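/- Let $K$ be an algebraically closed field and let $Q=(Q_0,Q_1,s,t)$ be a finite connected quiver with $|Q_0|\ge 3$ in which exactly two arrows start and exactly two arrows end at each vertex. For an arrow $\alpha$ let $\bar\alpha\neq\alpha$ be the other arrow with $s(\bar\alpha)=s(\alpha)$. Let $f$ be a permutation of $Q_1$ with $t(\alpha)=s(f(\alpha))$ for all $\alpha$ and $f^3=1$, and put $g(\alpha)=\overline{f(\alpha)}$. For each arrow $\alpha$ let $m_\alpha\in\mathbb{N}_{\geq 1}$ and $c_\alpha\in K\setminus\{0\}$, both constant on $g$-cycles; let $n_\alpha$ be the length of the $g$-cycle of $\alpha$ and $A_\alpha=\alpha g(\alpha)\cdots g^{m_\alpha n_\alpha-2}(\alpha)$ (paths are composed from left to right). An arrow $\alpha$ is called virtual if $m_\alpha n_\alpha=2$. Assume that $m_\alpha n_\alpha\ge 2$ for all $\alpha$, that $m_\alpha n_\alpha\ge 3$ if $\bar\alpha$ is virtual and not a loop, and that $m_\alpha n_\alpha\ge 4$ if $\bar\alpha$ is a virtual loop. Let $\Lambda=KQ/I$ be the weighted surface algebra, where $I$ is the ideal generated by 1. $\alpha f(\alpha)-c_{\bar\alpha}A_{\bar\alpha}$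 for all arrows $\alpha$; 2. $\alpha f(\alpha)g(f(\alpha))$ for all arrows $\alpha$, unless $f^2(\alpha)$ is virtual, or $f(\bar\alpha)$ is virtual and $m_{\bar\alpha}=1$, $n_{\bar\alpha}=3$; 3. $\alpha g(\alpha)f(g(\alpha))$ for all arrows $\alpha$, unless $f(\alpha)$ is virtual, or $f^2(\alpha)$ is virtual and $m_{f(\alpha)}=1$, $n_{f(\alpha)}=3$. Modules are right $\Lambda$-modules; $P_v=e_v\Lambda$, $S_v=P_v/\operatorname{rad}P_v$, $\Omega(S_v)$ is the kernel of the projective cover $P_v\to S_v$, and $\Omega^{-1}(S_v)$ is the cokernel of an injective envelope of $S_v$. Assume that $\Lambda$ is neither of the following two algebras. * The singular spherical algebra: $Q$ has vertices $0,\dots,5$ and twelve arrows, the $f$-cycles are $(0\to1\to2\to0)$, $(0\to2\to3\to0)$, $(1\to4\to5\to1)$, $(4\to3\to5\to4)$, all $m_\alpha=1$, and the product of the parameters of the four $g$-cycles $(0\to1\to4\to3\to0)$, $(1\to2\to3\to5\to1)$, $(0\to2\to0)$, $(4\to5\to4)$ is $1$. * The singular triangle algebra (in its presentation by the triangular quiver):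 $Q$ has vertices $0,1,2$ and six arrows, the $f$-cycles are $(0\to1\to2\to0)$ and $(0\to2\to1\to0)$, the $g$-cycles $(0\to1\to0)$, $(1\to2\to1)$, $(2\to0\to2)$ have weights $1,2,2$, and their parameters $c_0,c_1,c_2$ satisfy $c_0^2c_1c_2=1$. Let $\alpha$ be an arrow such that $\bar\alpha$ is virtual and not a loop, and put $i=s(\alpha)$, $j=t(\alpha)$, $y=t(f(\bar\alpha))$. Then $P_i$ is an injective envelope of $S_i$, and with $\Omega^{-1}(S_i)=P_i/S_i$ there is an exact sequence of $\Lambda$-modules $$0\to\Omega^{-1}(S_i)\to P_y\to P_j\to\Omega(S_i)\to 0 .$$ Splicing it repeatedly with $0\to\Omega(S_i)\to P_i\to S_i\to0$ and $0\to S_i\to P_i\to\Omega^{-1}(S_i)\to 0$ gives a minimal projective resolution $$\cdots\to P_j\to P_i\to P_i\to P_y\to P_j\to P_i\to S_i\to 0$$ of $S_i$, and $S_i$ has period $4$, that is, $4$ is the least $p\ge1$ with $\Omega^p(S_i)\cong S_i$. -/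

import Mathlib

/-! ## Homological notions over a ring -/

section Homological

variable {R : Type*} [Ring R]

/-- A submodule `X` of `M` is superfluous if `N + X = M` forces `N = M`. -/
def IsSuperfluous {M : Type*} [AddCommGroup M] [Module R M] (X : Submodule R M) : Prop :=
  ∀ N : Submodule R M, N ⊔ X = ⊤ → N = ⊤

/-- A submodule `X` of `M` is essential if it meets every non-zero submodule. -/
def IsEssentialSubmodule {M : Type*} [AddCommGroup M] [Module R M] (X : Submodule R M) : Prop :=
  ∀ N : Submodule R M, N ⊓ X = ⊥ → N = ⊥

/-- `j : M → I` is an injective envelope: `I` is injective and `j` is an essential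
monomorphism. The cokernel `I / j(M)` is then `Ω⁻¹(M)`. -/
structure IsInjectiveEnvelope {M I : Type*} [AddCommGroup M] [Module R M]
    [AddCommGroup I] [Module R I] (j : M →ₗ[R] I) : Prop where
  injective_module : Module.Injective R I
  injective_map : Function.Injective j
  essential : IsEssentialSubmodule (LinearMap.range j)

/-- `⋯ → P 2 → P 1 → P 0 → M → 0` is a minimal projective resolution: it is exact, all `P n` are
projective, and each of the maps `ε`, `d 0`, `d 1`, … is a projective cover of its image. -/
structure IsMinimalProjectiveResolution (P : ℕ → Type*) [∀ n, AddCommGroup (P n)]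
    [∀ n, Module R (P n)] (d : ∀ n, P (n + 1) →ₗ[R] P n)
    {M : Type*} [AddCommGroup M] [Module R M] (ε : P 0 →ₗ[R] M) : Prop where
  projective : ∀ n, Module.Projective R (P n)
  surjective : Function.Surjective ε
  exact_zero : Function.Exact (d 0) ε
  exact_succ : ∀ n, Function.Exact (d (n + 1)) (d n)
  minimal_zero : IsSuperfluous (LinearMap.ker ε)
  minimal_succ : ∀ n, IsSuperfluous (LinearMap.ker (d n))

/-- For a minimal projective resolution `(P, d)` of `M` the image of `d n : P (n+1) → P n` is the
syzygy `Ω^(n+1)(M)`. The period of `M` is `p` if `p` is the least positive integer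
with `Ω^p(M) ≅ M`. -/
def HasPeriod (P : ℕ → Type*) [∀ n, AddCommGroup (P n)]
    [∀ n, Module R (P n)] (d : ∀ n, P (n + 1) →ₗ[R] P n)
    (M : Type*) [AddCommGroup M] [Module R M] (p : ℕ) : Prop :=
  IsLeast {q : ℕ | ∃ n, q = n + 1 ∧ Nonempty (LinearMap.range (d n) ≃ₗ[R] M)} p

/-- The sequence `i, j, y, i, i, j, y, i, …` of period four. -/
def periodicIndex {V : Type*} (i j y : V) : ℕ → V
  | 0 => i
  | 1 => j
  | 2 => y
  | 3 => i
  | n + 4 => periodicIndex i j y n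

/-- The infinite sequence of maps obtained by repeating `d₀, d₁, d₂, d₃`:
`⋯ → P_j → P_i → P_i → P_y → P_j → P_i`. -/
def periodicDifferential {V : Type*} {P : V → Type*} [∀ v, AddCommGroup (P v)]
    [∀ v, Module R (P v)] {i j y : V} (d₀ : P j →ₗ[R] P i) (d₁ : P y →ₗ[R] P j)
    (d₂ : P i →ₗ[R] P y) (d₃ : P i →ₗ[R] P i) :
    ∀ n : ℕ, P (periodicIndex i j y (n + 1)) →ₗ[R] P (periodicIndex i j y n)
  | 0 => d₀
  | 1 => d₁
  | 2 => d₂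
  | 3 => d₃
  | n + 4 => periodicDifferential d₀ d₁ d₂ d₃ n

end Homological

/-! ## Quivers and path algebras -/

/-- A quiver with vertex set `V` and arrow set `A`. -/
structure ArrowQuiver (V A : Type*) where
  s : A → V
  t : A → V

namespace ArrowQuiver

variable {V A : Type*}

/-- The underlying graph is connected. -/
def IsConnected (Q : ArrowQuiver V A) : Prop :=
  ∀ u v : V, Relation.EqvGen (fun x z => ∃ a, Q.s a = x ∧ Q.t a = z) u v

/-- Exactly two arrows start and exactly two arrows end at each vertex. -/
def IsTwoRegular (Q : ArrowQuiver V A) : Prop :=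
  ∀ v : V, Nat.card {a : A // Q.s a = v} = 2 ∧ Nat.card {a : A // Q.t a = v} = 2

/-- The defining relations of the path algebra on generators `e_v` (`v` a vertex) and the arrows.
Paths are composed from left to right: `a * b` is non-zero only if `t a = s b`. -/
inductive PathRel (K : Type*) [Field K] [Fintype V] (Q : ArrowQuiver V A) :
    FreeAlgebra K (V ⊕ A) → FreeAlgebra K (V ⊕ A) → Prop
  | idem (v : V) : PathRel K Q
      (FreeAlgebra.ι K (Sum.inl v) * FreeAlgebra.ι K (Sum.inl v)) (FreeAlgebra.ι K (Sum.inl v))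
  | orth (v w : V) (h : v ≠ w) : PathRel K Q
      (FreeAlgebra.ι K (Sum.inl v) * FreeAlgebra.ι K (Sum.inl w)) 0
  | one : PathRel K Q (∑ v : V, FreeAlgebra.ι K (Sum.inl v)) 1
  | source (a : A) : PathRel K Q
      (FreeAlgebra.ι K (Sum.inl (Q.s a)) * FreeAlgebra.ι K (Sum.inr a)) (FreeAlgebra.ι K (Sum.inr a))
  | target (a : A) : PathRel K Q
      (FreeAlgebra.ι K (Sum.inr a) * FreeAlgebra.ι K (Sum.inl (Q.t a))) (FreeAlgebra.ι K (Sum.inr a))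

/-- The path algebra `KQ`. -/
def PathAlgebra (K : Type*) [Field K] [Fintype V] (Q : ArrowQuiver V A) :=
  RingQuot (PathRel K Q)

noncomputable instance (K : Type*) [Field K] [Fintype V] (Q : ArrowQuiver V A) :
    Ring (Q.PathAlgebra K) :=
  inferInstanceAs (Ring (RingQuot (PathRel K Q)))

noncomputable instance (K : Type*) [Field K] [Fintype V] (Q : ArrowQuiver V A) :
    Algebra K (Q.PathAlgebra K) :=
  inferInstanceAs (Algebra K (RingQuot (PathRel K Q)))

/-- The path of length zero at `v`, in `KQ`. -/
noncomputable def vertex (K : Type*) [Field K] [Fintype V] (Q : ArrowQuiver V A) (v : V) :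
    PathAlgebra K Q :=
  RingQuot.mkAlgHom K (PathRel K Q) (FreeAlgebra.ι K (Sum.inl v))

/-- The arrow `a`, in `KQ`. -/
noncomputable def arrow (K : Type*) [Field K] [Fintype V] (Q : ArrowQuiver V A) (a : A) :
    PathAlgebra K Q :=
  RingQuot.mkAlgHom K (PathRel K Q) (FreeAlgebra.ι K (Sum.inr a))

end ArrowQuiver

/-! ## Weighted triangulation quivers -/

/-- A triangulation quiver `(Q, f)`. The map `bar` is the involution `α ↦ ᾱ`: since exactly two
arrows start at each vertex, it is determined by the two conditions on it. -/
structure TriangulationQuiver (V A : Type*) extends ArrowQuiver V A where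
  connected : toArrowQuiver.IsConnected
  twoRegular : toArrowQuiver.IsTwoRegular
  bar : A → A
  s_bar : ∀ a, s (bar a) = s a
  bar_ne : ∀ a, bar a ≠ a
  f : Equiv.Perm A
  t_eq_s_f : ∀ a, t a = s (f a)
  f_cubed : ∀ a, f (f (f a)) = a

namespace TriangulationQuiver

variable {V A : Type*}

/-- The permutation `g(α) = \overline{f(α)}` of the arrows. -/
def g (Q : TriangulationQuiver V A) (a : A) : A := Q.bar (Q.f a)

/-- `n_α`, the length of the `g`-cycle of `α`. -/
noncomputable def n (Q : TriangulationQuiver V A) (a : A) : ℕ := Function.minimalPeriod Q.g a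

end TriangulationQuiver

/-- The data `(Q, f, m, c)` of a general weighted surface algebra, subject to the standing
assumptions on the numbers `m_α n_α`. An arrow `α` is virtual if `m_α n_α = 2`. -/
structure WeightedTriangulationQuiver (V A K : Type*) [Field K]
    extends TriangulationQuiver V A where
  m : A → ℕ
  m_pos : ∀ a, 0 < m a
  m_g : ∀ a, m (toTriangulationQuiver.g a) = m a
  c : A → K
  c_ne_zero : ∀ a, c a ≠ 0
  c_g : ∀ a, c (toTriangulationQuiver.g a) = c a
  two_le : ∀ a, 2 ≤ m a * toTriangulationQuiver.n a
  three_le : ∀ a, m (bar a) * toTriangulationQuiver.n (bar a) = 2 → s (bar a) ≠ t (bar a) →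
    3 ≤ m a * toTriangulationQuiver.n a
  four_le : ∀ a, m (bar a) * toTriangulationQuiver.n (bar a) = 2 → s (bar a) = t (bar a) →
    4 ≤ m a * toTriangulationQuiver.n a

namespace WeightedTriangulationQuiver

variable {V A K : Type*} [Field K]

/-- The arrow `α` is virtual. -/
def IsVirtual (D : WeightedTriangulationQuiver V A K) (a : A) : Prop := D.m a * D.n a = 2

variable [Fintype V]

/-- The element `α g(α) ⋯ g^(k-1)(α)` of `KQ`. -/
noncomputable def gPath (D : WeightedTriangulationQuiver V A K) (a : A) (k : ℕ) :
    D.toArrowQuiver.PathAlgebra K :=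
  ((List.range k).map fun r => D.toArrowQuiver.arrow K (D.g^[r] a)).prod

/-- `A_α`, the path along the `g`-cycle of `α` of length `m_α n_α - 1` (a positive number). -/
noncomputable def pathA (D : WeightedTriangulationQuiver V A K) (a : A) :
    D.toArrowQuiver.PathAlgebra K :=
  D.gPath a (D.m a * D.n a - 1)

/-- The generators of the ideal `I(Q, f, m, c)`. -/
inductive Rel (D : WeightedTriangulationQuiver V A K) :
    D.toArrowQuiver.PathAlgebra K → D.toArrowQuiver.PathAlgebra K → Prop
  | triangle (a : A) : Rel D
      (D.toArrowQuiver.arrow K a * D.toArrowQuiver.arrow K (D.f a))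
      (D.c (D.bar a) • D.pathA (D.bar a))
  | zeta (a : A) (h₁ : ¬ D.IsVirtual (D.f (D.f a)))
      (h₂ : ¬ (D.IsVirtual (D.f (D.bar a)) ∧ D.m (D.bar a) = 1 ∧ D.n (D.bar a) = 3)) : Rel D
      (D.toArrowQuiver.arrow K a * D.toArrowQuiver.arrow K (D.f a) *
        D.toArrowQuiver.arrow K (D.g (D.f a))) 0
  | xi (a : A) (h₁ : ¬ D.IsVirtual (D.f a))
      (h₂ : ¬ (D.IsVirtual (D.f (D.f a)) ∧ D.m (D.f a) = 1 ∧ D.n (D.f a) = 3)) : Rel D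
      (D.toArrowQuiver.arrow K a * D.toArrowQuiver.arrow K (D.g a) *
        D.toArrowQuiver.arrow K (D.f (D.g a))) 0

/-- The weighted surface algebra `Λ = KQ / I(Q, f, m, c)`. -/
def Alg (D : WeightedTriangulationQuiver V A K) := RingQuot D.Rel

noncomputable instance (D : WeightedTriangulationQuiver V A K) : Ring D.Alg :=
  inferInstanceAs (Ring (RingQuot D.Rel))

noncomputable instance (D : WeightedTriangulationQuiver V A K) : Algebra K D.Alg :=
  inferInstanceAs (Algebra K (RingQuot D.Rel))

/-- The idempotent `e_v` of `Λ`. -/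
noncomputable def e (D : WeightedTriangulationQuiver V A K) (v : V) : D.Alg :=
  RingQuot.mkAlgHom K D.Rel (D.toArrowQuiver.vertex K v)

/-- The indecomposable projective right module `P_v = e_v Λ`, as a right ideal of `Λ`. Right
`Λ`-modules are modules over the opposite ring. -/
noncomputable def P (D : WeightedTriangulationQuiver V A K) (v : V) :
    Submodule (D.Alg)ᵐᵒᵖ D.Alg :=
  Submodule.span (D.Alg)ᵐᵒᵖ {D.e v}

/-- The simple module `S_v = P_v / rad P_v`. -/
abbrev S (D : WeightedTriangulationQuiver V A K) (v : V) :=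
  D.P v ⧸ Module.jacobson (D.Alg)ᵐᵒᵖ (D.P v)

/-- The canonical projective cover `P_v → S_v`. -/
noncomputable def cover (D : WeightedTriangulationQuiver V A K) (v : V) :
    D.P v →ₗ[(D.Alg)ᵐᵒᵖ] D.S v :=
  (Module.jacobson (D.Alg)ᵐᵒᵖ (D.P v)).mkQ

/-- The syzygy `Ω(S_v)`, the kernel of the projective cover `P_v → S_v`. -/
noncomputable def syzygy (D : WeightedTriangulationQuiver V A K) (v : V) :
    Submodule (D.Alg)ᵐᵒᵖ (D.P v) :=
  LinearMap.ker (D.cover v)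

end WeightedTriangulationQuiver

/-! ## The two exceptional algebras -/

/-- The two `f`-cycles `(0→1→2→0)` and `(0→2→1→0)` of the triangular quiver: `triangularSource T k`
is the source of the `k`-th arrow of the `T`-th cycle. -/
def triangularSource : Fin 2 → Fin 3 → Fin 3 := ![![0, 1, 2], ![0, 2, 1]]

/-- The four `f`-cycles `(0→1→2→0)`, `(0→2→3→0)`, `(1→4→5→1)`, `(4→3→5→4)` of the spherical quiver,
in the same format. Its `g`-cycles are `0→1→4→3→0`, `1→2→3→5→1`, `0→2→0`, `4→5→4`. -/
def sphericalSource : Fin 4 → Fin 3 → Fin 6 :=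
  ![![0, 1, 2], ![0, 2, 3], ![1, 4, 5], ![4, 3, 5]]

namespace WeightedTriangulationQuiver

variable {V A K : Type*} [Field K]

/-- `Λ` is the singular triangle algebra given by the triangular quiver: the `g`-cycles
`(0→1→0)`, `(1→2→1)`, `(2→0→2)` have weights `1, 2, 2`, and their parameters `c₀, c₁, c₂`
satisfy `c₀² c₁ c₂ = 1`. -/
def IsSingularTriangle (D : WeightedTriangulationQuiver V A K) : Prop :=
  ∃ (v : Fin 3 ≃ V) (a : Fin 2 × Fin 3 ≃ A),
    (∀ T k, D.s (a (T, k)) = v (triangularSource T k)) ∧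
    (∀ T k, D.f (a (T, k)) = a (T, k + 1)) ∧
    D.m (a (0, 0)) = 1 ∧ D.m (a (0, 1)) = 2 ∧ D.m (a (0, 2)) = 2 ∧
    D.c (a (0, 0)) ^ 2 * D.c (a (0, 1)) * D.c (a (0, 2)) = 1

/-- `Λ` is the singular spherical algebra: the quiver is spherical, all weights are `1`, and the
product of the parameters of the four `g`-cycles is `1`. -/
def IsSingularSpherical (D : WeightedTriangulationQuiver V A K) : Prop :=
  ∃ (v : Fin 6 ≃ V) (a : Fin 4 × Fin 3 ≃ A),
    (∀ T k, D.s (a (T, k)) = v (sphericalSource T k)) ∧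
    (∀ T k, D.f (a (T, k)) = a (T, k + 1)) ∧
    (∀ x, D.m x = 1) ∧
    D.c (a (0, 0)) * D.c (a (0, 1)) * D.c (a (1, 0)) * D.c (a (2, 1)) = 1

end WeightedTriangulationQuiver

/-! Write `κ = ᾱ`, `β = f(α)`, `σ = f²(α)`, `δ = f(κ)`, `ν = f²(κ)`. Since `κ` is virtual and not a
loop, two `f`-triangles `(α β σ)` and `(κ δ ν)` are glued along the `g`-cycle `(κ σ)`, with `g(β) =
δ` and `g(ν) = α`. The relation `αβ = c_κ κ` makes `κ` redundant as a generator, so `rad P_i = αΛ`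
and `P_j` alone covers `Ω(S_i)`. All maps of the resolution are left multiplications: by `α` from
`P_j` to `P_i`, by `ρ = βδ - c_κ c_α g(α)⋯` (`relator`) from `P_y` to `P_j`, by `ν` from `P_i` to
`P_y`, and by the socle element `ω`, the `g`-path of length `m_α n_α` from `α`, from `P_i` to `P_i`.
Consecutive products vanish by the relations.

Exactness is a leading term argument. The modules `P_i`, `P_j`, `P_y` are spanned by few short paths
and by initial segments of `g`-cycles; multiplying a long segment by an arrow lengthens it, leaves
the cycle with product zero, or lands in a longer segment (`walk_α_mul_mem`, `walk_g_mul_cases`).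
The kernels are then computed by looking at shortest terms (`eq_smul_of_ν_mul_eq_zero`,
`exists_relator_mul`, `exists_ν_mul`). The crux is `relator_mul_g`: `ρ g(δ)` is a multiple of the
`g`-path of length three from `β`, plus longer terms. The coefficient is `1`, except when `m_α n_α =
m_β n_β = 4` and `f(g(α))` is virtual, where it is `1 - c_κ c_α c_{f(g(α))} c_β`. If that number
vanishes, closing up the configuration shows that the whole quiver is the triangular or the
spherical one with singular parameters (`not_singular`), which is excluded.

Spanning sets do not show that anything is non-zero. For this, modules with an explicit basis,
modelled on `P_y` and `P_i`, are built (`isRep_outer`, `isRep_inner`); the full `g`-paths act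
non-trivially on them.

Injectivity of `P_i` holds because every non-zero element of `e_i Λ` can be multiplied on the right
into `ω`, and dually for `Λ e_i` by passing to the opposite quiver; this gives a perfect pairing
`e_i Λ × Λ e_i → K`. Minimality holds because the projectives involved are local, and the period is
not smaller than four because the first three syzygies are generated by elements not killed by all
arrows. -/

set_option linter.unusedSectionVars false

/-! ### The permutations `f`, `g` and the involution on arrows -/

namespace TriangulationQuiver

variable {V A : Type*} (Q : TriangulationQuiver V A)

theorem eq_or_eq_bar {a b : A} (h : Q.s b = Q.s a) : b = a ∨ b = Q.bar a := by
  obtain ⟨x, y, -, hxy⟩ := Nat.card_eq_two_iff.1 (Q.twoRegular (Q.s a)).1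
  have key : ∀ c : {c : A // Q.s c = Q.s a}, c = x ∨ c = y := fun c => by
    have : c ∈ ({x, y} : Set _) := hxy ▸ Set.mem_univ c
    simpa using this
  have h1 := key ⟨a, rfl⟩
  have h2 := key ⟨Q.bar a, Q.s_bar a⟩
  have h3 := key ⟨b, h⟩
  have h4 := Q.bar_ne a
  rcases h1 with h1 | h1 <;> rcases h2 with h2 | h2 <;> rcases h3 with h3 | h3 <;>
    simp only [← h1, ← h2, Subtype.mk.injEq] at h2 h3 <;> tauto

@[simp] theorem bar_bar (a : A) : Q.bar (Q.bar a) = a := by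
  rcases Q.eq_or_eq_bar (a := a) (b := Q.bar (Q.bar a)) (by rw [Q.s_bar, Q.s_bar]) with h | h
  · exact h
  · exact absurd h (Q.bar_ne _)

theorem bar_f (a : A) : Q.bar (Q.f a) = Q.g a := rfl

@[simp] theorem bar_g (a : A) : Q.bar (Q.g a) = Q.f a := Q.bar_bar _

theorem f_ne_g (a : A) : Q.f a ≠ Q.g a := fun h => Q.bar_ne (Q.f a) h.symm

/-- The preimage of `a` under `g` is `f²(ā)`. -/
theorem g_f_f_bar (a : A) : Q.g (Q.f (Q.f (Q.bar a))) = a := by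
  rw [g, Q.f_cubed, bar_bar]

theorem g_f_f (a : A) : Q.g (Q.f (Q.f a)) = Q.bar a := by
  rw [g, Q.f_cubed]

theorem g_injective : Function.Injective Q.g := fun a b h => by
  have h' : Q.f a = Q.f b := by rw [← Q.bar_g a, h, Q.bar_g]
  exact Q.f.injective h'

theorem s_g (a : A) : Q.s (Q.g a) = Q.t a := by rw [g, Q.s_bar, Q.t_eq_s_f]

theorem s_f (a : A) : Q.s (Q.f a) = Q.t a := (Q.t_eq_s_f a).symm

theorem eq_f_or_eq_g {a b : A} (h : Q.s b = Q.t a) : b = Q.f a ∨ b = Q.g a :=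
  Q.eq_or_eq_bar (h.trans (Q.t_eq_s_f a))

end TriangulationQuiver

/-! ### Numerical invariants of `g`-cycles and the neighbourhood of a virtual arrow -/

namespace WeightedTriangulationQuiver

variable {V A K : Type*} [Field K] (D : WeightedTriangulationQuiver V A K)

/-- The number `m_α n_α`. -/
noncomputable def N (a : A) : ℕ := D.m a * D.n a

theorem n_pos (a : A) : 0 < D.n a := by
  have := D.two_le a
  rcases Nat.eq_zero_or_pos (D.n a) with h | h
  · rw [show D.toTriangulationQuiver.n a = 0 from h] at this; omega
  · exact h

theorem n_g (a : A) : D.n (D.g a) = D.n a :=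
  Function.minimalPeriod_apply (Function.minimalPeriod_pos_iff_mem_periodicPts.1 (D.n_pos a))

theorem N_g (a : A) : D.N (D.g a) = D.N a := by
  rw [N, N, D.m_g, D.n_g]

theorem two_le_N (a : A) : 2 ≤ D.N a := D.two_le a

theorem iterate_N (a : A) : D.g^[D.N a] a = a := by
  have h : Function.IsPeriodicPt D.g (D.n a) a := Function.isPeriodicPt_minimalPeriod _ _
  exact h.const_mul (D.m a)

theorem iterate_N_sub_one (a : A) : D.g^[D.N a - 1] (D.g a) = a := by
  rw [← Function.iterate_succ_apply, Nat.succ_eq_add_one,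
    Nat.sub_add_cancel (by have := D.two_le_N a; omega), D.iterate_N]

theorem N_iterate (a : A) (k : ℕ) : D.N (D.g^[k] a) = D.N a := by
  induction k with
  | zero => rfl
  | succ k ih => rw [Function.iterate_succ_apply', D.N_g, ih]

theorem c_iterate (a : A) (k : ℕ) : D.c (D.g^[k] a) = D.c a := by
  induction k with
  | zero => rfl
  | succ k ih => rw [Function.iterate_succ_apply', D.c_g, ih]

theorem three_le_N {a : A} (h : D.N (D.bar a) = 2) : 3 ≤ D.N a := by
  by_cases hl : D.s (D.bar a) = D.t (D.bar a)
  · have := D.four_le a h hl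
    exact le_trans (by norm_num) this
  · exact D.three_le a h hl

/-- The product `m n = 3` also allows a fixed point of `g` of weight `3`. Excluding it leaves `m =
1`, `n = 3`, the form in which the exceptions to the zero relations are stated. -/
theorem m_eq_one_of_N_eq_three {a : A} (h : D.N a = 3) (hg : D.g a ≠ a) :
    D.m a = 1 ∧ D.n a = 3 := by
  have h1 : D.n a ≠ 1 := fun h1 => hg (Function.minimalPeriod_eq_one_iff_isFixedPt.1 h1)
  have h2 : D.n a ∣ 3 := ⟨D.m a, by rw [← h, N, mul_comm]⟩
  rcases (Nat.dvd_prime Nat.prime_three).1 h2 with h3 | h3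
  · exact absurd h3 h1
  · rw [N, h3] at h
    exact ⟨by omega, h3⟩

/-- For a virtual arrow `f(d)` the `g`-cycle of `f(d)` consists of `f(d)` and `g(f(d))`. -/
theorem g_g_of_virtual {a : A} (h : D.N a = 2) : D.g (D.g a) = a := by
  have := D.iterate_N a
  rwa [h] at this

/-- The configuration around a virtual arrow `κ = ᾱ` that is not a loop: two `f`-cycles
`(α β σ)` and `(κ δ ν)` glued along the virtual `g`-cycle `(κ σ)`. -/
structure Quad (α κ β σ δ ν : A) : Prop where
  bar_α : D.bar α = κ
  f_α : D.f α = β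
  f_β : D.f β = σ
  f_σ : D.f σ = α
  f_κ : D.f κ = δ
  f_δ : D.f δ = ν
  f_ν : D.f ν = κ
  bar_σ : D.bar σ = δ
  N_κ : D.N κ = 2
  s_ne : D.s α ≠ D.s σ

variable {D}

/-- Both `g(κ)` and `f²(α)` are preimages of `κ` under `g`, the first because `g²(κ) = κ`. Hence the
virtual cycle is `(κ σ)`, and that `κ` is not a loop says that `α` and `σ` start at different
vertices. -/
theorem quad_of_virtual {α : A} (hv : D.IsVirtual (D.bar α))
    (hl : D.s (D.bar α) ≠ D.t (D.bar α)) :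
    D.Quad α (D.bar α) (D.f α) (D.f (D.f α)) (D.f (D.bar α)) (D.f (D.f (D.bar α))) := by
  have h1 : D.g (D.g (D.bar α)) = D.bar α := D.g_g_of_virtual hv
  have h2 : D.g (D.bar α) = D.f (D.f α) := by
    apply D.g_injective
    rw [h1, D.g_f_f]
  refine ⟨rfl, rfl, rfl, D.f_cubed _, rfl, rfl, D.f_cubed _, ?_, hv, ?_⟩
  · rw [← h2, D.bar_g]
  · rw [← h2, D.s_g, ← D.s_bar]
    exact hl

namespace Quad

variable {α κ β σ δ ν : A} (q : D.Quad α κ β σ δ ν)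

include q

theorem bar_κ : D.bar κ = α := by rw [← q.bar_α, D.bar_bar]

theorem bar_δ : D.bar δ = σ := by rw [← q.bar_σ, D.bar_bar]

theorem g_κ : D.g κ = σ := by rw [← D.bar_f, q.f_κ, q.bar_δ]

theorem g_σ : D.g σ = κ := by rw [← D.bar_f, q.f_σ, q.bar_α]

theorem g_β : D.g β = δ := by rw [← D.bar_f, q.f_β, q.bar_σ]

theorem g_ν : D.g ν = α := by rw [← D.bar_f, q.f_ν, q.bar_κ]

theorem bar_β : D.bar β = D.g α := by rw [← D.bar_f, q.f_α]

theorem bar_ν : D.bar ν = D.g δ := by rw [← D.bar_f, q.f_δ]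

theorem N_σ : D.N σ = 2 := by rw [← q.g_κ, D.N_g, q.N_κ]

/-- The symmetry of the configuration: seen from the other vertex of the virtual cycle, `δ` and `σ`
play the roles of `α` and `κ`. It exchanges the vertices `j = s(β)` and `y = s(ν)`, as well as the
numbers `N α` and `N β`, so most facts below are needed for one side only. -/
theorem swap : D.Quad δ σ ν κ α β where
  bar_α := q.bar_δ
  f_α := q.f_δ
  f_β := q.f_ν
  f_σ := q.f_κ
  f_κ := q.f_σ
  f_δ := q.f_α
  f_ν := q.f_β
  bar_σ := q.bar_κ
  N_κ := q.N_σ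
  s_ne := by
    rw [← q.bar_σ, ← q.bar_α, D.s_bar, D.s_bar]
    exact q.s_ne.symm

theorem N_ν : D.N ν = D.N α := by rw [← q.g_ν, D.N_g]

theorem N_δ : D.N δ = D.N β := by rw [← q.g_β, D.N_g]

theorem c_ν : D.c ν = D.c α := by rw [← q.g_ν, D.c_g]

theorem c_δ : D.c δ = D.c β := by rw [← q.g_β, D.c_g]

theorem c_σ : D.c σ = D.c κ := by rw [← q.g_κ, D.c_g]

theorem three_le : 3 ≤ D.N α := D.three_le_N (by rw [q.bar_α, q.N_κ])

theorem three_le' : 3 ≤ D.N β := by rw [← q.N_δ]; exact q.swap.three_le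

theorem β_ne_ν : β ≠ ν := fun h => q.s_ne <| by
  rw [← q.f_β, h, q.f_ν, ← q.bar_α, D.s_bar]

theorem α_ne_β : α ≠ β := fun h => q.s_ne <| by
  rw [← q.f_β, ← h, q.f_α, ← h]

theorem α_ne_δ : α ≠ δ := fun h => q.s_ne <| by
  rw [h, ← q.bar_σ, D.s_bar]

theorem α_ne_ν : α ≠ ν := fun h => q.α_ne_β <| by
  have h1 : β = κ := by rw [← q.f_α, h, q.f_ν]
  have h2 := q.three_le'
  rw [h1, q.N_κ] at h2
  omega

theorem g_g_of_N_eq_three (h : D.N α = 3) : D.g (D.g α) = ν := by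
  apply D.g_injective
  have := D.iterate_N α
  rw [h] at this
  rw [q.g_ν]
  exact this

theorem f_g_of_N_eq_three (h : D.N α = 3) : D.f (D.g α) = D.g δ := by
  rw [← q.bar_ν, ← q.g_g_of_N_eq_three h, D.bar_g]

theorem g_f_f_g : D.g (D.f (D.f (D.g δ))) = ν := by
  rw [← q.bar_ν, D.g_f_f_bar]

theorem N_f_f_g : D.N (D.f (D.f (D.g δ))) = D.N α := by
  rw [← D.N_g, q.g_f_f_g, q.N_ν]

/-- Otherwise `f` exchanges `g(α)` and `g(δ)`. As `f³ = 1` these coincide, hence `β = ν`, against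
the virtual arrow not being a loop. -/
theorem not_both_three : ¬ (D.N α = 3 ∧ D.N β = 3) := fun ⟨h1, h2⟩ => by
  have h3 := q.f_g_of_N_eq_three h1
  have h4 := q.swap.f_g_of_N_eq_three (by rw [q.N_δ, h2])
  have h5 := D.f_cubed (D.g α)
  rw [h3, h4, h3] at h5
  apply q.β_ne_ν
  have h6 : D.bar β = D.bar ν := by rw [q.bar_β, q.bar_ν, h5]
  rw [← D.bar_bar β, h6, D.bar_bar]

/-- The value `4` is impossible: it would give `g²(α) = f²(g(δ))`, while `N β = 3` gives `f(g(δ)) =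
g(α)`, so that `g` and `f` would agree at `g(α)`. The bound keeps the exceptional terms caused by `N
β = 3` far enough along the cycle of `α`. -/
theorem five_le_of_N_eq_three (h : D.N β = 3) : 5 ≤ D.N α := by
  have h1 := q.three_le
  have h2 : D.N α ≠ 3 := fun h2 => q.not_both_three ⟨h2, h⟩
  have h3 : D.N α ≠ 4 := fun h3 => by
    have h4 : D.g (D.g α) = D.f (D.f (D.g δ)) := by
      apply D.g_injective
      apply D.g_injective
      have := D.iterate_N α
      rw [h3] at this
      rw [q.g_f_f_g, q.g_ν]
      exact this
    rw [q.swap.f_g_of_N_eq_three (by rw [q.N_δ, h])] at h4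
    exact D.f_ne_g _ h4.symm
  omega

theorem five_le_of_N_eq_three' (h : D.N α = 3) : 5 ≤ D.N β := by
  rw [← q.N_δ]
  exact q.swap.five_le_of_N_eq_three (by rw [q.N_ν, h])

theorem f_g_of_N_eq_three' (h : D.N β = 3) : D.f (D.g δ) = D.g α :=
  q.swap.f_g_of_N_eq_three (by rw [q.N_δ, h])

theorem g_f_g_of_N_eq_three (h : D.N α = 3) : D.g (D.f (D.g δ)) = β := by
  rw [← q.f_g_of_N_eq_three h, D.g_f_f, ← q.bar_β, D.bar_bar]

theorem N_f_g_of_N_eq_three (h : D.N α = 3) : D.N (D.f (D.g δ)) = D.N β := by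
  rw [← D.N_g, q.g_f_g_of_N_eq_three h]

theorem not_virtual_f_g_of_N_eq_three (h : D.N α = 3) : D.N (D.f (D.g δ)) ≠ 2 := by
  rw [q.N_f_g_of_N_eq_three h]
  have := q.three_le'
  omega

theorem not_virtual_f_g_of_N_eq_three' (h : D.N β = 3) : D.N (D.f (D.g δ)) ≠ 2 := by
  rw [q.f_g_of_N_eq_three' h, D.N_g]
  have := q.three_le
  omega

theorem mn_ν (h : D.N α = 3) : D.m ν = 1 ∧ D.n ν = 3 :=
  D.m_eq_one_of_N_eq_three (q.N_ν.trans h) fun h1 => q.α_ne_ν <| by rw [← q.g_ν, h1]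

theorem mn_β (h : D.N β = 3) : D.m β = 1 ∧ D.n β = 3 :=
  q.swap.mn_ν (by rw [q.N_δ, h])

theorem iterate_α : D.g^[D.N α - 1] α = ν := by
  have := D.iterate_N_sub_one ν
  rwa [q.g_ν, q.N_ν] at this

theorem iterate_g_α : D.g^[D.N α - 2] (D.g α) = ν := by
  rw [← Function.iterate_succ_apply, ← q.iterate_α]
  have := q.three_le
  congr 2
  omega

end Quad

end WeightedTriangulationQuiver

/-! ### The defining relations in an arbitrary algebra -/

namespace WeightedTriangulationQuiver

variable {V A K : Type*} [Field K] [Fintype V] {D : WeightedTriangulationQuiver V A K}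
  {R : Type*} [Ring R] [Algebra K R]

/-- The product `ar(a) ar(g(a)) ⋯ ar(g^(k-1)(a))`. -/
def walk (D : WeightedTriangulationQuiver V A K) (ar : A → R) (a : A) (k : ℕ) : R :=
  ((List.range k).map fun r => ar (D.g^[r] a)).prod

/-- Elements of a `K`-algebra satisfying the defining relations of the weighted surface
algebra. -/
structure IsRep (D : WeightedTriangulationQuiver V A K) (ee : V → R) (ar : A → R) : Prop where
  idem : ∀ v, ee v * ee v = ee v
  orth : ∀ v w, v ≠ w → ee v * ee w = 0
  one : ∑ v, ee v = 1
  source : ∀ a, ee (D.s a) * ar a = ar a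
  target : ∀ a, ar a * ee (D.t a) = ar a
  triangle : ∀ a, ar a * ar (D.f a) = D.c (D.bar a) • D.walk ar (D.bar a) (D.N (D.bar a) - 1)
  zeta : ∀ a, D.N (D.f (D.f a)) ≠ 2 →
    ¬ (D.N (D.f (D.bar a)) = 2 ∧ D.m (D.bar a) = 1 ∧ D.n (D.bar a) = 3) →
    ar a * ar (D.f a) * ar (D.g (D.f a)) = 0
  xi : ∀ a, D.N (D.f a) ≠ 2 →
    ¬ (D.N (D.f (D.f a)) = 2 ∧ D.m (D.f a) = 1 ∧ D.n (D.f a) = 3) →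
    ar a * ar (D.g a) * ar (D.f (D.g a)) = 0

section Walk

variable (ar : A → R)

@[simp] theorem walk_zero (a : A) : D.walk ar a 0 = 1 := rfl

@[simp] theorem walk_one (a : A) : D.walk ar a 1 = ar a := by simp [walk]

theorem walk_succ (a : A) (k : ℕ) :
    D.walk ar a (k + 1) = D.walk ar a k * ar (D.g^[k] a) := by
  simp [walk, List.range_succ]

theorem walk_succ' (a : A) (k : ℕ) :
    D.walk ar a (k + 1) = ar a * D.walk ar (D.g a) k := by
  simp [walk, List.range_succ_eq_map, Function.comp_def]

theorem walk_add (a : A) (k l : ℕ) :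
    D.walk ar a (k + l) = D.walk ar a k * D.walk ar (D.g^[k] a) l := by
  induction l with
  | zero => simp
  | succ l ih =>
    rw [← add_assoc, walk_succ, ih, walk_succ, mul_assoc, ← Function.iterate_add_apply,
      add_comm l k]

theorem walk_two (a : A) : D.walk ar a 2 = ar a * ar (D.g a) := by
  rw [walk_succ, walk_one]; rfl

end Walk

namespace IsRep

variable {ee : V → R} {ar : A → R} (h : D.IsRep ee ar)

include h

theorem mul_eq_zero_of_ne {a b : A} (hab : D.s b ≠ D.t a) : ar a * ar b = 0 := by
  rw [← h.target a, ← h.source b, mul_assoc, ← mul_assoc (ee _), h.orth _ _ hab.symm]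
  simp

theorem ee_mul_of_ne {v : V} {b : A} (hab : D.s b ≠ v) : ee v * ar b = 0 := by
  rw [← h.source b, ← mul_assoc, h.orth _ _ hab.symm, zero_mul]

theorem mul_ee_of_ne {v : V} {a : A} (hab : D.t a ≠ v) : ar a * ee v = 0 := by
  rw [← h.target a, mul_assoc, h.orth _ _ hab, mul_zero]

theorem ee_mul_walk (a : A) {k : ℕ} (hk : k ≠ 0) :
    ee (D.s a) * D.walk ar a k = D.walk ar a k := by
  obtain ⟨k, rfl⟩ := Nat.exists_eq_succ_of_ne_zero hk
  rw [Nat.succ_eq_add_one, walk_succ', ← mul_assoc, h.source]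

theorem walk_mul_ee (a : A) {k : ℕ} (hk : k ≠ 0) :
    D.walk ar a k * ee (D.s (D.g^[k] a)) = D.walk ar a k := by
  obtain ⟨k, rfl⟩ := Nat.exists_eq_succ_of_ne_zero hk
  rw [Nat.succ_eq_add_one, walk_succ, mul_assoc, Function.iterate_succ_apply', D.s_g, h.target]

theorem walk_mul_of_ne (a b : A) {k : ℕ} (hk : k ≠ 0) (hb : D.s b ≠ D.s (D.g^[k] a)) :
    D.walk ar a k * ar b = 0 := by
  rw [← h.walk_mul_ee a hk, mul_assoc, h.ee_mul_of_ne hb, mul_zero]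

/-- The path `α g(α) ⋯` of length `m_α n_α`, multiplied by `c_α`, depends only on the source. -/
theorem c_smul_walk_N (a : A) :
    D.c a • D.walk ar a (D.N a) = ar (D.bar a) * ar (D.f (D.bar a)) * ar (D.f (D.f (D.bar a))) := by
  have h1 := h.triangle (D.bar a)
  rw [D.bar_bar] at h1
  have h2 : D.N a = D.N a - 1 + 1 := by have := D.two_le_N a; omega
  have h3 : D.g^[D.N a - 1] a = D.f (D.f (D.bar a)) := by
    apply D.g_injective
    rw [D.g_f_f_bar, ← Function.iterate_succ_apply' D.g, Nat.succ_eq_add_one, ← h2, D.iterate_N]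
  rw [h1, smul_mul_assoc]
  conv_lhs => rw [h2, walk_succ, h3]

/-- `ā` lies on the virtual cycle of `f²(a)`, so `A_ā` is the single arrow `ā`; a second triangle
relation, at `ā`, then applies. This is the value of the product in the first exception to the
relations of type `zeta`. -/
theorem triangle_mul_of_virtual {a : A} (hv : D.N (D.f (D.f a)) = 2) :
    ar a * ar (D.f a) * ar (D.g (D.f a)) = (D.c (D.bar a) * D.c a) • D.walk ar a (D.N a - 1) := by
  have h1 : D.N (D.bar a) = 2 := by rw [← D.g_f_f, D.N_g, hv]
  have h2 : D.g (D.f a) = D.f (D.bar a) := by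
    have h3 := D.g_g_of_virtual hv
    rw [D.g_f_f] at h3
    rw [← D.bar_g (D.bar a), h3, D.bar_f]
  have h3 := h.triangle (D.bar a)
  rw [D.bar_bar] at h3
  rw [h.triangle, h1, walk_one, h2, smul_mul_assoc, h3, smul_smul]

theorem mul_triangle_of_virtual {a : A} (hv : D.N (D.f a) = 2) :
    ar a * ar (D.g a) * ar (D.f (D.g a)) =
      (D.c (D.f a) * D.c (D.bar a)) • D.walk ar (D.bar a) (D.N (D.bar a) - 1) := by
  rw [mul_assoc, h.triangle, D.bar_g, hv, walk_one, mul_smul_comm, h.triangle, smul_smul]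

/-- The second exception is treated by rewriting `a f(a)` as the path `ā g(ā)` of length two, whose
product with the next arrow is again evaluated by the virtual arrow `f(ā)`. So also an exceptional
product is a multiple of `A_a`, a path along the cycle of `a`. -/
theorem zeta_general (a : A) : ar a * ar (D.f a) * ar (D.g (D.f a)) = 0 ∨
    ((D.N (D.f (D.f a)) = 2 ∨ (D.N (D.f (D.bar a)) = 2 ∧ D.N (D.bar a) = 3)) ∧
      ∃ r : K, ar a * ar (D.f a) * ar (D.g (D.f a)) = r • D.walk ar a (D.N a - 1)) := by
  by_cases h1 : D.N (D.f (D.f a)) = 2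
  · exact Or.inr ⟨Or.inl h1, _, h.triangle_mul_of_virtual h1⟩
  by_cases h2 : D.N (D.f (D.bar a)) = 2 ∧ D.m (D.bar a) = 1 ∧ D.n (D.bar a) = 3
  · have h3 : D.N (D.bar a) = 3 := by rw [N, h2.2.1, h2.2.2]
    refine Or.inr ⟨Or.inr ⟨h2.1, h3⟩, ?_⟩
    have h4 := h.mul_triangle_of_virtual h2.1
    have h5 : D.f (D.g (D.bar a)) = D.g (D.f a) := by
      have h6 : D.g (D.g (D.bar a)) = D.f (D.f a) := by
        apply D.g_injective
        have h7 := D.iterate_N (D.bar a)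
        rw [h3] at h7
        rw [D.g_f_f]
        exact h7
      rw [← D.bar_g (D.g (D.bar a)), h6, D.bar_f]
    rw [D.bar_bar] at h4
    refine ⟨D.c (D.bar a) * (D.c (D.f (D.bar a)) * D.c a), ?_⟩
    rw [h.triangle, h3, show 3 - 1 = 2 from rfl, walk_two, smul_mul_assoc, ← h5, h4, smul_smul]
  · exact Or.inl (h.zeta a h1 h2)

theorem xi_general (a : A) : ar a * ar (D.g a) * ar (D.f (D.g a)) = 0 ∨
    (D.N (D.f a) = 2 ∧ ∃ r : K, ar a * ar (D.g a) * ar (D.f (D.g a)) =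
      r • D.walk ar (D.bar a) (D.N (D.bar a) - 1)) ∨
    (D.N (D.f (D.f a)) = 2 ∧ D.N (D.f a) = 3 ∧
      ∃ r : K, ar a * ar (D.g a) * ar (D.f (D.g a)) = r • D.walk ar a (D.N a - 1)) := by
  by_cases h1 : D.N (D.f a) = 2
  · exact Or.inr (Or.inl ⟨h1, _, h.mul_triangle_of_virtual h1⟩)
  by_cases h2 : D.N (D.f (D.f a)) = 2 ∧ D.m (D.f a) = 1 ∧ D.n (D.f a) = 3
  · have h3 : D.N (D.f a) = 3 := by rw [N, h2.2.1, h2.2.2]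
    refine Or.inr (Or.inr ⟨h2.1, h3, D.c (D.f a) * (D.c (D.bar a) * D.c a), ?_⟩)
    rw [mul_assoc, h.triangle, D.bar_g, h3, show 3 - 1 = 2 from rfl, walk_two, mul_smul_comm,
      ← mul_assoc, h.triangle_mul_of_virtual h2.1, smul_smul]
  · exact Or.inl (h.xi a h1 h2)

end IsRep

/-! ### Products of paths near the virtual arrow -/

namespace Quad

variable {α κ β σ δ ν : A} (q : D.Quad α κ β σ δ ν) {ee : V → R} {ar : A → R}
  (h : D.IsRep ee ar)

include q h

theorem ar_α_mul_β : ar α * ar β = D.c κ • ar κ := by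
  have := h.triangle α
  rwa [q.f_α, q.bar_α, q.N_κ, show 2 - 1 = 1 from rfl, walk_one] at this

theorem ar_β_mul_σ : ar β * ar σ = D.c α • D.walk ar (D.g α) (D.N α - 1) := by
  have := h.triangle β
  rwa [q.f_β, q.bar_β, D.N_g, D.c_g] at this

theorem ar_κ_mul_δ : ar κ * ar δ = D.c α • D.walk ar α (D.N α - 1) := by
  have := h.triangle κ
  rwa [q.f_κ, q.bar_κ] at this

theorem ar_δ_mul_ν : ar δ * ar ν = D.c κ • ar σ := by
  rw [q.swap.ar_α_mul_β h, q.c_σ]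

theorem ar_ν_mul_κ : ar ν * ar κ = D.c β • D.walk ar (D.g δ) (D.N β - 1) := by
  rw [q.swap.ar_β_mul_σ h, q.c_δ, q.N_δ]

theorem ar_κ_mul_σ : ar κ * ar σ = (D.c α * (D.c κ)⁻¹) • D.walk ar α (D.N α) := by
  have h1 : D.c κ • (ar κ * ar σ) = D.c α • D.walk ar α (D.N α) := by
    rw [h.c_smul_walk_N, q.bar_α, q.f_κ, q.f_δ, mul_assoc, q.ar_δ_mul_ν h, mul_smul_comm]
  rw [mul_comm, mul_smul, ← h1, inv_smul_smul₀ (D.c_ne_zero κ)]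

theorem κσα : ar κ * ar σ * ar α = 0 := by
  have := h.xi κ (by rw [q.f_κ, q.N_δ]; have := q.three_le'; omega)
    (by rw [q.f_κ, q.f_δ, q.N_ν]; have := q.three_le; omega)
  rwa [q.g_κ, q.f_σ] at this

theorem κδg : ar κ * ar δ * ar (D.g δ) = 0 := by
  have := h.zeta κ (by rw [q.f_κ, q.f_δ, q.N_ν]; have := q.three_le; omega)
    (by rw [q.bar_κ, q.f_α]; have := q.three_le'; omega)
  rwa [q.f_κ] at this

/-- The zero relation at `ν` could only be suspended if `f(g(δ))` were virtual with `N β = 3`; but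
then `f(g(δ)) = g(α)`, whose invariant `N α` is at least `3`. -/
theorem νκσ : ar ν * ar κ * ar σ = 0 := by
  have := h.zeta ν (by rw [q.f_ν, q.f_κ, q.N_δ]; have := q.three_le'; omega)
    (by
      rw [q.bar_ν]
      rintro ⟨h1, h2, h3⟩
      refine q.not_virtual_f_g_of_N_eq_three' ?_ h1
      rw [← q.N_δ, ← D.N_g, N, h2, h3])
  rwa [q.f_ν, q.g_κ] at this

/-- Up to a non-zero scalar the path is `κσ`. It kills `α` by `κσα = 0`, and it kills `κ` because
`κ` is a multiple of `αβ` and `βσκ = 0` by symmetry. So the full `g`-path lies in the socle. -/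
theorem walk_α_mul (x : A) : D.walk ar α (D.N α) * ar x = 0 := by
  have h1 : D.c α • (D.walk ar α (D.N α) * ar x) = D.c κ • (ar κ * ar σ * ar x) := by
    rw [q.ar_κ_mul_σ h, smul_mul_assoc, smul_smul, mul_comm (D.c α),
      mul_inv_cancel_left₀ (D.c_ne_zero κ)]
  have h2 : D.c κ • (ar κ * ar σ * ar x) = 0 := by
    by_cases hx : D.s x = D.s α
    · rcases D.eq_or_eq_bar hx with rfl | rfl
      · rw [q.κσα h, smul_zero]
      · rw [q.bar_α, ← smul_mul_assoc, ← smul_mul_assoc, ← q.ar_α_mul_β h, mul_assoc, mul_assoc,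
          ← mul_assoc (ar β)]
        have := q.swap.νκσ h
        rw [this, mul_zero]
    · rw [mul_assoc, h.mul_eq_zero_of_ne (a := σ), mul_zero, smul_zero]
      rwa [← D.s_f, q.f_σ]
  rw [h2] at h1
  exact (smul_eq_zero.1 h1).resolve_left (D.c_ne_zero α)

/-- The two full `g`-paths starting at `y` are proportional: both are expressed through `νκδ`. -/
theorem c_smul_walk_g : D.c β • D.walk ar (D.g δ) (D.N β) =
    D.c α • D.walk ar ν (D.N α) := by
  have h1 := h.c_smul_walk_N (D.g δ)
  rw [D.c_g, q.c_δ, D.N_g, q.N_δ, ← q.bar_ν, D.bar_bar, q.f_ν, q.f_κ, mul_assoc,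
    q.ar_κ_mul_δ h, mul_smul_comm] at h1
  rw [← q.bar_ν, h1]
  have h2 : D.N α = D.N α - 1 + 1 := by have := q.three_le; omega
  conv_rhs => rw [h2, walk_succ', q.g_ν]

/-- The path is a multiple of `νκδ`, and `νκδν` is a multiple of `νκσ = 0`, while `κδ g(δ) = 0`. -/
theorem walk_g_mul (x : A) : D.walk ar (D.g δ) (D.N β) * ar x = 0 := by
  have hN : D.N β = D.N β - 1 + 1 := by have := q.three_le'; omega
  have h3 : D.g^[D.N β - 1] (D.g δ) = δ := by
    have := D.iterate_N_sub_one δ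
    rwa [q.N_δ] at this
  have h1 : D.c β • (D.walk ar (D.g δ) (D.N β) * ar x) = ar ν * ar κ * ar δ * ar x := by
    rw [q.ar_ν_mul_κ h, smul_mul_assoc, smul_mul_assoc]
    conv_lhs => rw [hN, walk_succ, h3]
  have h2 : ar ν * ar κ * ar δ * ar x = 0 := by
    by_cases hx : D.s x = D.s ν
    · rcases D.eq_or_eq_bar hx with rfl | rfl
      · rw [mul_assoc, q.ar_δ_mul_ν h, mul_smul_comm, q.νκσ h, smul_zero]
      · rw [q.bar_ν, mul_assoc (ar ν), mul_assoc, q.κδg h, mul_zero]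
    · rw [mul_assoc, h.mul_eq_zero_of_ne (a := δ), mul_zero]
      rwa [← D.s_f, q.f_δ]
  rw [h2] at h1
  exact (smul_eq_zero.1 h1).resolve_left (D.c_ne_zero β)

theorem walk_g_eq_zero {k : ℕ} (hk : D.N β < k) : D.walk ar (D.g δ) k = 0 := by
  obtain ⟨l, rfl⟩ := Nat.exists_eq_add_of_lt hk
  rw [add_assoc, walk_add, walk_succ', ← mul_assoc, q.walk_g_mul h, zero_mul]

theorem walk_β_mul (x : A) : D.walk ar β (D.N β) * ar x = 0 := by
  have h1 := q.swap.c_smul_walk_g h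
  have h2 := q.swap.walk_g_mul h x
  rw [q.N_ν] at h1 h2
  rw [q.c_ν, q.c_δ, q.N_δ] at h1
  have h3 : D.c β • (D.walk ar β (D.N β) * ar x) = 0 := by
    rw [← smul_mul_assoc, ← h1, smul_mul_assoc, h2, smul_zero]
  exact (smul_eq_zero.1 h3).resolve_left (D.c_ne_zero β)

theorem walk_β_eq_zero {k : ℕ} (hk : D.N β < k) : D.walk ar β k = 0 := by
  obtain ⟨l, rfl⟩ := Nat.exists_eq_add_of_lt hk
  rw [add_assoc, walk_add, walk_succ', ← mul_assoc, q.walk_β_mul h, zero_mul]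

theorem walk_g_one_mul : ar (D.g δ) * ar (D.f (D.g δ)) = D.c α • D.walk ar ν (D.N α - 1) := by
  rw [h.triangle, ← q.bar_ν, D.bar_bar, q.N_ν, q.c_ν]

theorem walk_g_two_mul_of_virtual (hv : D.N (D.f (D.g δ)) = 2) :
    D.walk ar (D.g δ) 2 * ar (D.f (D.g (D.g δ))) =
      (D.c (D.f (D.g δ)) * D.c α) • D.walk ar ν (D.N α - 1) := by
  rw [walk_two, h.mul_triangle_of_virtual hv, ← q.bar_ν, D.bar_bar, q.N_ν, q.c_ν]

theorem walk_g_two_mul_of_not_virtual (hv : D.N (D.f (D.g δ)) ≠ 2) :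
    D.walk ar (D.g δ) 2 * ar (D.f (D.g (D.g δ))) = 0 := by
  rw [walk_two]
  refine h.xi _ hv ?_
  rw [q.N_f_f_g]
  have := q.three_le
  omega

/-- The last two arrows of the path together with the arrow leaving the cycle form a product of type
`xi`. If it is exceptional it turns into a path along some `g`-cycle; one further relation brings
this back to the original cycle, with total length at least the full one unless it vanishes. Only
the socle element can survive. -/
theorem walk_g_mul_f_mem (m : ℕ) :
    ∃ r : K, D.walk ar (D.g δ) (m + 3) * ar (D.f (D.g^[m + 2] (D.g δ))) =
      r • D.walk ar (D.g δ) (D.N β) := by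
  have hR := q.three_le'
  set a := D.g δ with ha
  set d' := D.g^[m] a with hd'
  have hNa : D.N a = D.N β := by rw [ha, D.N_g, q.N_δ]
  have hd : D.g^[m + 1] a = D.g d' := Function.iterate_succ_apply' _ _ _
  have hgd : D.g^[m + 2] a = D.g (D.g d') := by rw [Function.iterate_succ_apply', hd]
  have hNd' : D.N d' = D.N β := by rw [hd', D.N_iterate, hNa]
  have h1 : D.walk ar a (m + 3) * ar (D.f (D.g^[m + 2] a)) = D.walk ar a m * ar d' *
      (ar (D.g d') * ar (D.g (D.g d')) * ar (D.f (D.g (D.g d')))) := by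
    rw [walk_succ, walk_succ, walk_succ, hd, hgd]
    simp only [mul_assoc, hd']
  have hwalk : ∀ l, D.walk ar a m * D.walk ar d' l = D.walk ar a (m + l) := fun l => by
    rw [walk_add]
  rw [h1]
  rcases h.xi_general (D.g d') with h2 | ⟨hv, r, h2⟩ | ⟨hv, h3, r, h2⟩
  · exact ⟨0, by rw [h2, mul_zero, zero_smul]⟩
  · have hb : 3 ≤ D.N (D.f d') := by
      rw [← D.bar_g, ← D.g_f_f, D.N_g]
      apply D.three_le_N
      rw [D.bar_f, D.N_g, hv]
    rw [h2, D.bar_g]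
    obtain ⟨l, hl⟩ := Nat.exists_eq_add_of_le hb
    rw [mul_smul_comm, hl, show 3 + l - 1 = l + 1 + 1 by omega, walk_succ', walk_succ', mul_assoc,
      ← mul_assoc (ar d'), ← mul_assoc (ar d' * ar (D.f d'))]
    rcases h.zeta_general d' with h4 | ⟨h5, r', h4⟩
    · exact ⟨0, by rw [h4]; simp⟩
    · rw [h4, smul_mul_assoc, mul_smul_comm, ← mul_assoc, hwalk, smul_smul, hNd']
      -- The path along the cycle now has length `m + (N β - 1)`, followed by `l` more factors. For
      -- `m > 1` it is too long, for `m = 1` it is already the socle element. For `m = 0` the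
      -- exception in `zeta_general` forces `N α = 3`, so `N β ≥ 5`, and the remaining factors
      -- continue along the same cycle beyond its full length.
      rcases Nat.lt_trichotomy m 1 with hm | hm | hm
      · obtain rfl : m = 0 := by omega
        have hda : d' = a := rfl
        rcases h5 with h5 | ⟨-, h5⟩
        · rw [hda, ha, q.N_f_f_g] at h5
          have := q.three_le
          omega
        · rw [hda, ha, ← q.bar_ν, D.bar_bar, q.N_ν] at h5
          refine ⟨0, ?_⟩
          have h6 := q.five_le_of_N_eq_three' h5
          have h7 : D.N (D.f d') = D.N β := q.N_f_g_of_N_eq_three h5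
          obtain ⟨l, rfl⟩ : ∃ l', l = l' + 2 := ⟨l - 2, by omega⟩
          have h8 : D.g (D.g (D.f d')) = D.g^[0 + (D.N β - 1)] a := by
            rw [zero_add, hda, ha, q.g_f_g_of_N_eq_three h5, q.g_β, ← q.N_δ, D.iterate_N_sub_one]
          rw [h8, walk_succ' ar _ (l + 1), ← mul_assoc, ← walk_succ, walk_succ' ar _ l, ← mul_assoc,
            show 0 + (D.N β - 1) + 1 = D.N β by omega, ha, q.walk_g_mul h]
          simp
      · subst hm
        rw [show 1 + (D.N β - 1) = D.N β by omega]
        rcases Nat.eq_zero_or_pos l with rfl | hl0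
        · exact ⟨r * r', by simp⟩
        · obtain ⟨l, rfl⟩ := Nat.exists_eq_succ_of_ne_zero hl0.ne'
          rw [Nat.succ_eq_add_one, walk_succ', ← mul_assoc, ha, q.walk_g_mul h]
          exact ⟨0, by simp⟩
      · rw [ha, q.walk_g_eq_zero h (by omega)]
        exact ⟨0, by simp⟩
  · rw [h2, D.N_g, hNd', mul_smul_comm, mul_assoc, ← walk_succ', hwalk,
      show m + (D.N β - 1 + 1) = m + D.N β by omega]
    rcases Nat.eq_zero_or_pos m with rfl | hm
    · exact ⟨r, by rw [zero_add]⟩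
    · rw [ha, q.walk_g_eq_zero h (by omega)]
      exact ⟨0, by simp⟩

/-- The product is a multiple of the socle element, which ends at `s(g(δ))`. The arrow leaving the
cycle ends at another vertex, except when it is `f²(g(δ))`; in that case a relation of type `xi`
applies without exception. -/
theorem walk_g_mul_f_eq_zero {k : ℕ} (hk : 3 ≤ k) (hk' : k < D.N β) :
    D.walk ar (D.g δ) k * ar (D.f (D.g^[k - 1] (D.g δ))) = 0 := by
  obtain ⟨m, rfl⟩ := Nat.exists_eq_add_of_le' hk
  rw [show m + 3 - 1 = m + 2 by omega]
  have hN : ∀ l, D.N (D.g^[l] (D.g δ)) = D.N β := fun l => by rw [D.N_iterate, D.N_g, q.N_δ]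
  by_cases h1 : D.g^[m + 2] (D.g δ) = D.f (D.g δ)
  · rw [walk_succ, walk_succ]
    have h3 : D.f (D.g^[m + 1] (D.g δ)) = D.g (D.g δ) := by
      rw [← D.bar_g, ← Function.iterate_succ_apply' D.g (m + 1), h1, D.bar_f]
    have h2 := h.xi (D.g^[m + 1] (D.g δ)) (by rw [h3, D.N_g, D.N_g, q.N_δ]; omega) (by
      rw [h3]
      rintro ⟨-, h4, h5⟩
      have : D.N (D.g (D.g δ)) = 3 := by rw [N, h4, h5]
      rw [D.N_g, D.N_g, q.N_δ] at this
      omega)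
    rw [← Function.iterate_succ_apply' D.g (m + 1)] at h2
    rw [mul_assoc, mul_assoc, ← mul_assoc (ar _), h2, mul_zero]
  · obtain ⟨r, h2⟩ := q.walk_g_mul_f_mem h m
    have h3 : D.t (D.f (D.g^[m + 2] (D.g δ))) ≠ D.s (D.g δ) := fun h3 => by
      rw [D.t_eq_s_f] at h3
      rcases D.eq_or_eq_bar h3 with h3 | h3
      · apply h1
        rw [← D.f_cubed (D.g^[m + 2] (D.g δ)), h3]
      · have h6 : D.bar (D.g δ) = ν := by rw [← q.bar_ν, D.bar_bar]
        rw [h6] at h3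
        have h4 : D.g^[m + 2] (D.g δ) = κ := by
          rw [← D.f_cubed (D.g^[m + 2] (D.g δ)), h3, q.f_ν]
        have h5 := hN (m + 2)
        rw [h4, q.N_κ] at h5
        omega
    have h4 : D.walk ar (D.g δ) (D.N β) * ee (D.s (D.g δ)) = D.walk ar (D.g δ) (D.N β) := by
      have h6 : D.g^[D.N β] (D.g δ) = D.g δ := by
        have := D.iterate_N (D.g δ)
        rwa [D.N_g, q.N_δ] at this
      have := h.walk_mul_ee (D.g δ) (k := D.N β) (by omega)
      rwa [h6] at this
    have h5 : D.walk ar (D.g δ) (m + 3) * ar (D.f (D.g^[m + 2] (D.g δ))) * ee (D.s (D.g δ)) = 0 := by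
      rw [mul_assoc, h.mul_ee_of_ne h3, mul_zero]
    rw [h2, ← h4, ← smul_mul_assoc, ← h2, h5]

/-- For `N β = 3` the path `A_β` is just `βδ`, and `αβδ = c_κ κδ` is a path along the cycle of `α`.
This is the one place where leaving the cycle of `α` after at least two steps gives a non-zero
result. -/
theorem walk_α_two_mul (hN : D.N β = 3) : D.walk ar α 2 * ar (D.f (D.g α)) =
    (D.c β * D.c κ * D.c α) • D.walk ar α (D.N α - 1) := by
  rw [walk_two, mul_assoc, h.triangle, D.bar_g, q.f_α, hN, show 3 - 1 = 2 from rfl, walk_two,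
    q.g_β, mul_smul_comm, ← mul_assoc, q.ar_α_mul_β h, smul_mul_assoc, q.ar_κ_mul_δ h, smul_smul,
    smul_smul, mul_assoc]

theorem ar_α_mul_walk_β {k : ℕ} (hk : 3 ≤ k) : ar α * D.walk ar β k = 0 := by
  obtain ⟨k, rfl⟩ := Nat.exists_eq_add_of_le' hk
  rw [walk_succ', walk_succ', walk_succ', q.g_β, ← mul_assoc, q.ar_α_mul_β h, smul_mul_assoc,
    ← mul_assoc, ← mul_assoc, q.κδg h, zero_mul, smul_zero]

theorem walk_α_two_mul_eq_zero (hN : D.N β ≠ 3) : D.walk ar α 2 * ar (D.f (D.g α)) = 0 := by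
  rw [walk_two, mul_assoc, h.triangle, D.bar_g, q.f_α, mul_smul_comm,
    q.ar_α_mul_walk_β h (by have := q.three_le'; omega), smul_zero]

/-- Removing the first arrow `α` leaves a path starting with `g(α)`, to which the mirror images of
the previous vanishing results apply. In the remaining virtual case one is left with `α` times a
path of length at least three from `β`, which contains `κδ g(δ) = 0`. -/
theorem walk_α_mul_f_eq_zero {k : ℕ} (hk : 3 ≤ k) (hk' : k < D.N α) :
    D.walk ar α k * ar (D.f (D.g^[k - 1] α)) = 0 := by
  obtain ⟨m, rfl⟩ := Nat.exists_eq_add_of_le' hk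
  rw [walk_succ', mul_assoc, show m + 3 - 1 = m + 1 + 1 by omega, Function.iterate_succ_apply]
  rcases Nat.eq_zero_or_pos m with rfl | hm
  · by_cases hv : D.N (D.f (D.g α)) = 2
    · have h1 := q.swap.walk_g_two_mul_of_virtual h hv
      have h2 : D.N β ≠ 3 := fun h2 =>
        q.swap.not_virtual_f_g_of_N_eq_three (by rw [q.N_δ, h2]) hv
      rw [zero_add, show D.g^[1] (D.g α) = D.g (D.g α) from rfl, h1, mul_smul_comm, q.N_δ,
        q.ar_α_mul_walk_β h (by have := q.three_le'; omega), smul_zero]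
    · have h1 := q.swap.walk_g_two_mul_of_not_virtual h hv
      rw [zero_add, show D.g^[1] (D.g α) = D.g (D.g α) from rfl, h1, mul_zero]
  · have h1 := q.swap.walk_g_mul_f_eq_zero h (k := m + 2) (by omega) (by rw [q.N_ν]; omega)
    rw [show m + 2 - 1 = m + 1 by omega] at h1
    rw [h1, mul_zero]

end Quad

end WeightedTriangulationQuiver

/-! ## The opposite quiver -/

namespace WeightedTriangulationQuiver

open MulOpposite

variable {V A K : Type*} [Field K]

section Op

variable (D : WeightedTriangulationQuiver V A K)

/-- The inverse of `g`. -/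
def gInv (a : A) : A := D.f.symm (D.bar a)

theorem g_gInv (a : A) : D.g (D.gInv a) = a := by
  rw [gInv, ← D.bar_f, Equiv.apply_symm_apply, D.bar_bar]

theorem gInv_g (a : A) : D.gInv (D.g a) = a := D.g_injective (D.g_gInv _)

theorem f_symm_apply (a : A) : D.f.symm a = D.f (D.f a) := by
  rw [Equiv.symm_apply_eq, D.f_cubed]

/-- The quiver with all arrows reversed. -/
def reverseTriangulation : TriangulationQuiver V A where
  s := D.t
  t := D.s
  connected := fun u v => by
    induction D.connected u v with
    | rel x z h =>
      obtain ⟨a, h1, h2⟩ := h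
      exact .symm _ _ (.rel _ _ ⟨a, h2, h1⟩)
    | refl x => exact .refl x
    | symm x z _ ih => exact .symm _ _ ih
    | trans x z w _ _ ih1 ih2 => exact .trans _ _ _ ih1 ih2
  twoRegular v := (D.twoRegular v).symm
  bar a := D.f.symm (D.bar (D.f a))
  s_bar a := by
    rw [D.t_eq_s_f, Equiv.apply_symm_apply, D.s_bar, D.t_eq_s_f]
  bar_ne a h := by
    rw [Equiv.symm_apply_eq] at h
    exact D.bar_ne _ h
  f := D.f.symm
  t_eq_s_f a := by rw [D.t_eq_s_f, Equiv.apply_symm_apply]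
  f_cubed a := by
    rw [Equiv.symm_apply_eq, Equiv.symm_apply_eq, Equiv.symm_apply_eq, D.f_cubed]

theorem reverseTriangulation_g (a : A) : D.reverseTriangulation.g a = D.gInv a := by
  change D.f.symm (D.bar (D.f (D.f.symm a))) = _
  rw [Equiv.apply_symm_apply]; rfl

theorem reverseTriangulation_n (a : A) : D.reverseTriangulation.n a = D.n a := by
  refine Function.minimalPeriod_eq_minimalPeriod_iff.2 fun n => ?_
  have h1 : D.reverseTriangulation.g = D.gInv := funext D.reverseTriangulation_g
  have h2 : Function.LeftInverse D.g^[n] D.gInv^[n] := Function.LeftInverse.iterate D.g_gInv n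
  have h3 : Function.LeftInverse D.gInv^[n] D.g^[n] := Function.LeftInverse.iterate D.gInv_g n
  rw [h1]
  constructor
  · intro h
    have := h2 a
    rwa [h] at this
  · intro h
    have := h3 a
    rwa [h] at this

/-- `(D.reverseTriangulation.bar a)` lies in the `g`-cycle of `f a`. -/
theorem g_reverseTriangulation_bar (a : A) : D.g (D.reverseTriangulation.bar a) = D.f a := by
  change D.g (D.f.symm (D.bar (D.f a))) = _
  exact D.g_gInv _

/-- The weighted triangulation quiver with all arrows reversed. -/
def reverse : WeightedTriangulationQuiver V A K where
  toTriangulationQuiver := D.reverseTriangulation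
  m := D.m
  m_pos := D.m_pos
  m_g a := by rw [D.reverseTriangulation_g, ← D.m_g, D.g_gInv]
  c := D.c
  c_ne_zero := D.c_ne_zero
  c_g a := by rw [D.reverseTriangulation_g, ← D.c_g, D.g_gInv]
  two_le a := by rw [D.reverseTriangulation_n]; exact D.two_le a
  three_le a h h' := by
    rw [D.reverseTriangulation_n] at h ⊢
    have h1 : D.N (D.bar (D.g a)) = 2 := by
      rw [D.bar_g, ← D.g_reverseTriangulation_bar, D.N_g]
      exact h
    have h2 := D.three_le_N h1
    rwa [D.N_g] at h2
  four_le a h h' := by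
    rw [D.reverseTriangulation_n] at h ⊢
    have h1 : D.N (D.bar (D.g a)) = 2 := by
      rw [D.bar_g, ← D.g_reverseTriangulation_bar, D.N_g]
      exact h
    have h2 := D.four_le (D.g a) h1 (by
      have h3 := D.g_g_of_virtual h
      rw [D.g_reverseTriangulation_bar] at h3
      change D.t (D.reverseTriangulation.bar a) = D.s (D.reverseTriangulation.bar a) at h'
      rw [D.bar_g, ← D.s_g, h3, ← h', ← D.s_g, D.g_reverseTriangulation_bar])
    rwa [← N, D.N_g] at h2

theorem reverse_f (a : A) : D.reverse.f a = D.f (D.f a) := D.f_symm_apply a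

theorem reverse_g (a : A) : D.reverse.g a = D.gInv a := D.reverseTriangulation_g a

theorem g_reverse_g (a : A) : D.g (D.reverse.g a) = a := by rw [reverse_g, g_gInv]

theorem reverse_bar (a : A) : D.reverse.bar a = D.f (D.f (D.bar (D.f a))) := D.f_symm_apply _

theorem g_reverse_bar (a : A) : D.g (D.reverse.bar a) = D.f a := D.g_reverseTriangulation_bar a

theorem reverse_n (a : A) : D.reverse.n a = D.n a := D.reverseTriangulation_n a

theorem reverse_N (a : A) : D.reverse.N a = D.N a := by
  rw [N, N, reverse_n]; rfl

variable {D}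

theorem Quad.reverse {α κ β σ δ ν : A} (q : D.Quad α κ β σ δ ν) : D.reverse.Quad ν σ δ κ β α where
  bar_α := by rw [reverse_bar, q.f_ν, q.bar_κ, q.f_α, q.f_β]
  f_α := by rw [reverse_f, q.f_ν, q.f_κ]
  f_β := by rw [reverse_f, q.f_δ, q.f_ν]
  f_σ := by rw [reverse_f, q.f_κ, q.f_δ]
  f_κ := by rw [reverse_f, q.f_σ, q.f_α]
  f_δ := by rw [reverse_f, q.f_β, q.f_σ]
  f_ν := by rw [reverse_f, q.f_α, q.f_β]
  bar_σ := by rw [reverse_bar, q.f_κ, q.bar_δ, q.f_σ, q.f_α]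
  N_κ := by rw [reverse_N, q.N_σ]
  s_ne := by
    change D.t ν ≠ D.t κ
    rw [← D.s_f, ← D.s_f, q.f_ν, q.f_κ, ← q.bar_α, ← q.bar_σ, D.s_bar, D.s_bar]
    exact q.s_ne

variable [Fintype V] {R : Type*} [Ring R] [Algebra K R]

/-- Reversing a path turns its last arrow into the first one, which is why the reversed path starts
at `g^k(a)`; lengths are shifted by one because the empty path has no last arrow. -/
theorem reverse_walk (ar : A → R) (a : A) (k : ℕ) :
    D.reverse.walk (fun x => op (ar x)) (D.g^[k] a) (k + 1) = op (D.walk ar a (k + 1)) := by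
  induction k with
  | zero => simp
  | succ k ih =>
    rw [walk_succ', reverse_g, Function.iterate_succ_apply', gInv_g, ih, walk_succ _ _ (k + 1),
      op_mul, Function.iterate_succ_apply']

theorem N_bar (a : A) : D.N (D.bar a) = D.N (D.f (D.f a)) := by
  rw [← D.g_f_f, D.N_g]

/-- The set of relations is self-dual: triangle relations go to triangle relations, and reversal
exchanges the families `zeta` and `xi` together with their exceptions. -/
theorem IsRep.reverse {ee : V → R} {ar : A → R} (h : D.IsRep ee ar) :
    D.reverse.IsRep (fun v => op (ee v)) (fun a => op (ar a)) where
  idem v := by rw [← op_mul, h.idem]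
  orth v w hvw := by rw [← op_mul, h.orth _ _ hvw.symm, op_zero]
  one := by rw [← Finset.op_sum, h.one, op_one]
  source a := by rw [← op_mul]; exact congrArg op (h.target a)
  target a := by rw [← op_mul]; exact congrArg op (h.source a)
  triangle a := by
    have h1 := h.triangle (D.f (D.f a))
    rw [D.f_cubed] at h1
    set b := D.bar (D.f (D.f a)) with hb
    have h2 : D.g (D.g (D.reverse.bar a)) = b := by rw [g_reverse_bar, hb, D.bar_f]
    have h3 : D.N (D.reverse.bar a) = D.N b := by rw [← h2, D.N_g, D.N_g]
    have h4 : 2 ≤ D.N b := D.two_le_N b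
    have h5 : D.reverse.bar a = D.g^[D.N b - 2] b := by
      rw [← h2, ← Function.iterate_succ_apply, ← Function.iterate_succ_apply,
        show (D.N (D.g (D.g (D.reverse.bar a))) - 2).succ.succ = D.N (D.reverse.bar a) by rw [h2, h3]; omega,
        D.iterate_N]
    have h6 : D.c (D.reverse.bar a) = D.c b := by rw [← h2, D.c_g, D.c_g]
    have h7 := reverse_walk (D := D) ar b (D.N b - 2)
    rw [← h5, show D.N b - 2 + 1 = D.N b - 1 by omega] at h7
    rw [reverse_f, ← op_mul, h1, op_smul, reverse_N, h3, h7, ← h6]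
    rfl
  zeta a h1 h2 := by
    -- `x` is the arrow with `g(x) = f²(a)`. Read backwards, the required product is `x g(x)
    -- f(g(x))`.
    set x := D.reverse.g (D.reverse.f a) with hx
    have hgx : D.g x = D.f (D.f a) := by rw [hx, g_reverse_g, reverse_f]
    have hfx : D.f x = D.g (D.f a) := by rw [← D.bar_g, hgx, D.bar_f]
    have h3 := h.xi x (by
        rw [hfx, D.N_g]
        rwa [reverse_N, reverse_f, reverse_f, D.f_cubed] at h1) (by
      rintro ⟨h4, h5, h6⟩
      rw [hfx, D.m_g] at h5
      rw [hfx, D.n_g] at h6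
      have h7 : D.N (D.f a) = 3 := by rw [N, h5, h6]
      apply h2
      rw [reverse_N, reverse_n, reverse_f]
      refine ⟨?_, ?_, ?_⟩
      · rw [reverse_bar, D.f_cubed]
        have h8 : D.g (D.f x) = D.reverse.bar a := by
          apply D.g_injective
          rw [g_reverse_bar, hfx]
          have := D.iterate_N (D.f a)
          rwa [h7] at this
        rw [← D.bar_g, h8, N_bar, reverse_bar, D.f_cubed] at h4
        exact h4
      · change D.m (D.reverse.bar a) = 1
        rw [← D.m_g, g_reverse_bar, h5]
      · rw [← D.n_g, g_reverse_bar, h6])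
    rw [← op_mul, ← op_mul, ← mul_assoc, reverse_f, ← hgx]
    rw [hgx, D.f_cubed, ← hgx] at h3
    exact congrArg op h3
  xi a h1 h2 := by
    -- Here the product read backwards is `x f(x) g(f(x))`, as `g(f(x)) = a`.
    set x := D.reverse.f (D.reverse.g a) with hx
    have hfx : D.f x = D.reverse.g a := by rw [hx, reverse_f, D.f_cubed]
    have hgx : D.g (D.f x) = a := by rw [hfx, g_reverse_g]
    have hffx : D.f (D.f x) = D.bar a := by rw [← hgx, D.bar_g]
    have hx' : D.bar x = D.g (D.bar a) := by rw [← hffx, ← D.bar_f, D.f_cubed]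
    have hga : D.g (D.f (D.f a)) = D.bar a := D.g_f_f a
    have h3 := h.zeta x (by
        rw [hffx, N_bar]
        rwa [reverse_N, reverse_f] at h1) (by
      rintro ⟨h4, h5, h6⟩
      rw [hx', D.m_g, ← hga, D.m_g] at h5
      rw [hx', D.n_g, ← hga, D.n_g] at h6
      have h7 : D.N (D.f (D.f a)) = 3 := by rw [N, h5, h6]
      apply h2
      rw [reverse_N, reverse_n, reverse_f, reverse_f, D.f_cubed]
      refine ⟨?_, ?_, h6⟩
      · have h8 : D.g (D.bar x) = D.f (D.f a) := by
          have := D.iterate_N (D.f (D.f a))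
          rw [h7] at this
          rw [hx', ← hga]
          exact this
        rw [← D.bar_g, h8, N_bar, D.f_cubed] at h4
        exact h4
      · exact h5)
    rw [← op_mul, ← op_mul, ← mul_assoc]
    rw [hgx, hfx] at h3
    exact congrArg op h3

end Op

end WeightedTriangulationQuiver

/-! ### The filtration by path length and the structure of `e_i R` -/

namespace WeightedTriangulationQuiver

variable {V A K : Type*} [Field K] [Fintype V] {D : WeightedTriangulationQuiver V A K}
  {R : Type*} [Ring R] [Algebra K R] {ee : V → R} {ar : A → R}

/-- The vertices and arrows generate the algebra. -/
def Generates (K : Type*) [Field K] {V A R : Type*} [Ring R] [Algebra K R]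
    (ee : V → R) (ar : A → R) : Prop :=
  Algebra.adjoin K (Set.range ee ∪ Set.range ar) = ⊤

theorem Generates.mul_mem (hg : Generates K ee ar) {U : Submodule K R}
    (he : ∀ u ∈ U, ∀ v, u * ee v ∈ U) (ha : ∀ u ∈ U, ∀ a, u * ar a ∈ U) {u : R} (hu : u ∈ U)
    (r : R) : u * r ∈ U := by
  have hr : r ∈ Algebra.adjoin K (Set.range ee ∪ Set.range ar) := by rw [hg]; trivial
  induction hr using Algebra.adjoin_induction generalizing u with
  | mem x hx =>
    rcases hx with ⟨v, rfl⟩ | ⟨a, rfl⟩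
    · exact he u hu v
    · exact ha u hu a
  | algebraMap k =>
    rw [← Algebra.commutes, ← Algebra.smul_def]
    exact U.smul_mem k hu
  | add x y _ _ hx hy =>
    rw [mul_add]
    exact U.add_mem (hx hu) (hy hu)
  | mul x y _ _ hx hy =>
    rw [← mul_assoc]
    exact hy (hx hu)

theorem span_mul_mem {s : Set R} {U : Submodule K R} (r : R) (h : ∀ x ∈ s, x * r ∈ U) {u : R}
    (hu : u ∈ Submodule.span K s) : u * r ∈ U := by
  induction hu using Submodule.span_induction with
  | mem x hx => exact h x hx
  | zero => rw [zero_mul]; exact U.zero_mem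
  | add x y _ _ hx hy => rw [add_mul]; exact U.add_mem hx hy
  | smul k x _ hx => rw [smul_mul_assoc]; exact U.smul_mem k hx

theorem IsRep.mul_ee_mem (h : D.IsRep ee ar) {U : Submodule K R} {u : R} (v w : V) (hu : u ∈ U)
    (huw : u * ee w = u) : u * ee v ∈ U := by
  by_cases hvw : w = v
  · rwa [← hvw, huw]
  · rw [← huw, mul_assoc, h.orth _ _ hvw, mul_zero]
    exact U.zero_mem

theorem IsRep.walk_mul_ee_mem (h : D.IsRep ee ar) {U : Submodule K R} {a : A} {k : ℕ} (hk : k ≠ 0)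
    (hu : D.walk ar a k ∈ U) (v : V) : D.walk ar a k * ee v ∈ U :=
  h.mul_ee_mem v _ hu (h.walk_mul_ee a hk)

theorem IsRep.ar_mul_ee_mem (h : D.IsRep ee ar) {U : Submodule K R} {a : A}
    (hu : ar a ∈ U) (v : V) : ar a * ee v ∈ U :=
  h.mul_ee_mem v _ hu (h.target a)

/-- The span of the paths `α g(α) ⋯` of length at least `m`. -/
def tail (D : WeightedTriangulationQuiver V A K) (ar : A → R) (a : A) (m : ℕ) : Submodule K R :=
  Submodule.span K (D.walk ar a '' Set.Ici m)

theorem walk_mem_tail (ar : A → R) (a : A) {m k : ℕ} (hk : m ≤ k) :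
    D.walk ar a k ∈ tail D ar a m :=
  Submodule.subset_span ⟨k, hk, rfl⟩

theorem tail_mono {a : A} {m n : ℕ} (hmn : m ≤ n) : tail D ar a n ≤ tail D ar a m :=
  Submodule.span_mono (Set.image_mono (Set.Ici_subset_Ici.2 hmn))

theorem mul_mem_of_mem_tail {a : A} {m : ℕ} {U : Submodule K R} {u : R} (hu : u ∈ tail D ar a m)
    (r : R) (hr : ∀ k, m ≤ k → D.walk ar a k * r ∈ U) : u * r ∈ U :=
  span_mul_mem r (by rintro _ ⟨k, hk, rfl⟩; exact hr k hk) hu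

theorem exists_add_of_mem_tail {a : A} {m : ℕ} {u : R} (hu : u ∈ tail D ar a m) :
    ∃ r : K, ∃ u' ∈ tail D ar a (m + 1), u = r • D.walk ar a m + u' := by
  have h1 : Set.Ici m = insert m (Set.Ici (m + 1)) := by
    ext x
    simp only [Set.mem_Ici, Set.mem_insert_iff]
    omega
  rw [tail, h1, Set.image_insert_eq, Submodule.mem_span_insert] at hu
  exact hu

namespace Quad

variable {α κ β σ δ ν : A} (q : D.Quad α κ β σ δ ν) (h : D.IsRep ee ar)

theorem iterate_g_ne_virtual {a b : A} (hb : D.N b = 2) (ha : 3 ≤ D.N a) (k : ℕ) :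
    b ≠ D.g^[k] a := by
  intro hab
  rw [hab, D.N_iterate] at hb
  omega

include q h

theorem walk_α_eq_zero {k : ℕ} (hk : D.N α < k) : D.walk ar α k = 0 := by
  obtain ⟨l, rfl⟩ := Nat.exists_eq_add_of_lt hk
  rw [add_assoc, walk_add, walk_succ', ← mul_assoc, q.walk_α_mul h, zero_mul]

/-- The exceptional product at `k = 2` occurs only for `N β = 3`. Then `N α ≥ 5`, and the resulting
path of length `N α - 1` is still strictly longer than `2`. Multiplication by arrows therefore
raises the filtration from length two on. -/
theorem walk_α_mul_mem {k : ℕ} (hk : 2 ≤ k) (a : A) :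
    D.walk ar α k * ar a ∈ tail D ar α (k + 1) := by
  by_cases ha : D.s a = D.s (D.g^[k] α)
  swap
  · rw [h.walk_mul_of_ne α a (by omega) ha]
    exact Submodule.zero_mem _
  rcases D.eq_or_eq_bar ha with rfl | rfl
  · rw [← walk_succ]
    exact Submodule.subset_span ⟨k + 1, Set.mem_Ici.2 le_rfl, rfl⟩
  obtain ⟨k, rfl⟩ := Nat.exists_eq_add_of_le' (show 1 ≤ k by omega)
  rw [Function.iterate_succ_apply', D.bar_g]
  rcases lt_or_ge (k + 1) (D.N α) with hkN | hkN
  · rcases Nat.lt_or_ge (k + 1) 3 with hk3 | hk3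
    · obtain rfl : k = 1 := by omega
      rw [Function.iterate_one]
      by_cases hN : D.N β = 3
      · rw [q.walk_α_two_mul h hN]
        have := q.five_le_of_N_eq_three hN
        exact Submodule.smul_mem _ _ (Submodule.subset_span
          ⟨D.N α - 1, Set.mem_Ici.2 (by omega), rfl⟩)
      · rw [q.walk_α_two_mul_eq_zero h hN]
        exact Submodule.zero_mem _
    · have := q.walk_α_mul_f_eq_zero h hk3 hkN
      rw [Nat.add_sub_cancel] at this
      rw [this]
      exact Submodule.zero_mem _
  · rcases hkN.eq_or_lt with hkN | hkN
    · rw [← hkN, q.walk_α_mul h]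
      exact Submodule.zero_mem _
    · rw [q.walk_α_eq_zero h hkN, zero_mul]
      exact Submodule.zero_mem _

theorem tail_mul_mem {m : ℕ} (hm : 2 ≤ m) {u : R} (hu : u ∈ tail D ar α m) (a : A) :
    u * ar a ∈ tail D ar α (m + 1) := by
  refine span_mul_mem _ ?_ hu
  rintro _ ⟨k, hk, rfl⟩
  exact tail_mono (Nat.succ_le_succ hk) (q.walk_α_mul_mem h (hm.trans hk) a)

theorem tail_eq_bot {m : ℕ} (hm : D.N α < m) : tail D ar α m = ⊥ := by
  refine le_bot_iff.1 (Submodule.span_le.2 ?_)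
  rintro _ ⟨k, hk, rfl⟩
  exact (Submodule.mem_bot K).2 (q.walk_α_eq_zero h (hm.trans_le hk))

/-- Leading terms can be pushed: multiplying by the next arrow of the cycle lengthens the leading
path by one and raises the error term at least as much. -/
theorem walk_add_mul_mem {m M : ℕ} (hm : 2 ≤ m) (hmM : m ≤ M) {u : R}
    (hu : u ∈ tail D ar α (m + 1)) :
    ∃ z, ∃ e ∈ tail D ar α (M + 1), (D.walk ar α m + u) * z = D.walk ar α M + e := by
  obtain ⟨l, rfl⟩ := Nat.exists_eq_add_of_le hmM
  induction l generalizing m u with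
  | zero => exact ⟨1, u, hu, by rw [add_zero, mul_one]⟩
  | succ l ih =>
    obtain ⟨z, e, he, hz⟩ := ih (m := m + 1) (by omega)
      (q.tail_mul_mem h (by omega) hu (D.g^[m] α)) (by omega)
    rw [show m + 1 + l = m + (l + 1) by omega] at he hz
    exact ⟨ar (D.g^[m] α) * z, e, he, by
      rw [← mul_assoc, add_mul, ← walk_succ, hz]⟩

theorem walk_add_mul_eq {m : ℕ} (hm : 2 ≤ m) (hmN : m ≤ D.N α) {u : R}
    (hu : u ∈ tail D ar α (m + 1)) : ∃ z, (D.walk ar α m + u) * z = D.walk ar α (D.N α) := by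
  obtain ⟨z, e, he, hz⟩ := q.walk_add_mul_mem h hm hmN hu
  rw [q.tail_eq_bot h (Nat.lt_succ_self _), Submodule.mem_bot] at he
  exact ⟨z, by rw [hz, he, add_zero]⟩

/-- Normalise the shortest path that occurs and push it to full length, where the error term is
zero. -/
theorem exists_mul_eq_of_mem_tail {m : ℕ} (hm : 2 ≤ m) {u : R} (hu : u ∈ tail D ar α m)
    (hu0 : u ≠ 0) : ∃ z, u * z = D.walk ar α (D.N α) := by
  by_cases hmN : m ≤ D.N α
  · obtain ⟨l, hl⟩ := Nat.exists_eq_add_of_le hmN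
    induction l generalizing m u with
    | zero =>
      obtain ⟨r, u', hu', rfl⟩ := exists_add_of_mem_tail hu
      rw [q.tail_eq_bot h (by omega), Submodule.mem_bot] at hu'
      subst hu'
      have hr : r ≠ 0 := by rintro rfl; simp at hu0
      exact ⟨algebraMap K R r⁻¹, by
        rw [← Algebra.commutes, ← Algebra.smul_def, add_zero, inv_smul_smul₀ hr, hl, add_zero]⟩
    | succ l ih =>
      obtain ⟨r, u', hu', rfl⟩ := exists_add_of_mem_tail hu
      by_cases hr : r = 0
      · rw [hr, zero_smul, zero_add] at hu0 ⊢
        exact ih (m := m + 1) (by omega) hu' hu0 (by omega) (by omega)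
      · obtain ⟨z, hz⟩ := q.walk_add_mul_eq h hm hmN (Submodule.smul_mem _ r⁻¹ hu')
        refine ⟨algebraMap K R r⁻¹ * z, ?_⟩
        rw [← hz, ← mul_assoc, ← Algebra.commutes, ← Algebra.smul_def, smul_add,
          inv_smul_smul₀ hr]
  · rw [q.tail_eq_bot h (by omega), Submodule.mem_bot] at hu
    exact absurd hu hu0

/-- `σ` is virtual, hence never on the cycle of `α`. It could only be the arrow leaving the cycle,
and it differs from the exceptional arrow `f(g(α))` because `σ = f(β)` and `β ≠ g(α)`. -/
theorem walk_α_mul_σ {k : ℕ} (hk : 2 ≤ k) : D.walk ar α k * ar σ = 0 := by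
  by_cases ha : D.s σ = D.s (D.g^[k] α)
  swap
  · exact h.walk_mul_of_ne α _ (by omega) ha
  rcases D.eq_or_eq_bar ha with h1 | h1
  · exact absurd h1 (iterate_g_ne_virtual q.N_σ q.three_le k)
  obtain ⟨k, rfl⟩ := Nat.exists_eq_add_of_le' (show 1 ≤ k by omega)
  rcases lt_or_ge (k + 1) (D.N α) with hkN | hkN
  · rw [Function.iterate_succ_apply', D.bar_g] at h1
    rcases Nat.lt_or_ge (k + 1) 3 with hk3 | hk3
    · obtain rfl : k = 1 := by omega
      rw [Function.iterate_one, ← q.f_β] at h1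
      have h2 := D.f.injective h1
      rw [← q.bar_β] at h2
      exact absurd h2.symm (D.bar_ne β)
    · rw [h1]
      have := q.walk_α_mul_f_eq_zero h hk3 hkN
      rwa [Nat.add_sub_cancel] at this
  · rcases hkN.eq_or_lt with hkN | hkN
    · rw [← hkN, q.walk_α_mul h]
    · rw [q.walk_α_eq_zero h hkN, zero_mul]

theorem tail_mul_σ {u : R} (hu : u ∈ tail D ar α 2) : u * ar σ = 0 := by
  have : u * ar σ ∈ (⊥ : Submodule K R) := by
    refine span_mul_mem _ ?_ hu
    rintro _ ⟨k, hk, rfl⟩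
    exact (Submodule.mem_bot K).2 (q.walk_α_mul_σ h hk)
  exact (Submodule.mem_bot K).1 this

theorem ar_κ_mul_of_ne {a : A} (h1 : a ≠ σ) (h2 : a ≠ δ) : ar κ * ar a = 0 := by
  apply h.mul_eq_zero_of_ne
  intro h3
  rcases D.eq_f_or_eq_g h3 with h4 | h4
  · rw [q.f_κ] at h4; exact h2 h4
  · rw [q.g_κ] at h4; exact h1 h4

theorem ar_κ_mul_g : ar κ * ar (D.g α) = 0 := by
  apply q.ar_κ_mul_of_ne h
  · intro h1
    have := q.three_le
    rw [← D.N_g, h1, q.N_σ] at this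
    omega
  · rw [← q.g_β]
    exact fun h1 => q.α_ne_β (D.g_injective h1)

theorem ar_κ_mul_α : ar κ * ar α = 0 := by
  apply q.ar_κ_mul_of_ne h _ q.α_ne_δ
  intro h1
  have := q.three_le
  rw [h1, q.N_σ] at this
  omega

theorem ar_α_mul_α : ar α * ar α = 0 := by
  apply h.mul_eq_zero_of_ne
  intro h3
  rcases D.eq_f_or_eq_g h3 with h4 | h4
  · rw [q.f_α] at h4; exact q.α_ne_β h4
  · exact q.α_ne_ν (D.g_injective (by rw [← h4, q.g_ν]))

/-- The candidate for `e_i R`, where `i` is the source of `α`. -/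
def corner (D : WeightedTriangulationQuiver V A K) (ee : V → R) (ar : A → R) (α κ : A) :
    Submodule K R :=
  Submodule.span K {ee (D.s α), ar α, ar κ} ⊔ tail D ar α 2

theorem mem_corner {u : R} : u ∈ corner D ee ar α κ ↔
    ∃ r₀ r₁ s : K, ∃ u' ∈ tail D ar α 2, u = r₀ • ee (D.s α) + r₁ • ar α + s • ar κ + u' := by
  simp only [corner, Submodule.mem_sup, Submodule.mem_span_insert, Submodule.mem_span_singleton]
  constructor
  · rintro ⟨_, ⟨r₀, _, ⟨r₁, _, ⟨s, rfl⟩, rfl⟩, rfl⟩, u', hu', rfl⟩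
    exact ⟨r₀, r₁, s, u', hu', by simp only [add_assoc]⟩
  · rintro ⟨r₀, r₁, s, u', hu', rfl⟩
    exact ⟨_, ⟨r₀, _, ⟨r₁, _, ⟨s, rfl⟩, rfl⟩, rfl⟩, u', hu', by simp only [add_assoc]⟩

/-- By `Generates.mul_mem` it is enough to multiply the spanning elements by vertices and arrows.
The relations return `αβ` to `κ`, and `κδ`, `κσ` to the cycle of `α`. -/
theorem corner_mul_mem (hg : Generates K ee ar) {u : R} (hu : u ∈ corner D ee ar α κ) (r : R) :
    u * r ∈ corner D ee ar α κ := by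
  have h0 : ee (D.s α) ∈ corner D ee ar α κ :=
    Submodule.mem_sup_left (Submodule.subset_span (by simp))
  have h1 : ar α ∈ corner D ee ar α κ :=
    Submodule.mem_sup_left (Submodule.subset_span (by simp))
  have h2 : ar κ ∈ corner D ee ar α κ :=
    Submodule.mem_sup_left (Submodule.subset_span (by simp))
  have h3 : ∀ k, 2 ≤ k → D.walk ar α k ∈ corner D ee ar α κ := fun k hk =>
    Submodule.mem_sup_right (Submodule.subset_span ⟨k, hk, rfl⟩)
  have hN := q.three_le
  have hcases : ∀ (r : R), ee (D.s α) * r ∈ corner D ee ar α κ → ar α * r ∈ corner D ee ar α κ →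
      ar κ * r ∈ corner D ee ar α κ →
      (∀ k, 2 ≤ k → D.walk ar α k * r ∈ corner D ee ar α κ) →
      ∀ u ∈ corner D ee ar α κ, u * r ∈ corner D ee ar α κ := by
    intro r t0 t1 t2 t3 u hu
    obtain ⟨r₀, r₁, s, u', hu', rfl⟩ := (q.mem_corner h).1 hu
    simp only [add_mul, smul_mul_assoc]
    refine add_mem (add_mem (add_mem ?_ ?_) ?_) ?_
    · exact Submodule.smul_mem _ _ t0
    · exact Submodule.smul_mem _ _ t1
    · exact Submodule.smul_mem _ _ t2
    · exact span_mul_mem _ (by rintro _ ⟨k, hk, rfl⟩; exact t3 k hk) hu'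
  refine hg.mul_mem (fun u hu v => hcases _ ?_ ?_ ?_ ?_ u hu)
    (fun u hu a => hcases _ ?_ ?_ ?_ ?_ u hu) hu r
  · exact h.mul_ee_mem v _ h0 (h.idem _)
  · exact h.ar_mul_ee_mem h1 v
  · exact h.ar_mul_ee_mem h2 v
  · exact fun k hk => h.walk_mul_ee_mem (by omega) (h3 k hk) v
  · by_cases ha : D.s a = D.s α
    · rcases D.eq_or_eq_bar ha with rfl | rfl
      · rwa [h.source]
      · rwa [← D.s_bar, h.source, q.bar_α]
    · rw [h.ee_mul_of_ne ha]; exact zero_mem _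
  · by_cases ha : D.s a = D.t α
    · rcases D.eq_f_or_eq_g ha with rfl | rfl
      · rw [q.f_α, q.ar_α_mul_β h]; exact Submodule.smul_mem _ _ h2
      · rw [← walk_two]; exact h3 2 le_rfl
    · rw [h.mul_eq_zero_of_ne ha]; exact zero_mem _
  · by_cases ha : D.s a = D.t κ
    · rcases D.eq_f_or_eq_g ha with rfl | rfl
      · rw [q.f_κ, q.ar_κ_mul_δ h]
        exact Submodule.smul_mem _ _ (h3 _ (by omega))
      · rw [q.g_κ, q.ar_κ_mul_σ h]
        exact Submodule.smul_mem _ _ (h3 _ (by omega))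
    · rw [h.mul_eq_zero_of_ne ha]; exact zero_mem _
  · intro k hk
    exact Submodule.mem_sup_right (tail_mono (by omega) (q.walk_α_mul_mem h hk a))

theorem ee_mul_mem_corner (hg : Generates K ee ar) (r : R) :
    ee (D.s α) * r ∈ corner D ee ar α κ :=
  q.corner_mul_mem h hg (Submodule.mem_sup_left (Submodule.subset_span (by simp))) r

theorem corner_fg : (corner D ee ar α κ).FG := by
  refine Submodule.FG.sup (Submodule.fg_span (by simp)) ?_
  have h1 : tail D ar α 2 = Submodule.span K (D.walk ar α '' Set.Icc 2 (D.N α)) := by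
    refine le_antisymm (Submodule.span_le.2 ?_)
      (Submodule.span_mono (Set.image_mono Set.Icc_subset_Ici_self))
    rintro _ ⟨k, hk, rfl⟩
    by_cases hkN : k ≤ D.N α
    · exact Submodule.subset_span ⟨k, ⟨hk, hkN⟩, rfl⟩
    · rw [q.walk_α_eq_zero h (by omega)]
      exact zero_mem _
  rw [h1]
  exact Submodule.fg_span ((Set.finite_Icc _ _).image _)

/-- Every non-zero element of `e_i R` can be multiplied into the socle. -/
theorem exists_mul_eq_socle (hg : Generates K ee ar) {x : R} (hx : ee (D.s α) * x = x)
    (hx0 : x ≠ 0) : ∃ z, x * z = D.walk ar α (D.N α) := by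
  have hN := q.three_le
  -- Multiplication by `g(α)` kills `κ` and leaves a path of length two as leading term.
  have lead1 : ∀ (r s : K) (u : R), u ∈ tail D ar α 2 → r ≠ 0 →
      ∃ z, (r • ar α + s • ar κ + u) * z = D.walk ar α (D.N α) := by
    intro r s u hu hr
    obtain ⟨z, hz⟩ := q.walk_add_mul_eq h le_rfl (by omega)
      (Submodule.smul_mem _ r⁻¹ (q.tail_mul_mem h le_rfl hu (D.g α)))
    refine ⟨ar (D.g α) * (algebraMap K R r⁻¹ * z), ?_⟩
    have h1 : (r • ar α + s • ar κ + u) * ar (D.g α) =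
        r • (D.walk ar α 2 + r⁻¹ • (u * ar (D.g α))) := by
      rw [add_mul, add_mul, smul_mul_assoc, smul_mul_assoc, q.ar_κ_mul_g h, walk_two, smul_zero,
        add_zero, smul_add, smul_inv_smul₀ hr]
    rw [← mul_assoc, h1, ← mul_assoc, ← Algebra.commutes, ← Algebra.smul_def,
      inv_smul_smul₀ hr, hz]
  have hxc := q.ee_mul_mem_corner h hg x
  rw [hx, q.mem_corner h] at hxc
  obtain ⟨r₀, r₁, s, u, hu, rfl⟩ := hxc
  by_cases h0 : r₀ = 0
  · subst h0
    rw [zero_smul, zero_add] at hx0 ⊢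
    by_cases h1 : r₁ = 0
    · subst h1
      rw [zero_smul, zero_add] at hx0 ⊢
      by_cases hs : s = 0
      · subst hs
        rw [zero_smul, zero_add] at hx0 ⊢
        exact q.exists_mul_eq_of_mem_tail h le_rfl hu hx0
      -- With only `κ` and longer paths present, `σ` kills the latter and takes `κ` to the socle.
      · have hc : s * (D.c α * (D.c κ)⁻¹) ≠ 0 :=
          mul_ne_zero hs (mul_ne_zero (D.c_ne_zero _) (inv_ne_zero (D.c_ne_zero _)))
        refine ⟨ar σ * algebraMap K R (s * (D.c α * (D.c κ)⁻¹))⁻¹, ?_⟩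
        rw [← mul_assoc, add_mul, q.tail_mul_σ h hu, add_zero, smul_mul_assoc, q.ar_κ_mul_σ h,
          ← Algebra.commutes, ← Algebra.smul_def, smul_smul s, inv_smul_smul₀ hc]
    · exact lead1 _ _ _ hu h1
  -- A non-zero coefficient at `e_i` becomes one at `α` after multiplication by `α`, since `αα = κα
  -- = 0`.
  · obtain ⟨z, hz⟩ := lead1 r₀ 0 _ (tail_mono (by omega) (q.tail_mul_mem h le_rfl hu α)) h0
    refine ⟨ar α * z, ?_⟩
    rw [← hz, ← mul_assoc]
    simp only [add_mul, smul_mul_assoc, h.source, q.ar_α_mul_α h, q.ar_κ_mul_α h, smul_zero,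
      add_zero, zero_smul]

end Quad

end WeightedTriangulationQuiver

/-! ### Nilpotency at the vertices involved, and the kernel of multiplication by `ν` -/

namespace WeightedTriangulationQuiver

variable {V A K : Type*} [Field K] [Fintype V] {D : WeightedTriangulationQuiver V A K}
  {R : Type*} [Ring R] [Algebra K R] {ee : V → R} {ar : A → R}

/-- The elements annihilated by all sufficiently long words in the arrows. -/
def longAnnihilated (K : Type*) [Field K] {A R : Type*} [Ring R] [Algebra K R] (ar : A → R) :
    Submodule K R where
  carrier := {u | ∃ n, ∀ l : List A, n ≤ l.length → u * (l.map ar).prod = 0}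
  zero_mem' := ⟨0, fun _ _ => zero_mul _⟩
  add_mem' := by
    rintro u v ⟨m, hm⟩ ⟨n, hn⟩
    refine ⟨max m n, fun l hl => ?_⟩
    rw [add_mul, hm l (le_of_max_le_left hl), hn l (le_of_max_le_right hl), add_zero]
  smul_mem' := by
    rintro c u ⟨n, hn⟩
    exact ⟨n, fun l hl => by rw [smul_mul_assoc, hn l hl, smul_zero]⟩

theorem longAnnihilated_mul_left (r : R) {u : R} (hu : u ∈ longAnnihilated K ar) :
    r * u ∈ longAnnihilated K ar := by
  obtain ⟨n, hn⟩ := hu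
  exact ⟨n, fun l hl => by rw [mul_assoc, hn l hl, mul_zero]⟩

theorem longAnnihilated_of_forall [Fintype A] {u : R}
    (hu : ∀ a, u * ar a ∈ longAnnihilated K ar) : u ∈ longAnnihilated K ar := by
  choose n hn using hu
  refine ⟨Finset.univ.sup n + 1, fun l hl => ?_⟩
  match l with
  | [] => simp at hl
  | a :: l =>
    rw [List.map_cons, List.prod_cons, ← mul_assoc]
    apply hn
    have := Finset.le_sup (f := n) (Finset.mem_univ a)
    simp only [List.length_cons] at hl
    omega

theorem IsRep.longAnnihilated_mul_right (h : D.IsRep ee ar) (hg : Generates K ee ar) {u : R}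
    (hu : u ∈ longAnnihilated K ar) (r : R) : u * r ∈ longAnnihilated K ar := by
  refine hg.mul_mem ?_ ?_ hu r
  · rintro u ⟨n, hn⟩ v
    refine ⟨n + 1, fun l hl => ?_⟩
    match l with
    | [] => simp at hl
    | a :: l =>
      have h1 := hn (a :: l) (by omega)
      rw [List.map_cons, List.prod_cons] at h1 ⊢
      by_cases ha : D.s a = v
      · rw [mul_assoc, ← mul_assoc (ee v), ← ha, h.source, h1]
      · rw [mul_assoc, ← mul_assoc (ee v), h.ee_mul_of_ne ha, zero_mul, mul_zero]
  · rintro u ⟨n, hn⟩ a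
    refine ⟨n, fun l hl => ?_⟩
    have := hn (a :: l) (by rw [List.length_cons]; omega)
    rwa [List.map_cons, List.prod_cons, ← mul_assoc] at this

namespace Quad

variable {α κ β σ δ ν : A} (q : D.Quad α κ β σ δ ν) (h : D.IsRep ee ar)

include q h

theorem walk_g_mul_f {k : ℕ} (hk : 1 ≤ k) (hk' : k < D.N β) :
    ∃ r : K, D.walk ar (D.g δ) k * ar (D.f (D.g^[k - 1] (D.g δ))) =
      r • D.walk ar ν (D.N α - 1) := by
  rcases Nat.lt_or_ge k 3 with hk3 | hk3
  · obtain rfl | rfl : k = 1 ∨ k = 2 := by omega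
    · exact ⟨_, by rw [walk_one]; exact q.walk_g_one_mul h⟩
    · by_cases hv : D.N (D.f (D.g δ)) = 2
      · exact ⟨_, q.walk_g_two_mul_of_virtual h hv⟩
      · exact ⟨0, by rw [zero_smul]; exact q.walk_g_two_mul_of_not_virtual h hv⟩
  · exact ⟨0, by rw [zero_smul, q.walk_g_mul_f_eq_zero h hk3 hk']⟩

/-- A proper initial segment of the cycle of `g(δ)` is killed, prolonged, or sent to a multiple of
`A_ν`. Its mirror image controls the segments starting with `g(α)`. -/
theorem walk_g_mul_cases {k : ℕ} (hk : 1 ≤ k) (hk' : k < D.N β) (a : A) :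
    D.walk ar (D.g δ) k * ar a = 0 ∨
    D.walk ar (D.g δ) k * ar a = D.walk ar (D.g δ) (k + 1) ∨
    ∃ r : K, D.walk ar (D.g δ) k * ar a = r • D.walk ar ν (D.N α - 1) := by
  by_cases ha : D.s a = D.s (D.g^[k] (D.g δ))
  swap
  · exact Or.inl (h.walk_mul_of_ne _ a (by omega) ha)
  rcases D.eq_or_eq_bar ha with rfl | rfl
  · exact Or.inr (Or.inl (walk_succ ar _ _).symm)
  · right; right
    obtain ⟨r, hr⟩ := q.walk_g_mul_f h hk hk'
    obtain ⟨k, rfl⟩ := Nat.exists_eq_add_of_le' hk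
    rw [Nat.add_sub_cancel] at hr
    rw [Function.iterate_succ_apply', D.bar_g]
    exact ⟨r, hr⟩

theorem c_smul_walk_g_sub_one :
    D.c β • D.walk ar (D.g δ) (D.N β - 1) = ar ν * ar κ := (q.ar_ν_mul_κ h).symm

section LongAnnihilated

variable [Fintype A]

theorem tail_le_longAnnihilated {m : ℕ} (hm : 2 ≤ m) : tail D ar α m ≤ longAnnihilated K ar := by
  have key : ∀ l m, 2 ≤ m → D.N α < m + l → tail D ar α m ≤ longAnnihilated K ar := by
    intro l
    induction l with
    | zero =>
      intro m _ hN
      rw [q.tail_eq_bot h (by omega)]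
      exact bot_le
    | succ l ih =>
      intro m hm hN
      refine Submodule.span_le.2 ?_
      rintro _ ⟨k, hk, rfl⟩
      exact longAnnihilated_of_forall fun a => ih (m + 1) (by omega) (by omega)
        (tail_mono (Nat.succ_le_succ hk) (q.walk_α_mul_mem h (hm.trans hk) a))
  exact key (D.N α + 1) m hm (by omega)

theorem ee_mem_longAnnihilated : ee (D.s α) ∈ longAnnihilated K ar := by
  have hN := q.three_le
  have h2 : ∀ k, 2 ≤ k → D.walk ar α k ∈ longAnnihilated K ar := fun k hk =>
    q.tail_le_longAnnihilated h hk (walk_mem_tail ar α le_rfl)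
  have hκ : ar κ ∈ longAnnihilated K ar := by
    refine longAnnihilated_of_forall fun a => ?_
    by_cases ha : a = σ
    · rw [ha, q.ar_κ_mul_σ h]
      exact Submodule.smul_mem _ _ (h2 _ (by omega))
    by_cases ha' : a = δ
    · rw [ha', q.ar_κ_mul_δ h]
      exact Submodule.smul_mem _ _ (h2 _ (by omega))
    rw [q.ar_κ_mul_of_ne h ha ha']
    exact zero_mem _
  have hα : ar α ∈ longAnnihilated K ar := by
    refine longAnnihilated_of_forall fun a => ?_
    by_cases ha : D.s a = D.t α
    · rcases D.eq_f_or_eq_g ha with rfl | rfl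
      · rw [q.f_α, q.ar_α_mul_β h]; exact Submodule.smul_mem _ _ hκ
      · rw [← walk_two]; exact h2 2 le_rfl
    · rw [h.mul_eq_zero_of_ne ha]; exact zero_mem _
  refine longAnnihilated_of_forall fun a => ?_
  by_cases ha : D.s a = D.s α
  · rcases D.eq_or_eq_bar ha with rfl | rfl
    · rwa [h.source]
    · rwa [← D.s_bar, h.source, q.bar_α]
  · rw [h.ee_mul_of_ne ha]; exact zero_mem _

/-- Anything starting with `ν` factors through `e_i`, which has been treated. The segments from
`g(δ)` are handled by descending length: the one of length `N β - 1` is a multiple of `νκ`, and a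
shorter one times an arrow is zero, longer, or a multiple of a path from `ν`. -/
theorem ee_mem_longAnnihilated' (hg : Generates K ee ar) : ee (D.s ν) ∈ longAnnihilated K ar := by
  have hN := q.three_le
  have hR := q.three_le'
  have hν : ar ν ∈ longAnnihilated K ar := by
    rw [← h.target, ← D.s_f, q.f_ν, ← q.bar_α, D.s_bar]
    exact longAnnihilated_mul_left _ (q.ee_mem_longAnnihilated h)
  have hνw : D.walk ar ν (D.N α - 1) ∈ longAnnihilated K ar := by
    rw [show D.N α - 1 = D.N α - 2 + 1 by omega, walk_succ']
    exact h.longAnnihilated_mul_right hg hν _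
  have key : ∀ l, l + 2 ≤ D.N β →
      D.walk ar (D.g δ) (D.N β - 1 - l) ∈ longAnnihilated K ar := by
    intro l
    induction l with
    | zero =>
      intro _
      have h1 : D.c β • D.walk ar (D.g δ) (D.N β - 1) ∈ longAnnihilated K ar := by
        rw [q.c_smul_walk_g_sub_one h]
        exact h.longAnnihilated_mul_right hg hν _
      have h2 := Submodule.smul_mem _ (D.c β)⁻¹ h1
      rwa [inv_smul_smul₀ (D.c_ne_zero β)] at h2
    | succ l ih =>
      intro hl
      refine longAnnihilated_of_forall fun a => ?_
      rcases q.walk_g_mul_cases h (k := D.N β - 1 - (l + 1)) (by omega) (by omega) a with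
        h1 | h1 | ⟨r, h1⟩
      · rw [h1]; exact zero_mem _
      · rw [h1, show D.N β - 1 - (l + 1) + 1 = D.N β - 1 - l by omega]
        exact ih (by omega)
      · rw [h1]; exact Submodule.smul_mem _ _ hνw
  have h1 := key (D.N β - 2) (by omega)
  rw [show D.N β - 1 - (D.N β - 2) = 1 by omega, walk_one] at h1
  refine longAnnihilated_of_forall fun a => ?_
  by_cases ha : D.s a = D.s ν
  · rcases D.eq_or_eq_bar ha with rfl | rfl
    · rwa [h.source]
    · rwa [← D.s_bar, h.source, q.bar_ν]
  · rw [h.ee_mul_of_ne ha]; exact zero_mem _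

end LongAnnihilated

theorem ar_ν_mul_walk_α : ar ν * D.walk ar α (D.N α) = 0 := by
  have h1 : D.c α • (ar ν * D.walk ar α (D.N α)) = 0 := by
    have h2 := q.νκσ h
    rw [mul_assoc, q.ar_κ_mul_σ h, mul_smul_comm] at h2
    rw [(smul_eq_zero.1 h2).resolve_left
      (mul_ne_zero (D.c_ne_zero _) (inv_ne_zero (D.c_ne_zero _))), smul_zero]
  exact (smul_eq_zero.1 h1).resolve_left (D.c_ne_zero α)

/-- The kernel of left multiplication by `ν` on `e_i R` is the socle. -/
theorem eq_smul_of_ν_mul_eq_zero (hg : Generates K ee ar) (hω : D.walk ar ν (D.N α) ≠ 0) {x : R}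
    (hx : ee (D.s α) * x = x) (hx0 : ar ν * x = 0) : ∃ r : K, x = r • D.walk ar α (D.N α) := by
  have hN := q.three_le
  have hν : ∀ k, ar ν * D.walk ar α k = D.walk ar ν (k + 1) := fun k => by
    rw [walk_succ', q.g_ν]
  have hνN := q.ar_ν_mul_walk_α h
  have hνtail : ∀ e ∈ tail D ar α (D.N α), ar ν * e = 0 := by
    intro e he
    obtain ⟨r, u', hu', rfl⟩ := exists_add_of_mem_tail he
    rw [q.tail_eq_bot h (Nat.lt_succ_self _), Submodule.mem_bot] at hu'
    rw [hu', add_zero, mul_smul_comm, hνN, smul_zero]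
  -- A leading path shorter than the full one can be pushed to length `N α - 1`; preceded by `ν` it
  -- is the full path from `ν`, which is non-zero.
  have key : ∀ m u, 2 ≤ m → m + 1 ≤ D.N α → u ∈ tail D ar α (m + 1) →
      ar ν * (D.walk ar α m + u) ≠ 0 := by
    intro m u hm hmN hu h0
    obtain ⟨z, e, he, hz⟩ := q.walk_add_mul_mem h hm (M := D.N α - 1) (by omega) hu
    rw [show D.N α - 1 + 1 = D.N α by omega] at he
    apply hω
    have h1 : ar ν * (D.walk ar α (D.N α - 1) + e) = D.walk ar ν (D.N α) := by
      rw [mul_add, hνtail e he, hν, add_zero, show D.N α - 1 + 1 = D.N α by omega]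
    rw [← h1, ← hz, ← mul_assoc, h0, zero_mul]
  have keyr : ∀ (r : K) m u, r ≠ 0 → 2 ≤ m → m + 1 ≤ D.N α → u ∈ tail D ar α (m + 1) →
      ar ν * (r • D.walk ar α m + u) ≠ 0 := by
    intro r m u hr hm hmN hu h0
    refine key m (r⁻¹ • u) hm hmN (Submodule.smul_mem _ _ hu) ?_
    have h1 : D.walk ar α m + r⁻¹ • u = r⁻¹ • (r • D.walk ar α m + u) := by
      rw [smul_add, inv_smul_smul₀ hr]
    rw [h1, mul_smul_comm, h0, smul_zero]
  have lead1 : ∀ (r s : K) (u : R), u ∈ tail D ar α 2 → r ≠ 0 →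
      ar ν * (r • ar α + s • ar κ + u) ≠ 0 := by
    intro r s u hu hr h0
    refine keyr r 2 (u * ar (D.g α)) hr le_rfl (by omega) (q.tail_mul_mem h le_rfl hu _) ?_
    have h1 : (r • ar α + s • ar κ + u) * ar (D.g α) = r • D.walk ar α 2 + u * ar (D.g α) := by
      rw [add_mul, add_mul, smul_mul_assoc, smul_mul_assoc, q.ar_κ_mul_g h, walk_two, smul_zero,
        add_zero]
    rw [← h1, ← mul_assoc, h0, zero_mul]
  -- A term in `κ` needs care, as `κδ` is itself a path of length `N α - 1`. If the rest starts at
  -- length at least `N α - 1`, multiply by `δ`, so that `κδ` leads. If it starts earlier, multiply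
  -- by the next arrow of the cycle and let the rest lead.
  have keyκ : ∀ (s : K) (l m : ℕ), s ≠ 0 → 2 ≤ m → m + l = D.N α → ∀ u ∈ tail D ar α m,
      ar ν * (s • ar κ + u) ≠ 0 := by
    intro s l
    induction l with
    | zero =>
      intro m hs hm hml u hu h0
      rw [add_zero] at hml
      subst hml
      have h1 : (s • ar κ + u) * ar δ = (s * D.c α) • D.walk ar α (D.N α - 1) + u * ar δ := by
        rw [add_mul, smul_mul_assoc, q.ar_κ_mul_δ h, smul_smul]
      have h2 := q.tail_mul_mem h hm hu δ
      refine keyr _ (D.N α - 1) (u * ar δ) (mul_ne_zero hs (D.c_ne_zero α)) (by omega) (by omega)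
        (tail_mono (by omega) h2) ?_
      rw [← h1, ← mul_assoc, h0, zero_mul]
    | succ l ih =>
      intro m hs hm hml u hu h0
      obtain ⟨r, u', hu', rfl⟩ := exists_add_of_mem_tail hu
      by_cases hr : r = 0
      · rw [hr, zero_smul, zero_add] at h0
        exact ih (m + 1) hs (by omega) (by omega) u' hu' h0
      by_cases hl : l = 0
      · subst hl
        have h1 : (s • ar κ + (r • D.walk ar α m + u')) * ar δ =
            (s * D.c α) • D.walk ar α (D.N α - 1) + (r • D.walk ar α m + u') * ar δ := by
          rw [add_mul (s • ar κ), smul_mul_assoc, q.ar_κ_mul_δ h, smul_smul]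
        have h2 := q.tail_mul_mem h hm hu δ
        refine keyr _ (D.N α - 1) _ (mul_ne_zero hs (D.c_ne_zero α)) (by omega) (by omega)
          (tail_mono (by omega) h2) ?_
        rw [← h1, ← mul_assoc, h0, zero_mul]
      -- The contribution of `κ` is non-zero only if the next arrow is `δ`. It would then compete
      -- with the leading term just for `N α - 1 = m + 1`; but in that case `g(δ) = ν`, whereas
      -- `g(δ)` is the other arrow at `y`.
      · have h3 : ar κ * ar (D.g^[m] α) ∈ tail D ar α (m + 2) := by
          by_cases hδ : D.g^[m] α = δ
          · rw [hδ, q.ar_κ_mul_δ h]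
            by_cases hl1 : l = 1
            · exfalso
              have h4 := q.iterate_α
              rw [show D.N α - 1 = m + 1 by omega, Function.iterate_succ_apply', hδ, ← q.bar_ν]
                at h4
              exact D.bar_ne ν h4
            · exact Submodule.smul_mem _ _ (walk_mem_tail ar α (by omega))
          · rw [q.ar_κ_mul_of_ne h (iterate_g_ne_virtual q.N_σ q.three_le m).symm hδ]
            exact zero_mem _
        have h5 : (s • ar κ + (r • D.walk ar α m + u')) * ar (D.g^[m] α) =
            r • D.walk ar α (m + 1) + (s • (ar κ * ar (D.g^[m] α)) + u' * ar (D.g^[m] α)) := by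
          rw [add_mul, add_mul, smul_mul_assoc, smul_mul_assoc, ← walk_succ]
          abel
        refine keyr r (m + 1) _ hr (by omega) (by omega) (Submodule.add_mem _
          (Submodule.smul_mem _ s h3) (q.tail_mul_mem h (by omega) hu' (D.g^[m] α))) ?_
        rw [← h5, ← mul_assoc, h0, zero_mul]
  have keyt : ∀ (l m : ℕ), 2 ≤ m → m + l = D.N α → ∀ u ∈ tail D ar α m,
      ar ν * u = 0 → u ∈ tail D ar α (D.N α) := by
    intro l
    induction l with
    | zero =>
      intro m _ hml u hu _
      rwa [← hml]
    | succ l ih =>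
      intro m hm hml u hu h0
      obtain ⟨r, u', hu', rfl⟩ := exists_add_of_mem_tail hu
      by_cases hr : r = 0
      · rw [hr, zero_smul, zero_add] at h0 ⊢
        exact ih (m + 1) (by omega) (by omega) u' hu' h0
      · exact absurd h0 (keyr r m u' hr hm (by omega) hu')
  have hxc := q.ee_mul_mem_corner h hg x
  rw [hx, q.mem_corner h] at hxc
  obtain ⟨r₀, r₁, s, u, hu, rfl⟩ := hxc
  have h0 : r₀ = 0 := by
    by_contra h0
    refine lead1 r₀ 0 _ (tail_mono (by omega) (q.tail_mul_mem h le_rfl hu α)) h0 ?_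
    have h1 : (r₀ • ee (D.s α) + r₁ • ar α + s • ar κ + u) * ar α =
        r₀ • ar α + (0 : K) • ar κ + u * ar α := by
      simp only [add_mul, smul_mul_assoc, h.source, q.ar_α_mul_α h, q.ar_κ_mul_α h, smul_zero,
        add_zero, zero_smul]
    rw [← h1, ← mul_assoc, hx0, zero_mul]
  rw [h0, zero_smul, zero_add] at hx0 ⊢
  have h1 : r₁ = 0 := by
    by_contra h1
    exact lead1 r₁ s u hu h1 hx0
  rw [h1, zero_smul, zero_add] at hx0 ⊢
  have h2 : s = 0 := by
    by_contra h2
    exact keyκ s (D.N α - 2) 2 h2 le_rfl (by omega) u hu hx0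
  rw [h2, zero_smul, zero_add] at hx0 ⊢
  have h3 := keyt (D.N α - 2) 2 le_rfl (by omega) u hu hx0
  obtain ⟨r, u', hu', rfl⟩ := exists_add_of_mem_tail h3
  rw [q.tail_eq_bot h (Nat.lt_succ_self _), Submodule.mem_bot] at hu'
  exact ⟨r, by rw [hu', add_zero]⟩

end Quad

end WeightedTriangulationQuiver

/-! ### The second syzygy and exactness at `P_j` and `P_y` -/

namespace WeightedTriangulationQuiver

variable {V A K : Type*} [Field K] [Fintype V] {D : WeightedTriangulationQuiver V A K}
  {R : Type*} [Ring R] [Algebra K R] {ee : V → R} {ar : A → R}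

/-- The right ideal generated by `b`, as a subspace. -/
def rightIdeal (K : Type*) [Field K] {R : Type*} [Ring R] [Algebra K R] (b : R) :
    Submodule K R :=
  LinearMap.range (LinearMap.mulLeft K b)

theorem mem_rightIdeal {b x : R} : x ∈ rightIdeal K b ↔ ∃ r, b * r = x := Iff.rfl

theorem mul_mem_rightIdeal (b r : R) : b * r ∈ rightIdeal K b := ⟨r, rfl⟩

theorem rightIdeal_mul_mem {b x : R} (hx : x ∈ rightIdeal K b) (r : R) :
    x * r ∈ rightIdeal K b := by
  obtain ⟨y, rfl⟩ := hx
  exact ⟨y * r, (mul_assoc _ _ _).symm⟩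

theorem ar_mul_mem_tail (ar : A → R) (a : A) {m : ℕ} {u : R} (hu : u ∈ tail D ar (D.g a) m) :
    ar a * u ∈ tail D ar a (m + 1) := by
  induction hu using Submodule.span_induction with
  | mem x hx =>
    obtain ⟨k, hk, rfl⟩ := hx
    rw [← walk_succ']
    exact walk_mem_tail ar a (Nat.succ_le_succ hk)
  | zero => rw [mul_zero]; exact zero_mem _
  | add x y _ _ hx hy => rw [mul_add]; exact add_mem hx hy
  | smul k x _ hx => rw [mul_smul_comm]; exact Submodule.smul_mem _ k hx

/-- The element `βδ - c_κ c_α g(α) ⋯ g^(m_α n_α - 2)(α)` generating the second syzygy of `S_i`. -/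
noncomputable def relator (D : WeightedTriangulationQuiver V A K) (ar : A → R) (α κ β δ : A) : R :=
  ar β * ar δ - (D.c κ * D.c α) • D.walk ar (D.g α) (D.N α - 2)

namespace Quad

variable {α κ β σ δ ν : A} (q : D.Quad α κ β σ δ ν) (h : D.IsRep ee ar)

include q h

theorem α_mul_relator : ar α * relator D ar α κ β δ = 0 := by
  have hN := q.three_le
  rw [relator, mul_sub, ← mul_assoc, q.ar_α_mul_β h, smul_mul_assoc, q.ar_κ_mul_δ h, smul_smul,
    mul_smul_comm, ← walk_succ', show D.N α - 2 + 1 = D.N α - 1 by omega, sub_self]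

theorem relator_mul_ν : relator D ar α κ β δ * ar ν = 0 := by
  have hN := q.three_le
  have h1 : D.walk ar (D.g α) (D.N α - 2) * ar ν = D.walk ar (D.g α) (D.N α - 1) := by
    conv_rhs => rw [show D.N α - 1 = D.N α - 2 + 1 by omega, walk_succ, q.iterate_g_α]
  rw [relator, sub_mul, mul_assoc, q.ar_δ_mul_ν h, mul_smul_comm, q.ar_β_mul_σ h, smul_smul,
    smul_mul_assoc, h1, sub_self]

theorem ee_mul_relator : ee (D.s β) * relator D ar α κ β δ = relator D ar α κ β δ := by
  have hN := q.three_le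
  have h1 := h.ee_mul_walk (D.g α) (k := D.N α - 2) (by omega)
  rw [← q.bar_β, D.s_bar, q.bar_β] at h1
  rw [relator, mul_sub, ← mul_assoc, h.source, mul_smul_comm, h1]

theorem relator_mul_ee : relator D ar α κ β δ * ee (D.s ν) = relator D ar α κ β δ := by
  have hN := q.three_le
  have h1 := h.walk_mul_ee (D.g α) (k := D.N α - 2) (by omega)
  rw [q.iterate_g_α] at h1
  have h2 : ar δ * ee (D.s ν) = ar δ := by
    rw [← q.f_δ, D.s_f, h.target]
  rw [relator, sub_mul, mul_assoc, h2, smul_mul_assoc, h1]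

theorem tail_β_eq_bot {m : ℕ} (hm : D.N β < m) : tail D ar β m = ⊥ := by
  refine le_bot_iff.1 (Submodule.span_le.2 ?_)
  rintro _ ⟨k, hk, rfl⟩
  exact (Submodule.mem_bot K).2 (q.walk_β_eq_zero h (hm.trans_le hk))

theorem tail_β_mul_mem {m : ℕ} (hm : 3 ≤ m) {u : R} (hu : u ∈ tail D ar β m) (a : A) :
    u * ar a ∈ tail D ar β (m + 1) := by
  refine mul_mem_of_mem_tail hu _ fun k hk => ?_
  obtain ⟨k, rfl⟩ := Nat.exists_eq_add_of_le' (show 1 ≤ k by omega)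
  rw [walk_succ', mul_assoc, q.g_β]
  refine tail_mono (by omega) (ar_mul_mem_tail ar β (m := k + 1) ?_)
  rw [q.g_β]
  exact q.swap.walk_α_mul_mem h (by omega) a

theorem smul_walk_β_add_ne_zero (hω : D.walk ar β (D.N β) ≠ 0) {m : ℕ} (hm : 3 ≤ m)
    (hmN : m ≤ D.N β) {r : K} (hr : r ≠ 0) {u : R} (hu : u ∈ tail D ar β (m + 1)) :
    r • D.walk ar β m + u ≠ 0 := by
  obtain ⟨l, hl⟩ := Nat.exists_eq_add_of_le hmN
  induction l generalizing m u with
  | zero =>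
    rw [q.tail_β_eq_bot h (by omega), Submodule.mem_bot] at hu
    rw [hu, add_zero, show m = D.N β by omega]
    exact smul_ne_zero hr hω
  | succ l ih =>
    intro h0
    apply ih (m := m + 1) (by omega) (by omega)
      (q.tail_β_mul_mem h (by omega) hu (D.g^[m] β)) (by omega)
    rw [walk_succ, ← smul_mul_assoc, ← add_mul, h0, zero_mul]

/-- The hypothesis is the only use of non-singularity. The first term of the relator gives the path
of length three from `β`. The second term leaves the cycle of `α` and gives zero or a multiple of
`A_β`, of length `N β - 1`; this competes with the first term only if `N β = 4`. -/
theorem relator_mul_g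
    (hns : D.N α = 4 → D.N β = 4 → D.N (D.f (D.g α)) = 2 →
      D.c κ * D.c α * D.c (D.f (D.g α)) * D.c β ≠ 1) :
    ∃ r : K, r ≠ 0 ∧ ∃ u ∈ tail D ar β 4,
      relator D ar α κ β δ * ar (D.g δ) = r • D.walk ar β 3 + u := by
  have hN := q.three_le
  have hR := q.three_le'
  have h1 : ar β * ar δ * ar (D.g δ) = D.walk ar β 3 := by
    rw [walk_succ', walk_succ', walk_one, q.g_β, mul_assoc]
  -- The path in the relator has length `N α - 2` and would continue with `ν`; hence `g(δ)`, the
  -- other arrow at `y`, is the one leaving the cycle.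
  have h2 : D.g δ = D.f (D.g^[D.N α - 3] (D.g α)) := by
    rw [← D.bar_g, ← Function.iterate_succ_apply' D.g, ← q.bar_ν,
      show (D.N α - 3).succ = D.N α - 2 by omega, q.iterate_g_α]
  have h3 : relator D ar α κ β δ * ar (D.g δ) = D.walk ar β 3 - (D.c κ * D.c α) •
      (D.walk ar (D.g α) (D.N α - 2) * ar (D.f (D.g^[D.N α - 3] (D.g α)))) := by
    rw [relator, sub_mul, h1, smul_mul_assoc, ← h2]
  rw [h3]
  have hzero : D.walk ar (D.g α) (D.N α - 2) * ar (D.f (D.g^[D.N α - 3] (D.g α))) = 0 →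
      ∃ r : K, r ≠ 0 ∧ ∃ u ∈ tail D ar β 4, D.walk ar β 3 - (D.c κ * D.c α) •
        (D.walk ar (D.g α) (D.N α - 2) * ar (D.f (D.g^[D.N α - 3] (D.g α)))) =
          r • D.walk ar β 3 + u := fun h0 =>
    ⟨1, one_ne_zero, 0, zero_mem _, by rw [h0, smul_zero, sub_zero, one_smul, add_zero]⟩
  have hlong : 5 ≤ D.N β → ∀ r : K, D.walk ar (D.g α) (D.N α - 2) *
      ar (D.f (D.g^[D.N α - 3] (D.g α))) = r • D.walk ar β (D.N β - 1) →
      ∃ r : K, r ≠ 0 ∧ ∃ u ∈ tail D ar β 4, D.walk ar β 3 - (D.c κ * D.c α) •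
        (D.walk ar (D.g α) (D.N α - 2) * ar (D.f (D.g^[D.N α - 3] (D.g α)))) =
          r • D.walk ar β 3 + u := fun h5 r h0 =>
    ⟨1, one_ne_zero, -((D.c κ * D.c α) • r • D.walk ar β (D.N β - 1)),
      neg_mem (Submodule.smul_mem _ _ (Submodule.smul_mem _ _ (walk_mem_tail ar β (by omega)))),
      by rw [h0, one_smul, sub_eq_add_neg]⟩
  rcases Nat.lt_or_ge (D.N α) 5 with hN5 | hN5
  · obtain hN3 | hN4 : D.N α = 3 ∨ D.N α = 4 := by omega
    · refine hlong (q.five_le_of_N_eq_three' hN3) (D.c β) ?_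
      have h4 := q.swap.walk_g_one_mul h
      rw [q.N_δ, q.c_δ] at h4
      rw [hN3, walk_one]
      exact h4
    · by_cases hv : D.N (D.f (D.g α)) = 2
      · have h4 := q.swap.walk_g_two_mul_of_virtual h hv
        rw [q.N_δ, q.c_δ] at h4
        have h5 : D.walk ar (D.g α) (D.N α - 2) * ar (D.f (D.g^[D.N α - 3] (D.g α))) =
            (D.c (D.f (D.g α)) * D.c β) • D.walk ar β (D.N β - 1) := by
          rw [hN4]
          exact h4
        rcases Nat.lt_or_ge (D.N β) 5 with hR5 | hR5
        · have hR3 : D.N β ≠ 3 := fun h6 => by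
            have := q.five_le_of_N_eq_three h6
            omega
          have hR4 : D.N β = 4 := by omega
          -- The critical case: both terms are multiples of the same path of length three, and the
          -- coefficient is non-zero precisely by hypothesis.
          refine ⟨1 - D.c κ * D.c α * D.c (D.f (D.g α)) * D.c β,
            sub_ne_zero.2 (hns hN4 hR4 hv).symm, 0, zero_mem _, ?_⟩
          rw [h5, hR4, add_zero, sub_smul, one_smul, smul_smul, mul_assoc (D.c κ * D.c α)]
        · exact hlong hR5 _ h5
      · have h4 := q.swap.walk_g_two_mul_of_not_virtual h hv
        apply hzero
        rw [hN4]
        exact h4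
  · apply hzero
    have h4 := q.swap.walk_g_mul_f_eq_zero h (k := D.N α - 2) (by omega) (by rw [q.N_ν]; omega)
    rwa [show D.N α - 2 - 1 = D.N α - 3 by omega] at h4

theorem relator_mul_walk {r : K} {u : R} (hu : u ∈ tail D ar β 4)
    (hr : relator D ar α κ β δ * ar (D.g δ) = r • D.walk ar β 3 + u) (k : ℕ) :
    ∃ u ∈ tail D ar β (k + 4),
      relator D ar α κ β δ * D.walk ar (D.g δ) (k + 1) = r • D.walk ar β (k + 3) + u := by
  induction k with
  | zero => exact ⟨u, hu, by rw [zero_add, walk_one, hr]⟩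
  | succ k ih =>
    obtain ⟨u, hu, hk⟩ := ih
    refine ⟨_, q.tail_β_mul_mem h (by omega) hu (D.g^[k + 1] (D.g δ)), ?_⟩
    have h1 : D.g^[k + 3] β = D.g^[k + 1] (D.g δ) := by
      rw [← q.g_β, ← Function.iterate_succ_apply, ← Function.iterate_succ_apply]
    rw [walk_succ, ← mul_assoc, hk, add_mul, smul_mul_assoc, ← h1, ← walk_succ]

/-- Descending induction on length: a path from `β` of length at least three is, up to a scalar and
longer paths, the relator times a segment starting with `g(δ)`. -/
theorem tail_β_le {r : K} (hr0 : r ≠ 0) {u : R} (hu : u ∈ tail D ar β 4)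
    (hr : relator D ar α κ β δ * ar (D.g δ) = r • D.walk ar β 3 + u) {m : ℕ} (hm : 3 ≤ m) :
    tail D ar β m ≤ rightIdeal K (relator D ar α κ β δ) := by
  have key : ∀ l m, 3 ≤ m → D.N β < m + l →
      tail D ar β m ≤ rightIdeal K (relator D ar α κ β δ) := by
    intro l
    induction l with
    | zero =>
      intro m _ hN
      rw [q.tail_β_eq_bot h (by omega)]
      exact bot_le
    | succ l ih =>
      intro m hm hN x hx
      obtain ⟨s, x', hx', rfl⟩ := exists_add_of_mem_tail hx
      refine add_mem (Submodule.smul_mem _ _ ?_) (ih (m + 1) (by omega) (by omega) hx')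
      obtain ⟨k, rfl⟩ := Nat.exists_eq_add_of_le' hm
      obtain ⟨e, he, hk⟩ := q.relator_mul_walk h hu hr k
      have h1 : D.walk ar β (k + 3) =
          r⁻¹ • (relator D ar α κ β δ * D.walk ar (D.g δ) (k + 1) - e) := by
        rw [hk, add_sub_cancel_right, inv_smul_smul₀ hr0]
      rw [h1]
      exact Submodule.smul_mem _ _ (sub_mem (mul_mem_rightIdeal _ _)
        (ih (k + 4) (by omega) (by omega) he))
  exact key (D.N β + 1) m hm (by omega)

/-- The two full `g`-paths at `j` are proportional, so the full path from `g(α)` is covered by the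
paths from `β`. -/
theorem walk_g_α_mem_rightIdeal {r : K} (hr0 : r ≠ 0) {u : R} (hu : u ∈ tail D ar β 4)
    (hr : relator D ar α κ β δ * ar (D.g δ) = r • D.walk ar β 3 + u) :
    tail D ar (D.g α) (D.N α) ≤ rightIdeal K (relator D ar α κ β δ) := by
  have hR := q.three_le'
  refine Submodule.span_le.2 ?_
  rintro _ ⟨k, hk, rfl⟩
  rcases (Set.mem_Ici.1 hk).eq_or_lt with hk | hk
  · have h1 := q.swap.c_smul_walk_g h
    rw [q.N_ν, q.c_ν, q.N_δ, q.c_δ] at h1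
    have h2 : D.walk ar (D.g α) (D.N α) = (D.c α)⁻¹ • D.c β • D.walk ar β (D.N β) := by
      rw [← h1, inv_smul_smul₀ (D.c_ne_zero α)]
    rw [← hk, h2]
    exact Submodule.smul_mem _ _ (Submodule.smul_mem _ _
      (q.tail_β_le h hr0 hu hr hR (walk_mem_tail ar β le_rfl)))
  · have h1 := q.swap.walk_g_eq_zero h (k := k) (by rw [q.N_ν]; exact hk)
    rw [h1]
    exact zero_mem _

/-- The kernel of left multiplication by `α` on `e_j R` is generated by the relator. -/
theorem exists_relator_mul (hg : Generates K ee ar) (hω : D.walk ar α (D.N α) ≠ 0)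
    (hns : D.N α = 4 → D.N β = 4 → D.N (D.f (D.g α)) = 2 →
      D.c κ * D.c α * D.c (D.f (D.g α)) * D.c β ≠ 1) {x : R}
    (hx : ee (D.s β) * x = x) (hx0 : ar α * x = 0) : ∃ r, relator D ar α κ β δ * r = x := by
  have hN := q.three_le
  have hR := q.three_le'
  obtain ⟨r, hr0, u, hu, hr⟩ := q.relator_mul_g h hns
  have hsg : D.s (D.g α) = D.s β := by rw [← q.bar_β, D.s_bar]
  set I := rightIdeal K (relator D ar α κ β δ) with hI
  -- Modulo the relator, `βδ` is a path from `g(α)` and longer paths from `β` vanish; so this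
  -- subspace is all of `e_j R`.
  set U : Submodule K R := Submodule.span K {ee (D.s β), ar β} ⊔ tail D ar (D.g α) 1 ⊔ I with hU
  have m0 : ee (D.s β) ∈ U := Submodule.mem_sup_left (Submodule.mem_sup_left
    (Submodule.subset_span (by simp)))
  have m1 : ar β ∈ U := Submodule.mem_sup_left (Submodule.mem_sup_left
    (Submodule.subset_span (by simp)))
  have m2 : tail D ar (D.g α) 1 ≤ U := le_sup_of_le_left le_sup_right
  have m3 : I ≤ U := le_sup_right
  have hwalk : ∀ k, 2 ≤ k → D.walk ar β k ∈ U := by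
    intro k hk
    rcases hk.eq_or_lt with rfl | hk
    · rw [walk_two, q.g_β, show ar β * ar δ = relator D ar α κ β δ +
        (D.c κ * D.c α) • D.walk ar (D.g α) (D.N α - 2) by rw [relator, sub_add_cancel]]
      refine add_mem (m3 ?_) (Submodule.smul_mem _ _ (m2 (walk_mem_tail ar _ (by omega))))
      exact ⟨1, mul_one _⟩
    · exact m3 (q.tail_β_le h hr0 hu hr le_rfl (walk_mem_tail ar β hk))
  have memU : ∀ {x : R}, x ∈ U ↔ ∃ r₀ r₁ : K, ∃ u ∈ tail D ar (D.g α) 1, ∃ v ∈ I,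
      x = r₀ • ee (D.s β) + r₁ • ar β + u + v := by
    intro x
    simp only [hU, Submodule.mem_sup, Submodule.mem_span_insert, Submodule.mem_span_singleton]
    constructor
    · rintro ⟨_, ⟨_, ⟨r₀, _, ⟨r₁, rfl⟩, rfl⟩, u', hu', rfl⟩, v, hv, rfl⟩
      exact ⟨r₀, r₁, u', hu', v, hv, rfl⟩
    · rintro ⟨r₀, r₁, u', hu', v, hv, rfl⟩
      exact ⟨_, ⟨_, ⟨r₀, _, ⟨r₁, rfl⟩, rfl⟩, u', hu', rfl⟩, v, hv, rfl⟩
  have hcases : ∀ r : R, ee (D.s β) * r ∈ U → ar β * r ∈ U →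
      (∀ k, 1 ≤ k → D.walk ar (D.g α) k * r ∈ U) → ∀ x ∈ U, x * r ∈ U := by
    intro r t0 t1 t2 x hx
    obtain ⟨r₀, r₁, u', hu', v, hv, rfl⟩ := memU.1 hx
    simp only [add_mul, smul_mul_assoc]
    exact add_mem (add_mem (add_mem (Submodule.smul_mem _ _ t0) (Submodule.smul_mem _ _ t1))
      (mul_mem_of_mem_tail hu' r t2)) (m3 (rightIdeal_mul_mem hv r))
  have hxU : x ∈ U := by
    rw [← hx]
    refine hg.mul_mem (fun w hw v => hcases _ ?_ ?_ ?_ w hw)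
      (fun w hw a => hcases _ ?_ ?_ ?_ w hw) m0 x
    · exact h.mul_ee_mem v _ m0 (h.idem _)
    · exact h.ar_mul_ee_mem m1 v
    · exact fun k hk => h.walk_mul_ee_mem (by omega) (m2 (walk_mem_tail ar _ hk)) v
    · by_cases ha : D.s a = D.s β
      · rcases D.eq_or_eq_bar ha with rfl | rfl
        · rwa [h.source]
        · rw [← D.s_bar, h.source, q.bar_β, ← walk_one (D := D) ar (D.g α)]
          exact m2 (walk_mem_tail ar _ le_rfl)
      · rw [h.ee_mul_of_ne ha]; exact zero_mem _
    · by_cases ha : D.s a = D.t β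
      · rcases D.eq_f_or_eq_g ha with rfl | rfl
        · rw [q.f_β, q.ar_β_mul_σ h]
          exact Submodule.smul_mem _ _ (m2 (walk_mem_tail ar _ (by omega)))
        · rw [← walk_two]; exact hwalk 2 le_rfl
      · rw [h.mul_eq_zero_of_ne ha]; exact zero_mem _
    · intro k hk
      rcases Nat.lt_or_ge k (D.N α) with hkN | hkN
      · rcases q.swap.walk_g_mul_cases h hk (by rwa [q.N_ν]) a with h1 | h1 | ⟨s, h1⟩
        · rw [h1]; exact zero_mem _
        · rw [h1]; exact m2 (walk_mem_tail ar _ (by omega))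
        · rw [h1, q.N_δ]; exact Submodule.smul_mem _ _ (hwalk _ (by omega))
      · exact m3 (rightIdeal_mul_mem (q.walk_g_α_mem_rightIdeal h hr0 hu hr
          (walk_mem_tail ar _ hkN)) _)
  have hα : ∀ v ∈ I, ar α * v = 0 := by
    rintro _ ⟨y, rfl⟩
    change ar α * (relator D ar α κ β δ * y) = 0
    rw [← mul_assoc, q.α_mul_relator h, zero_mul]
  have hne : ∀ (r : K) (m : ℕ) (u : R), r ≠ 0 → 2 ≤ m → m ≤ D.N α → u ∈ tail D ar α (m + 1) →
      r • D.walk ar α m + u ≠ 0 := by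
    intro r m u hr hm hmN hu h0
    obtain ⟨z, hz⟩ := q.walk_add_mul_eq h hm hmN (Submodule.smul_mem _ r⁻¹ hu)
    apply hω
    have h1 : D.walk ar α m + r⁻¹ • u = r⁻¹ • (r • D.walk ar α m + u) := by
      rw [smul_add, inv_smul_smul₀ hr]
    rw [← hz, h1, h0, smul_zero, zero_mul]
  have key : ∀ l m, 1 ≤ m → m + l = D.N α → ∀ u ∈ tail D ar (D.g α) m, ar α * u = 0 → u ∈ I := by
    intro l
    induction l with
    | zero =>
      intro m _ hml u hu' _
      rw [add_zero] at hml
      exact q.walk_g_α_mem_rightIdeal h hr0 hu hr (hml ▸ hu')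
    | succ l ih =>
      intro m hm hml w hw h0
      obtain ⟨s, w', hw', rfl⟩ := exists_add_of_mem_tail hw
      have h1 := ar_mul_mem_tail ar α hw'
      by_cases hs : s = 0
      · rw [hs, zero_smul, zero_add] at h0 ⊢
        have hm1 : m + 1 + l = D.N α := by rw [← hml, add_assoc, add_comm 1 l]
        exact ih (m + 1) (Nat.le_add_left 1 m) hm1 w' hw' h0
      · rw [mul_add, mul_smul_comm, ← walk_succ'] at h0
        exact absurd h0 (hne s (m + 1) _ hs (by omega) (by omega) h1)
  obtain ⟨r₀, r₁, w, hw, v, hv, rfl⟩ := memU.1 hxU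
  have hαe : ar α * ee (D.s β) = ar α := by rw [← q.f_α, D.s_f, h.target]
  have hw2 := ar_mul_mem_tail ar α hw
  rw [mul_add, mul_add, mul_add, mul_smul_comm, mul_smul_comm, hαe, q.ar_α_mul_β h, hα v hv,
    add_zero] at hx0
  -- Multiplication by `g(α)` removes the term in `κ`, so that `r₀` becomes a leading coefficient.
  have hr00 : r₀ = 0 := by
    by_contra h0
    refine hne r₀ 2 (ar α * w * ar (D.g α)) h0 le_rfl (by omega)
      (q.tail_mul_mem h le_rfl hw2 (D.g α)) ?_
    have h1 : (r₀ • ar α + r₁ • D.c κ • ar κ + ar α * w) * ar (D.g α) =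
        r₀ • D.walk ar α 2 + ar α * w * ar (D.g α) := by
      rw [add_mul, add_mul, smul_mul_assoc, smul_mul_assoc, smul_mul_assoc, q.ar_κ_mul_g h,
        walk_two, smul_zero, smul_zero, add_zero]
    rw [← h1, hx0, zero_mul]
  rw [hr00, zero_smul, zero_add] at hx0 ⊢
  -- Multiplication by `σ` removes the longer paths and sends `κ` to the socle.
  have hr10 : r₁ = 0 := by
    have h1 : (r₁ • D.c κ • ar κ + ar α * w) * ar σ = (r₁ * D.c α) • D.walk ar α (D.N α) := by
      rw [add_mul, q.tail_mul_σ h hw2, add_zero, smul_mul_assoc, smul_mul_assoc,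
        q.ar_κ_mul_σ h, smul_smul, smul_smul]
      congr 1
      have := D.c_ne_zero κ
      field_simp
    rw [hx0, zero_mul] at h1
    have h2 := (smul_eq_zero.1 h1.symm).resolve_right hω
    exact (mul_eq_zero.1 h2).resolve_right (D.c_ne_zero α)
  rw [hr10, zero_smul, zero_add] at hx0 ⊢
  exact mem_rightIdeal.1 (Submodule.add_mem I (key (D.N α - 1) 1 le_rfl (by omega) w hw hx0) hv)

/-- The kernel of left multiplication by the relator on `e_y R` is generated by `ν`. -/
theorem exists_ν_mul (hg : Generates K ee ar) (hω : D.walk ar β (D.N β) ≠ 0)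
    (hns : D.N α = 4 → D.N β = 4 → D.N (D.f (D.g α)) = 2 →
      D.c κ * D.c α * D.c (D.f (D.g α)) * D.c β ≠ 1) {x : R}
    (hx : ee (D.s ν) * x = x) (hx0 : relator D ar α κ β δ * x = 0) : ∃ r, ar ν * r = x := by
  have hN := q.three_le
  have hR := q.three_le'
  obtain ⟨r, hr0, u, hu, hr⟩ := q.relator_mul_g h hns
  set b := relator D ar α κ β δ with hb
  set I := rightIdeal K (ar ν) with hI
  set U : Submodule K R := Submodule.span K {ee (D.s ν)} ⊔ tail D ar (D.g δ) 1 ⊔ I with hU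
  have m0 : ee (D.s ν) ∈ U := Submodule.mem_sup_left (Submodule.mem_sup_left
    (Submodule.subset_span (by simp)))
  have m2 : tail D ar (D.g δ) 1 ≤ U := le_sup_of_le_left le_sup_right
  have m3 : I ≤ U := le_sup_right
  -- From length `N β - 1` on, segments of the cycle of `g(δ)` are multiples of `νκ`.
  have hlast : tail D ar (D.g δ) (D.N β - 1) ≤ I := by
    refine Submodule.span_le.2 ?_
    rintro _ ⟨k, hk, rfl⟩
    obtain ⟨l, rfl⟩ := Nat.exists_eq_add_of_le (Set.mem_Ici.1 hk)
    rw [walk_add]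
    have h1 : D.walk ar (D.g δ) (D.N β - 1) = (D.c β)⁻¹ • (ar ν * ar κ) := by
      rw [← q.c_smul_walk_g_sub_one h, inv_smul_smul₀ (D.c_ne_zero β)]
    rw [h1]
    exact rightIdeal_mul_mem (Submodule.smul_mem _ _ (mul_mem_rightIdeal _ _)) _
  have memU : ∀ {x : R}, x ∈ U ↔ ∃ r₀ : K, ∃ u ∈ tail D ar (D.g δ) 1, ∃ v ∈ I,
      x = r₀ • ee (D.s ν) + u + v := by
    intro x
    simp only [hU, Submodule.mem_sup, Submodule.mem_span_singleton]
    constructor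
    · rintro ⟨_, ⟨_, ⟨r₀, rfl⟩, u', hu', rfl⟩, v, hv, rfl⟩
      exact ⟨r₀, u', hu', v, hv, rfl⟩
    · rintro ⟨r₀, u', hu', v, hv, rfl⟩
      exact ⟨_, ⟨_, ⟨r₀, rfl⟩, u', hu', rfl⟩, v, hv, rfl⟩
  have hcases : ∀ r : R, ee (D.s ν) * r ∈ U →
      (∀ k, 1 ≤ k → D.walk ar (D.g δ) k * r ∈ U) → ∀ x ∈ U, x * r ∈ U := by
    intro r t0 t2 x hx
    obtain ⟨r₀, u', hu', v, hv, rfl⟩ := memU.1 hx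
    simp only [add_mul, smul_mul_assoc]
    exact add_mem (add_mem (Submodule.smul_mem _ _ t0)
      (mul_mem_of_mem_tail hu' r t2)) (m3 (rightIdeal_mul_mem hv r))
  have hxU : x ∈ U := by
    rw [← hx]
    refine hg.mul_mem (fun w hw v => hcases _ ?_ ?_ w hw)
      (fun w hw a => hcases _ ?_ ?_ w hw) m0 x
    · exact h.mul_ee_mem v _ m0 (h.idem _)
    · exact fun k hk => h.walk_mul_ee_mem (by omega) (m2 (walk_mem_tail ar _ hk)) v
    · by_cases ha : D.s a = D.s ν
      · rcases D.eq_or_eq_bar ha with rfl | rfl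
        · rw [h.source]; exact m3 ⟨1, mul_one _⟩
        · rw [← D.s_bar, h.source, q.bar_ν, ← walk_one (D := D) ar (D.g δ)]
          exact m2 (walk_mem_tail ar _ le_rfl)
      · rw [h.ee_mul_of_ne ha]; exact zero_mem _
    · intro k hk
      rcases Nat.lt_or_ge k (D.N β) with hkN | hkN
      · rcases q.walk_g_mul_cases h hk hkN a with h1 | h1 | ⟨s, h1⟩
        · rw [h1]; exact zero_mem _
        · rw [h1]; exact m2 (walk_mem_tail ar _ (by omega))
        · rw [h1, show D.N α - 1 = D.N α - 2 + 1 by omega, walk_succ']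
          exact Submodule.smul_mem _ _ (m3 (mul_mem_rightIdeal _ _))
      · exact m3 (rightIdeal_mul_mem (hlast (walk_mem_tail ar _ (by omega))) _)
  have hbI : ∀ v ∈ I, b * v = 0 := by
    rintro _ ⟨y, rfl⟩
    change b * (ar ν * y) = 0
    rw [← mul_assoc, q.relator_mul_ν h, zero_mul]
  -- Left multiplication by the relator shifts the length by exactly two. Hence segments shorter
  -- than `N β - 1` have images with a non-zero leading term, of length at most `N β`.
  have hbtail : ∀ m, ∀ u ∈ tail D ar (D.g δ) (m + 1), b * u ∈ tail D ar β (m + 3) := by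
    intro m u hu'
    induction hu' using Submodule.span_induction with
    | mem x hx =>
      obtain ⟨k, hk, rfl⟩ := hx
      obtain ⟨k, rfl⟩ := Nat.exists_eq_add_of_le' (show 1 ≤ k by rw [Set.mem_Ici] at hk; omega)
      obtain ⟨e, he, hk'⟩ := q.relator_mul_walk h hu hr k
      rw [Set.mem_Ici] at hk
      rw [hk']
      exact add_mem (Submodule.smul_mem _ _ (walk_mem_tail ar β (by omega)))
        (tail_mono (by omega) he)
    | zero => rw [mul_zero]; exact zero_mem _
    | add x y _ _ hx hy => rw [mul_add]; exact add_mem hx hy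
    | smul k x _ hx => rw [mul_smul_comm]; exact Submodule.smul_mem _ k hx
  have key : ∀ l m, m + 1 + l = D.N β - 1 → ∀ u ∈ tail D ar (D.g δ) (m + 1), b * u = 0 →
      u ∈ I := by
    intro l
    induction l with
    | zero =>
      intro m hml u hu' _
      rw [add_zero] at hml
      exact hlast (hml ▸ hu')
    | succ l ih =>
      intro m hml w hw h0
      obtain ⟨s, w', hw', rfl⟩ := exists_add_of_mem_tail hw
      by_cases hs : s = 0
      · rw [hs, zero_smul, zero_add] at h0 ⊢
        exact ih (m + 1) (by omega) w' hw' h0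
      · exfalso
        obtain ⟨e, he, hk⟩ := q.relator_mul_walk h hu hr m
        rw [mul_add, mul_smul_comm, hk, smul_add, smul_smul, add_assoc] at h0
        exact q.smul_walk_β_add_ne_zero h hω (by omega) (by omega) (mul_ne_zero hs hr0)
          (add_mem (Submodule.smul_mem _ s he) (hbtail (m + 1) _ hw')) h0
  obtain ⟨r₀, w, hw, v, hv, rfl⟩ := memU.1 hxU
  have hbe : b * ee (D.s ν) = b := q.relator_mul_ee h
  rw [mul_add, mul_add, mul_smul_comm, hbe, hbI v hv, add_zero] at hx0
  have hr00 : r₀ = 0 := by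
    by_contra h0
    have h1 : (r₀ • b + b * w) * ar (D.g δ) =
        (r₀ * r) • D.walk ar β 3 + (r₀ • u + b * w * ar (D.g δ)) := by
      rw [add_mul, smul_mul_assoc, hr, smul_add, smul_smul, add_assoc]
    rw [hx0, zero_mul] at h1
    exact q.smul_walk_β_add_ne_zero h hω le_rfl hR (mul_ne_zero h0 hr0)
      (add_mem (Submodule.smul_mem _ r₀ hu)
        (q.tail_β_mul_mem h le_rfl (hbtail 0 w hw) (D.g δ))) h1.symm
  rw [hr00, zero_smul, zero_add] at hx0 ⊢
  exact mem_rightIdeal.1 (Submodule.add_mem I (key (D.N β - 2) 0 (by omega) w hw hx0) hv)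

end Quad

end WeightedTriangulationQuiver

/-! ### Modules given by a basis and an action of the arrows -/

namespace WeightedTriangulationQuiver

open MulOpposite

variable {V A K : Type*} [Field K] [Fintype V] {D : WeightedTriangulationQuiver V A K}

section Act

variable {X : Type*}

open Classical in
/-- The projection to the span of the basis vectors at the vertex `v`. -/
noncomputable def vertexProj (K : Type*) [Field K] {V X : Type*} (vtx : X → V) (v : V) :
    Module.End K (X →₀ K) :=
  Finsupp.linearCombination K fun x => if vtx x = v then Finsupp.single x 1 else 0

/-- The linear extension of a map on basis vectors. -/
noncomputable def actEnd (act : A → X → X →₀ K) (a : A) : Module.End K (X →₀ K) :=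
  Finsupp.linearCombination K (act a)

theorem actEnd_single (act : A → X → X →₀ K) (a : A) (x : X) :
    actEnd act a (Finsupp.single x 1) = act a x := by
  rw [actEnd, Finsupp.linearCombination_single, one_smul]

theorem vertexProj_single_self {vtx : X → V} {v : V} {x : X} (h : vtx x = v) :
    vertexProj K vtx v (Finsupp.single x 1) = Finsupp.single x 1 := by
  rw [vertexProj, Finsupp.linearCombination_single, one_smul, if_pos h]

theorem vertexProj_single_of_ne {vtx : X → V} {v : V} {x : X} (h : vtx x ≠ v) :
    vertexProj K vtx v (Finsupp.single x 1) = 0 := by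
  rw [vertexProj, Finsupp.linearCombination_single, one_smul, if_neg h]

/-- The action of `a g(a) ⋯ g^(k-1)(a)`. -/
noncomputable def run (D : WeightedTriangulationQuiver V A K) (T : A → Module.End K (X →₀ K))
    (a : A) (k : ℕ) : Module.End K (X →₀ K) :=
  unop (D.walk (fun a => op (T a)) a k)

variable (T : A → Module.End K (X →₀ K))

theorem run_one (a : A) (v : X →₀ K) : run D T a 1 v = T a v := by
  rw [run, walk_one (D := D)]; rfl

theorem run_succ (a : A) (k : ℕ) (v : X →₀ K) :
    run D T a (k + 1) v = T (D.g^[k] a) (run D T a k v) := by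
  rw [run, walk_succ (D := D)]; rfl

theorem run_succ' (a : A) (k : ℕ) (v : X →₀ K) :
    run D T a (k + 1) v = run D T (D.g a) k (T a v) := by
  rw [run, walk_succ' (D := D)]; rfl

theorem run_eq_zero (a : A) {k : ℕ} (hk : k ≠ 0) {v : X →₀ K} (hv : ∀ a, T a v = 0) :
    run D T a k v = 0 := by
  obtain ⟨k, rfl⟩ := Nat.exists_eq_succ_of_ne_zero hk
  rw [Nat.succ_eq_add_one, run_succ', hv, map_zero]

theorem run_chain {a : A} {w : ℕ → X →₀ K} {m : ℕ}
    (hw : ∀ k, m ≤ k → T (D.g^[k] a) (w k) = w (k + 1)) (l : ℕ) :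
    run D T (D.g^[m] a) l (w m) = w (m + l) := by
  induction l with
  | zero => rfl
  | succ l ih =>
    rw [run_succ, ih, ← Function.iterate_add_apply, add_comm l m, hw _ (by omega), add_assoc]

/-- Right modules correspond to homomorphisms into the opposite of an endomorphism algebra. The
relations are tested on basis vectors, and only on those at the source of the first arrow, since all
other vectors are killed by both sides. -/
theorem isRep_of_act {vtx : X → V} {act : A → X → X →₀ K}
    (hs : ∀ a x, vtx x ≠ D.s a → act a x = 0)
    (ht : ∀ a x, vertexProj K vtx (D.t a) (act a x) = act a x)
    (htri : ∀ a x, vtx x = D.s a → actEnd act (D.f a) (act a x) =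
      D.c (D.bar a) • run D (actEnd act) (D.bar a) (D.N (D.bar a) - 1) (Finsupp.single x 1))
    (hzeta : ∀ a, D.N (D.f (D.f a)) ≠ 2 →
      ¬ (D.N (D.f (D.bar a)) = 2 ∧ D.m (D.bar a) = 1 ∧ D.n (D.bar a) = 3) →
      ∀ x, vtx x = D.s a → actEnd act (D.g (D.f a)) (actEnd act (D.f a) (act a x)) = 0)
    (hxi : ∀ a, D.N (D.f a) ≠ 2 →
      ¬ (D.N (D.f (D.f a)) = 2 ∧ D.m (D.f a) = 1 ∧ D.n (D.f a) = 3) →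
      ∀ x, vtx x = D.s a → actEnd act (D.f (D.g a)) (actEnd act (D.g a) (act a x)) = 0) :
    D.IsRep (fun v => op (vertexProj K vtx v)) (fun a => op (actEnd act a)) := by
  have hext : ∀ {S T : Module.End K (X →₀ K)},
      (∀ x, S (Finsupp.single x 1) = T (Finsupp.single x 1)) → S = T := fun {S T} hST =>
    Finsupp.lhom_ext' fun x => LinearMap.ext_ring (hST x)
  have hN : ∀ a, D.N a - 1 ≠ 0 := fun a => by have := D.two_le_N a; omega
  refine ⟨?_, ?_, ?_, ?_, ?_, ?_, ?_, ?_⟩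
  · intro v
    rw [← op_mul]
    congr 1
    refine hext fun x => ?_
    rw [Module.End.mul_apply]
    by_cases hx : vtx x = v
    · rw [vertexProj_single_self hx, vertexProj_single_self hx]
    · rw [vertexProj_single_of_ne hx, map_zero]
  · intro v w hvw
    rw [← op_mul, ← op_zero]
    congr 1
    refine hext fun x => ?_
    rw [Module.End.mul_apply, LinearMap.zero_apply]
    by_cases hx : vtx x = v
    · rw [vertexProj_single_self hx, vertexProj_single_of_ne (hx.trans_ne hvw)]
    · rw [vertexProj_single_of_ne hx, map_zero]
  · rw [← Finset.op_sum, ← op_one]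
    congr 1
    refine hext fun x => ?_
    rw [LinearMap.sum_apply, Finset.sum_eq_single (vtx x), vertexProj_single_self rfl]
    · rfl
    · intro v _ hv
      exact vertexProj_single_of_ne hv.symm
    · intro hx
      exact absurd (Finset.mem_univ _) hx
  · intro a
    rw [← op_mul]
    congr 1
    refine hext fun x => ?_
    rw [Module.End.mul_apply]
    by_cases hx : vtx x = D.s a
    · rw [vertexProj_single_self hx]
    · rw [vertexProj_single_of_ne hx, map_zero, actEnd_single, hs a x hx]
  · intro a
    rw [← op_mul]
    congr 1
    refine hext fun x => ?_
    rw [Module.End.mul_apply, actEnd_single, ht]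
  · intro a
    apply unop_injective
    rw [← op_mul, unop_op, unop_smul]
    refine hext fun x => ?_
    rw [Module.End.mul_apply, actEnd_single, LinearMap.smul_apply]
    by_cases hx : vtx x = D.s a
    · exact htri a x hx
    · rw [hs a x hx, map_zero]
      obtain ⟨k, hk⟩ := Nat.exists_eq_succ_of_ne_zero (hN (D.bar a))
      have h1 : run D (actEnd act) (D.bar a) (D.N (D.bar a) - 1) (Finsupp.single x 1) = 0 := by
        rw [hk, Nat.succ_eq_add_one, run_succ', actEnd_single, hs _ x (by rwa [D.s_bar]),
          map_zero]
      have h2 := congrArg (D.c (D.bar a) • ·) h1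
      simp only [smul_zero] at h2
      exact h2.symm
  · intro a h1 h2
    apply unop_injective
    rw [← op_mul, ← op_mul, unop_op, unop_zero]
    refine hext fun x => ?_
    rw [Module.End.mul_apply, Module.End.mul_apply, actEnd_single, LinearMap.zero_apply]
    by_cases hx : vtx x = D.s a
    · exact hzeta a h1 h2 x hx
    · rw [hs a x hx, map_zero, map_zero]
  · intro a h1 h2
    apply unop_injective
    rw [← op_mul, ← op_mul, unop_op, unop_zero]
    refine hext fun x => ?_
    rw [Module.End.mul_apply, Module.End.mul_apply, actEnd_single, LinearMap.zero_apply]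
    by_cases hx : vtx x = D.s a
    · exact hxi a h1 h2 x hx
    · rw [hs a x hx, map_zero, map_zero]

end Act

/-! ### The projective module at the source of `ν` -/

/-- Indices of a basis of `P_y`, where `y` is the source of `ν`. -/
inductive OuterIndex
  | e : OuterIndex
  | n : ℕ → OuterIndex
  | y : ℕ → OuterIndex

namespace OuterIndex

/-- The vertex of a basis vector. -/
def vtx (D : WeightedTriangulationQuiver V A K) (δ ν : A) : OuterIndex → V
  | e => D.s ν
  | n k => D.s (D.g^[k] ν)
  | y k => D.s (D.g^[k] (D.g δ))

/-- The vector corresponding to the path of length `k` starting with `ν`. -/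
noncomputable def vn (D : WeightedTriangulationQuiver V A K) (α : A) (k : ℕ) :
    OuterIndex →₀ K :=
  if k ≤ D.N α then Finsupp.single (n k) 1 else 0

/-- The vector corresponding to the path of length `k` starting with `g δ`. -/
noncomputable def vy (D : WeightedTriangulationQuiver V A K) (α β : A) (k : ℕ) :
    OuterIndex →₀ K :=
  if k < D.N β then Finsupp.single (y k) 1
  else if k = D.N β then (D.c α * (D.c β)⁻¹) • Finsupp.single (n (D.N α)) 1 else 0

open Classical in
/-- The action of the arrows on the basis vectors. -/
noncomputable def act (D : WeightedTriangulationQuiver V A K) (α κ β δ ν : A) (a : A) :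
    OuterIndex → OuterIndex →₀ K
  | e => if a = ν then vn D α 1 else if a = D.g δ then vy D α β 1 else 0
  | n k =>
    if 1 ≤ k ∧ k < D.N α then
      if a = D.g^[k] ν then vn D α (k + 1)
      else if a = D.bar (D.g^[k] ν) then
        if k = 1 then D.c β • vy D α β (D.N β - 1)
        else if k = 2 then (D.c κ * D.c β) • vy D α β (D.N β - 1)
        else if k = 3 ∧ D.N β = 3 then (D.c β * D.c κ * D.c α) • vn D α (D.N α) else 0
      else 0
    else 0
  | y k =>
    if 1 ≤ k ∧ k < D.N β then
      if a = D.g^[k] (D.g δ) then vy D α β (k + 1)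
      else if a = D.bar (D.g^[k] (D.g δ)) then
        if k = 1 then D.c α • vn D α (D.N α - 1)
        else if k = 2 ∧ D.N (D.f (D.g δ)) = 2 then
          (D.c (D.f (D.g δ)) * D.c α) • vn D α (D.N α - 1)
        else 0
      else 0
    else 0

end OuterIndex

open OuterIndex in
-- The action copies the multiplication rules derived above for `e_y R`, which serve here as
-- definitions; the defining relations have to be verified anew. Nothing is assumed about the
-- parameters, so the singular algebras are included.
theorem Quad.isRep_outer {α κ β σ δ ν : A} (q : D.Quad α κ β σ δ ν) :
    D.IsRep (fun v => op (vertexProj K (OuterIndex.vtx D δ ν) v))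
      (fun a => op (actEnd (OuterIndex.act D α κ β δ ν) a)) := by
  have hN := q.three_le
  have hR := q.three_le'
  have hgν : D.g δ ≠ ν := by rw [← q.bar_ν]; exact D.bar_ne ν
  have hNg : ∀ k, D.N (D.g^[k] (D.g δ)) = D.N β := fun k => by rw [D.N_iterate, D.N_g, q.N_δ]
  have hNν : ∀ k, D.N (D.g^[k] ν) = D.N α := fun k => by rw [D.N_iterate, q.N_ν]
  have hcg : ∀ k, D.c (D.g^[k] (D.g δ)) = D.c β := fun k => by rw [D.c_iterate, D.c_g, q.c_δ]
  have hcν : ∀ k, D.c (D.g^[k] ν) = D.c α := fun k => by rw [D.c_iterate, q.c_ν]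
  have hitν : D.g^[D.N α] ν = ν := by have := D.iterate_N ν; rwa [q.N_ν] at this
  have hitg : D.g^[D.N β] (D.g δ) = D.g δ := by
    have := D.iterate_N (D.g δ); rwa [D.N_g, q.N_δ] at this
  have hδ : D.g^[D.N β - 1] (D.g δ) = δ := by
    have := D.iterate_N_sub_one δ; rwa [q.N_δ] at this
  have hτ : D.g^[D.N α - 1] ν = D.f (D.f (D.g δ)) := by
    apply D.g_injective
    rw [q.g_f_f_g, ← Function.iterate_succ_apply' D.g, show (D.N α - 1).succ = D.N α by omega,
      hitν]
  have hbarτ : D.bar (D.g^[D.N α - 1] ν) = D.g (D.f (D.g δ)) := by rw [hτ]; rfl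
  set T := actEnd (OuterIndex.act D α κ β δ ν) with hT
  set e : OuterIndex →₀ K := Finsupp.single OuterIndex.e 1 with he
  have hsingle : ∀ a x, T a (Finsupp.single x 1) = OuterIndex.act D α κ β δ ν a x :=
    fun a x => actEnd_single _ _ _
  have vn_of_le : ∀ k, k ≤ D.N α → vn D α k = Finsupp.single (OuterIndex.n k) 1 := fun k hk =>
    if_pos hk
  have vn_of_gt : ∀ k, D.N α < k → vn D α k = 0 := fun k hk => if_neg (by omega)
  have vy_of_lt : ∀ k, k < D.N β → vy D α β k = Finsupp.single (OuterIndex.y k) 1 := fun k hk =>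
    if_pos hk
  -- The two full paths at `y` are proportional, so only the one from `ν` is a basis vector; the
  -- scalar is the one in `c_smul_walk_g`.
  have vy_N : vy D α β (D.N β) = (D.c α * (D.c β)⁻¹) • vn D α (D.N α) := by
    rw [vn_of_le _ le_rfl, vy, if_neg (lt_irrefl _), if_pos rfl]
  have vy_of_gt : ∀ k, D.N β < k → vy D α β k = 0 := fun k hk => by
    rw [vy, if_neg (by omega), if_neg (by omega)]
  have kill_n : ∀ a, T a (vn D α (D.N α)) = 0 := fun a => by
    rw [vn_of_le _ le_rfl, hsingle]
    exact if_neg (by omega)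
  have kill_y : ∀ a, T a (vy D α β (D.N β)) = 0 := fun a => by
    rw [vy_N, map_smul, kill_n, smul_zero]
  have e_ν : T ν e = vn D α 1 := by rw [he, hsingle]; exact if_pos rfl
  have e_g : T (D.g δ) e = vy D α β 1 := by
    rw [he, hsingle]
    exact (if_neg hgν).trans (if_pos rfl)
  have n_next : ∀ k, 1 ≤ k → T (D.g^[k] ν) (vn D α k) = vn D α (k + 1) := by
    intro k hk
    rcases Nat.lt_trichotomy k (D.N α) with h1 | h1 | h1
    · rw [vn_of_le k h1.le, hsingle, OuterIndex.act, if_pos ⟨hk, h1⟩, if_pos rfl]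
    · rw [h1, kill_n, vn_of_gt _ (by omega)]
    · rw [vn_of_gt k h1, map_zero, vn_of_gt _ (by omega)]
  have y_next : ∀ k, 1 ≤ k → T (D.g^[k] (D.g δ)) (vy D α β k) = vy D α β (k + 1) := by
    intro k hk
    rcases Nat.lt_trichotomy k (D.N β) with h1 | h1 | h1
    · rw [vy_of_lt k h1, hsingle, OuterIndex.act, if_pos ⟨hk, h1⟩, if_pos rfl]
    · rw [h1, kill_y, vy_of_gt _ (by omega)]
    · rw [vy_of_gt k h1, map_zero, vy_of_gt _ (by omega)]
  have n_1 : T κ (vn D α 1) = D.c β • vy D α β (D.N β - 1) := by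
    rw [vn_of_le 1 (by omega), hsingle, OuterIndex.act, if_pos ⟨le_rfl, by omega⟩,
      Function.iterate_one, q.g_ν, q.bar_α, if_neg, if_pos rfl, if_pos rfl]
    rw [← q.bar_α]; exact D.bar_ne α
  have hbar2 : D.bar (D.g^[2] ν) = β := by
    rw [Function.iterate_succ_apply', Function.iterate_one, q.g_ν, D.bar_g, q.f_α]
  have n_2 : T β (vn D α 2) = (D.c κ * D.c β) • vy D α β (D.N β - 1) := by
    rw [vn_of_le 2 (by omega), hsingle, OuterIndex.act, if_pos ⟨by omega, by omega⟩,
      hbar2, if_neg, if_pos rfl, if_neg (by omega), if_pos rfl]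
    exact fun h => D.bar_ne _ (hbar2.trans h)
  have hbar3 : D.bar (D.g^[3] ν) = D.f (D.g α) := by
    rw [Function.iterate_succ_apply', Function.iterate_succ_apply', Function.iterate_one, q.g_ν,
      D.bar_g]
  have n_3 : D.N β = 3 → T (D.f (D.g α)) (vn D α 3) =
      (D.c β * D.c κ * D.c α) • vn D α (D.N α) := by
    intro h3
    have := q.five_le_of_N_eq_three h3
    rw [vn_of_le 3 (by omega), hsingle, OuterIndex.act, if_pos ⟨by omega, by omega⟩,
      hbar3, if_neg, if_pos rfl, if_neg (by omega), if_neg (by omega), if_pos ⟨rfl, h3⟩]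
    exact fun h => D.bar_ne _ (hbar3.trans h)
  have n_off : ∀ k, 3 ≤ k → (k = 3 → D.N β ≠ 3) → T (D.bar (D.g^[k] ν)) (vn D α k) = 0 := by
    intro k hk hk3
    rcases Nat.lt_trichotomy k (D.N α) with h1 | h1 | h1
    · rw [vn_of_le k h1.le, hsingle, OuterIndex.act, if_pos ⟨by omega, h1⟩, if_neg (D.bar_ne _),
        if_pos rfl, if_neg (by omega), if_neg (by omega), if_neg (fun h2 => hk3 h2.1 h2.2)]
    · rw [h1, kill_n]
    · rw [vn_of_gt k h1, map_zero]
  have y_1 : T (D.f (D.g δ)) (vy D α β 1) = D.c α • vn D α (D.N α - 1) := by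
    have h1 : D.f (D.g δ) = D.bar (D.g^[1] (D.g δ)) := by rw [Function.iterate_one, D.bar_g]
    rw [vy_of_lt 1 (by omega), hsingle, OuterIndex.act, if_pos ⟨le_rfl, by omega⟩, if_neg,
      if_pos h1, if_pos rfl]
    rw [h1]; exact D.bar_ne _
  have hbary2 : D.f (D.g (D.g δ)) = D.bar (D.g^[2] (D.g δ)) := by
    rw [Function.iterate_succ_apply', Function.iterate_one, D.bar_g]
  have y_2 : D.N (D.f (D.g δ)) = 2 → T (D.f (D.g (D.g δ))) (vy D α β 2) =
      (D.c (D.f (D.g δ)) * D.c α) • vn D α (D.N α - 1) := by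
    intro hv
    rw [vy_of_lt 2 (by omega), hsingle, OuterIndex.act, if_pos ⟨by omega, by omega⟩, if_neg,
      if_pos hbary2, if_neg (by omega), if_pos ⟨rfl, hv⟩]
    rw [hbary2]; exact D.bar_ne _
  have y_off : ∀ k, 2 ≤ k → (k = 2 → D.N (D.f (D.g δ)) ≠ 2) →
      T (D.bar (D.g^[k] (D.g δ))) (vy D α β k) = 0 := by
    intro k hk hk3
    rcases Nat.lt_trichotomy k (D.N β) with h1 | h1 | h1
    · rw [vy_of_lt k h1, hsingle, OuterIndex.act, if_pos ⟨by omega, h1⟩, if_neg (D.bar_ne _),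
        if_pos rfl, if_neg (by omega), if_neg (fun h2 => hk3 h2.1 h2.2)]
    · rw [h1, kill_y]
    · rw [vy_of_gt k h1, map_zero]
  have y_δ : T δ (vy D α β (D.N β - 1)) = vy D α β (D.N β) := by
    have := y_next (D.N β - 1) (by omega)
    rwa [hδ, show D.N β - 1 + 1 = D.N β by omega] at this
  have y_σ : T σ (vy D α β (D.N β - 1)) = 0 := by
    have := y_off (D.N β - 1) (by omega) (fun h2 =>
      q.not_virtual_f_g_of_N_eq_three' (by omega))
    rwa [hδ, q.bar_δ] at this
  have hτ_n : T (D.f (D.f (D.g δ))) (vn D α (D.N α - 1)) = vn D α (D.N α) := by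
    have := n_next (D.N α - 1) (by omega)
    rwa [hτ, show D.N α - 1 + 1 = D.N α by omega] at this
  have hbarτ_n : D.N α ≠ 3 → T (D.g (D.f (D.g δ))) (vn D α (D.N α - 1)) = 0 := by
    intro h3
    have := n_off (D.N α - 1) (by omega) (fun h4 h5 => by
      have := q.five_le_of_N_eq_three h5
      omega)
    rwa [hbarτ] at this
  have run_n : ∀ k l, 1 ≤ k → run D T (D.g^[k] ν) l (vn D α k) = vn D α (k + l) :=
    fun k l hk => run_chain T (fun m hm => n_next m (hk.trans hm)) l
  have run_y : ∀ k l, 1 ≤ k → run D T (D.g^[k] (D.g δ)) l (vy D α β k) = vy D α β (k + l) :=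
    fun k l hk => run_chain T (fun m hm => y_next m (hk.trans hm)) l
  have basis_n : ∀ k, k < D.N α → Finsupp.single (OuterIndex.n k) (1 : K) = vn D α k :=
    fun k hk => (vn_of_le k hk.le).symm
  have basis_y : ∀ k, k < D.N β → Finsupp.single (OuterIndex.y k) (1 : K) = vy D α β k :=
    fun k hk => (vy_of_lt k hk).symm
  -- when `f(g δ)` is virtual, the arrows after `g²(δ)`
  have virt_N : D.N (D.f (D.g δ)) = 2 → D.N α ≠ 3 := fun hv h3 =>
    q.not_virtual_f_g_of_N_eq_three h3 hv
  have virt_gf : D.N (D.f (D.g δ)) = 2 → D.f (D.f (D.g (D.g δ))) = D.g (D.f (D.g δ)) := by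
    intro hv
    apply D.g_injective
    rw [D.g_f_f, D.bar_g, D.g_g_of_virtual hv]
  have virt_gb : D.N (D.f (D.g δ)) = 2 → D.g (D.f (D.g (D.g δ))) = D.f (D.f (D.g δ)) := by
    intro hv
    rw [← D.bar_f, virt_gf hv, D.bar_g]
  have fn : ∀ k, D.f (D.g^[k] ν) = D.bar (D.g^[k + 1] ν) := fun k => by
    rw [Function.iterate_succ_apply', D.bar_g]
  have fy : ∀ k, D.f (D.g^[k] (D.g δ)) = D.bar (D.g^[k + 1] (D.g δ)) := fun k => by
    rw [Function.iterate_succ_apply', D.bar_g]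
  have n_3_kill : ∀ k, 3 ≤ k → ∃ r : K, T (D.bar (D.g^[k] ν)) (vn D α k) = r • vn D α (D.N α) := by
    intro k hk
    by_cases h3 : k = 3 ∧ D.N β = 3
    · obtain ⟨rfl, h3⟩ := h3
      exact ⟨_, by rw [hbar3, n_3 h3]⟩
    · exact ⟨0, by rw [n_off k hk (fun h1 h2 => h3 ⟨h1, h2⟩), zero_smul]⟩
  have run_of_zero : ∀ {a k u}, k ≠ 0 → T a u = 0 → run D T a k u = 0 := by
    intro a k u hk hu
    obtain ⟨k, rfl⟩ := Nat.exists_eq_succ_of_ne_zero hk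
    rw [Nat.succ_eq_add_one, run_succ', hu, map_zero]
  have run_e_n : ∀ l, l ≠ 0 → run D T ν l e = vn D α l := by
    intro l hl
    obtain ⟨l, rfl⟩ := Nat.exists_eq_succ_of_ne_zero hl
    rw [Nat.succ_eq_add_one, run_succ', e_ν]
    exact (run_n 1 l le_rfl).trans (by rw [add_comm])
  have run_e_y : ∀ l, l ≠ 0 → run D T (D.g δ) l e = vy D α β l := by
    intro l hl
    obtain ⟨l, rfl⟩ := Nat.exists_eq_succ_of_ne_zero hl
    rw [Nat.succ_eq_add_one, run_succ', e_g]
    exact (run_y 1 l le_rfl).trans (by rw [add_comm])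
  -- Indices outside the proper range give superfluous basis vectors on which every arrow is zero.
  -- They satisfy all relations trivially, as does the socle vector.
  have cases_x : ∀ a x, OuterIndex.vtx D δ ν x = D.s a →
      (∀ b, T b (Finsupp.single x 1) = 0) ∨
      (Finsupp.single x 1 = e ∧ (a = ν ∨ a = D.g δ)) ∨
      (∃ k, 1 ≤ k ∧ k < D.N α ∧ Finsupp.single x 1 = vn D α k ∧
        (a = D.g^[k] ν ∨ a = D.bar (D.g^[k] ν))) ∨
      (∃ k, 1 ≤ k ∧ k < D.N β ∧ Finsupp.single x 1 = vy D α β k ∧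
        (a = D.g^[k] (D.g δ) ∨ a = D.bar (D.g^[k] (D.g δ)))) := by
    intro a x hx
    rcases x with _ | k | k
    · refine Or.inr (Or.inl ⟨rfl, ?_⟩)
      rw [← q.bar_ν]
      exact D.eq_or_eq_bar hx.symm
    · by_cases hk : 1 ≤ k ∧ k < D.N α
      · exact Or.inr (Or.inr (Or.inl ⟨k, hk.1, hk.2, basis_n k hk.2, D.eq_or_eq_bar hx.symm⟩))
      · exact Or.inl fun b => by rw [hsingle]; exact if_neg hk
    · by_cases hk : 1 ≤ k ∧ k < D.N β
      · exact Or.inr (Or.inr (Or.inr ⟨k, hk.1, hk.2, basis_y k hk.2, D.eq_or_eq_bar hx.symm⟩))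
      · exact Or.inl fun b => by rw [hsingle]; exact if_neg hk
  have it1 : D.g^[1] ν = α := by rw [Function.iterate_one, q.g_ν]
  have it2 : D.g^[2] ν = D.g α := by rw [Function.iterate_succ_apply', it1]
  have it1' : D.g^[1] (D.g δ) = D.g (D.g δ) := rfl
  have bar1 : D.bar (D.g^[1] ν) = κ := by rw [it1, q.bar_α]
  have bary1 : D.bar (D.g^[1] (D.g δ)) = D.f (D.g δ) := D.bar_g _
  have h_tri : ∀ a x, OuterIndex.vtx D δ ν x = D.s a →
      T (D.f a) (T a (Finsupp.single x 1)) =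
        D.c (D.bar a) • run D T (D.bar a) (D.N (D.bar a) - 1) (Finsupp.single x 1) := by
    intro a x hx
    have hM := D.two_le_N (D.bar a)
    rcases cases_x a x hx with h0 | ⟨hu, rfl | rfl⟩ | ⟨k, hk1, hkN, hu, ha⟩ | ⟨k, hk1, hkN, hu, ha⟩
    · rw [h0, map_zero, run_eq_zero T _ (by omega) h0, smul_zero]
    · rw [hu, e_ν, q.f_ν, n_1, q.bar_ν, D.N_g, D.c_g, q.N_δ, q.c_δ, run_e_y _ (by omega)]
    · rw [hu, e_g, y_1, ← q.bar_ν, D.bar_bar, q.N_ν, q.c_ν, run_e_n _ (by omega)]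
    · rw [hu]
      rcases ha with rfl | rfl
      · rw [n_next k hk1, fn]
        obtain rfl | rfl | rfl | hk4 : k = 1 ∨ k = 2 ∨ k = 3 ∨ 4 ≤ k := by omega
        · rw [hbar2, n_2, bar1, q.N_κ, run_one, n_1, smul_smul]
        · rw [hbar2]
          have h1 : D.N β - 1 = D.N β - 2 + 1 := by omega
          rw [h1, run_succ', n_2, q.g_β, map_smul]
          by_cases h3 : D.N β = 3
          · have h2 : D.N β - 2 = 1 := by omega
            rw [hbar3, n_3 h3, h2, run_one, y_δ, vy_N, smul_smul, smul_smul]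
            congr 1
            field_simp [D.c_ne_zero β]
          · rw [n_off 3 le_rfl (fun _ => h3)]
            have h2 : D.N β - 2 = D.N β - 3 + 1 := by omega
            rw [h2, run_succ', y_δ, run_eq_zero T _ (by omega) kill_y, smul_zero, smul_zero]
        · rw [n_off _ (by omega) (by omega)]
          by_cases h3 : D.N β = 3
          · have h5 := q.five_le_of_N_eq_three h3
            have h4 : D.N (D.bar (D.g^[3] ν)) = D.N α := by
              rw [hbar3, ← q.f_g_of_N_eq_three' h3, q.N_f_f_g]
            have h6 : D.N α - 1 = D.N α - 2 + 1 := by omega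
            rw [h4, hbar3, h6, run_succ', n_3 h3, map_smul, run_eq_zero T _ (by omega) kill_n,
              smul_zero, smul_zero]
          · rw [run_of_zero (by omega) (n_off 3 le_rfl (fun _ => h3)), smul_zero]
        · rw [n_off _ (by omega) (by omega), run_of_zero (by omega) (n_off k (by omega) (by omega)),
            smul_zero]
      · rw [D.bar_bar, hNν, hcν, run_n k _ hk1]
        obtain rfl | rfl | hk3 : k = 1 ∨ k = 2 ∨ 3 ≤ k := by omega
        · rw [bar1, n_1, q.f_κ, map_smul, y_δ, vy_N, smul_smul, mul_left_comm,
            mul_inv_cancel₀ (D.c_ne_zero β), mul_one, show 1 + (D.N α - 1) = D.N α by omega]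
        · rw [hbar2, n_2, q.f_β, map_smul, y_σ, vn_of_gt _ (by omega), smul_zero, smul_zero]
        · obtain ⟨r, hr⟩ := n_3_kill k hk3
          rw [hr, map_smul, kill_n, vn_of_gt _ (by omega), smul_zero, smul_zero]
    · rw [hu]
      rcases ha with rfl | rfl
      · rw [y_next k hk1, fy]
        obtain rfl | rfl | hk3 : k = 1 ∨ k = 2 ∨ 3 ≤ k := by omega
        · rw [bary1]
          by_cases hv : D.N (D.f (D.g δ)) = 2
          · rw [← hbary2, y_2 hv, hv, run_one, y_1, smul_smul]
          · rw [y_off 2 le_rfl (fun _ => hv)]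
            have h1 := D.two_le_N (D.f (D.g δ))
            have h2 : D.N (D.f (D.g δ)) - 1 = D.N (D.f (D.g δ)) - 2 + 1 := by omega
            rw [h2, run_succ', y_1, map_smul]
            by_cases h3 : D.N α = 3
            · have h4 := q.five_le_of_N_eq_three' h3
              have h5 : D.N β - 2 = D.N β - 4 + 1 + 1 := by omega
              rw [q.g_f_g_of_N_eq_three h3, q.N_f_g_of_N_eq_three h3, h3,  h5, run_succ',
                n_2, map_smul, q.g_β, run_succ', y_δ, run_eq_zero T _ (by omega) kill_y]
              simp only [smul_zero]
            · rw [run_of_zero (by omega) (hbarτ_n h3), smul_zero, smul_zero]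
        · rw [y_off _ (by omega) (by omega)]
          by_cases hv : D.N (D.f (D.g δ)) = 2
          · have h1 : D.N (D.f (D.g (D.g δ))) = D.N α := by
              rw [← D.N_g, virt_gb hv, q.N_f_f_g]
            have h2 := virt_N hv
            have h3 : D.N α - 1 = D.N α - 3 + 1 + 1 := by omega
            rw [← hbary2, h1, h3, run_succ', y_2 hv, map_smul, virt_gb hv, run_succ']
            rw [hτ_n, run_eq_zero T _ (by omega) kill_n, smul_zero, smul_zero]
          · rw [run_of_zero (by omega) (y_off 2 le_rfl (fun _ => hv)), smul_zero]
        · rw [y_off _ (by omega) (by omega), run_of_zero (by omega) (y_off k (by omega) (by omega)),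
            smul_zero]
      · rw [D.bar_bar, hNg, hcg, run_y k _ hk1]
        obtain rfl | rfl | hk3 : k = 1 ∨ k = 2 ∨ 3 ≤ k := by omega
        · rw [bary1, y_1, map_smul, hτ_n, show 1 + (D.N β - 1) = D.N β by omega, vy_N, smul_smul,
            mul_left_comm, mul_inv_cancel₀ (D.c_ne_zero β), mul_one]
        · rw [vy_of_gt (2 + (D.N β - 1)) (by omega), smul_zero]
          by_cases hv : D.N (D.f (D.g δ)) = 2
          · rw [← hbary2, y_2 hv, map_smul, virt_gf hv, hbarτ_n (virt_N hv), smul_zero]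
          · rw [y_off 2 le_rfl (fun _ => hv), map_zero]
        · rw [y_off _ (by omega) (by omega), map_zero, vy_of_gt _ (by omega), smul_zero]
  have h_zeta : ∀ a, D.N (D.f (D.f a)) ≠ 2 →
      ¬ (D.N (D.f (D.bar a)) = 2 ∧ D.m (D.bar a) = 1 ∧ D.n (D.bar a) = 3) →
      ∀ x, OuterIndex.vtx D δ ν x = D.s a →
      T (D.g (D.f a)) (T (D.f a) (T a (Finsupp.single x 1))) = 0 := by
    intro a h1 h2 x hx
    rcases cases_x a x hx with h0 | ⟨hu, rfl | rfl⟩ | ⟨k, hk1, hkN, hu, ha⟩ | ⟨k, hk1, hkN, hu, ha⟩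
    · rw [h0, map_zero, map_zero]
    · rw [hu, e_ν, q.f_ν, n_1, q.g_κ, map_smul, y_σ, smul_zero]
    · rw [hu, e_g, y_1, map_smul, hbarτ_n, smul_zero]
      intro h3
      apply h2
      rw [← q.bar_ν, D.bar_bar, q.f_ν]
      exact ⟨q.N_κ, q.mn_ν h3⟩
    · rw [hu]
      rcases ha with rfl | rfl
      · rw [n_next k hk1, fn]
        obtain rfl | hk2 : k = 1 ∨ 2 ≤ k := by omega
        · rw [it1, q.f_α, q.f_β] at h1
          exact absurd q.N_σ h1
        · obtain ⟨r, hr⟩ := n_3_kill (k + 1) (by omega)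
          rw [hr, map_smul, kill_n, smul_zero]
      · obtain rfl | rfl | hk3 : k = 1 ∨ k = 2 ∨ 3 ≤ k := by omega
        · rw [bar1, n_1, q.f_κ, map_smul, y_δ, map_smul, kill_y, smul_zero]
        · rw [hbar2, n_2, q.f_β, map_smul, y_σ, smul_zero, map_zero]
        · obtain ⟨r, hr⟩ := n_3_kill k hk3
          rw [hr, map_smul, kill_n, smul_zero, map_zero]
    · rw [hu]
      rcases ha with rfl | rfl
      · rw [y_next k hk1, fy, y_off _ (by omega), map_zero]
        intro hk2 hv
        obtain rfl : k = 1 := by omega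
        rw [it1', virt_gf hv, D.N_g] at h1
        exact h1 hv
      · obtain rfl | rfl | hk3 : k = 1 ∨ k = 2 ∨ 3 ≤ k := by omega
        · rw [bary1, y_1, map_smul, hτ_n, map_smul, kill_n, smul_zero]
        · by_cases hv : D.N (D.f (D.g δ)) = 2
          · rw [← hbary2, y_2 hv, map_smul, virt_gf hv, hbarτ_n (virt_N hv), smul_zero, map_zero]
          · rw [y_off 2 le_rfl (fun _ => hv), map_zero, map_zero]
        · rw [y_off _ (by omega) (by omega), map_zero, map_zero]
  have h_xi : ∀ a, D.N (D.f a) ≠ 2 →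
      ¬ (D.N (D.f (D.f a)) = 2 ∧ D.m (D.f a) = 1 ∧ D.n (D.f a) = 3) →
      ∀ x, OuterIndex.vtx D δ ν x = D.s a →
      T (D.f (D.g a)) (T (D.g a) (T a (Finsupp.single x 1))) = 0 := by
    intro a h1 h2 x hx
    rcases cases_x a x hx with h0 | ⟨hu, rfl | rfl⟩ | ⟨k, hk1, hkN, hu, ha⟩ | ⟨k, hk1, hkN, hu, ha⟩
    · rw [h0, map_zero, map_zero]
    · rw [q.f_ν] at h1
      exact absurd q.N_κ h1
    · have h3 := y_next 1 le_rfl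
      rw [it1'] at h3
      rw [hu, e_g, h3, hbary2, y_off 2 le_rfl (fun _ => h1)]
    · rw [hu]
      rcases ha with rfl | rfl
      · rw [n_next k hk1, ← Function.iterate_succ_apply' D.g, n_next (k + 1) (by omega), fn,
          n_off _ (by omega)]
        intro hk3 h3
        obtain rfl : k = 1 := by omega
        apply h2
        rw [it1, q.f_α, q.f_β]
        exact ⟨q.N_σ, q.mn_β h3⟩
      · obtain rfl | rfl | hk3 : k = 1 ∨ k = 2 ∨ 3 ≤ k := by omega
        · rw [bar1, n_1, q.g_κ, map_smul, y_σ, smul_zero, map_zero]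
        · rw [hbar2, n_2, q.g_β, map_smul, y_δ, map_smul, kill_y, smul_zero]
        · obtain ⟨r, hr⟩ := n_3_kill k hk3
          rw [hr, map_smul, kill_n, smul_zero, map_zero]
    · rw [hu]
      rcases ha with rfl | rfl
      · rw [y_next k hk1, ← Function.iterate_succ_apply' D.g, y_next (k + 1) (by omega), fy,
          y_off _ (by omega) (by omega)]
      · obtain rfl | rfl | hk3 : k = 1 ∨ k = 2 ∨ 3 ≤ k := by omega
        · rw [bary1, y_1, map_smul]
          by_cases h3 : D.N α = 3
          · rw [q.g_f_g_of_N_eq_three h3, h3,  n_2, q.f_β, map_smul, map_smul, y_σ,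
              smul_zero, smul_zero]
          · rw [hbarτ_n h3, smul_zero, map_zero]
        · by_cases hv : D.N (D.f (D.g δ)) = 2
          · rw [← hbary2, y_2 hv, map_smul, virt_gb hv, hτ_n, map_smul, kill_n, smul_zero]
          · rw [y_off 2 le_rfl (fun _ => hv), map_zero, map_zero]
        · rw [y_off _ (by omega) (by omega), map_zero, map_zero]
  have proj_n : ∀ k v, D.s (D.g^[k] ν) = v →
      vertexProj K (OuterIndex.vtx D δ ν) v (vn D α k) = vn D α k := by
    intro k v hv
    rw [vn]
    split_ifs
    · exact vertexProj_single_self hv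
    · exact map_zero _
  have proj_y : ∀ k v, D.s (D.g^[k] (D.g δ)) = v →
      vertexProj K (OuterIndex.vtx D δ ν) v (vy D α β k) = vy D α β k := by
    intro k v hv
    rw [vy]
    split_ifs with h1 h2
    · exact vertexProj_single_self hv
    · rw [map_smul, vertexProj_single_self]
      change D.s (D.g^[D.N α] ν) = v
      rw [hitν, ← hv, h2, hitg, ← q.bar_ν, D.s_bar]
    · exact map_zero _
  have sτ : D.s (D.g^[D.N α - 1] ν) = D.t (D.f (D.g δ)) := by rw [hτ, D.s_f]
  have sδ : D.s (D.g^[D.N β - 1] (D.g δ)) = D.t κ := by rw [hδ, ← q.f_κ, D.s_f]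
  have h_s : ∀ a x, OuterIndex.vtx D δ ν x ≠ D.s a → OuterIndex.act D α κ β δ ν a x = 0 := by
    intro a x hx
    rcases x with _ | k | k
    · simp only [OuterIndex.act]
      rw [if_neg, if_neg]
      · rintro rfl
        apply hx
        change D.s ν = _
        rw [← q.bar_ν, D.s_bar]
      · rintro rfl
        exact hx rfl
    · simp only [OuterIndex.act]
      split_ifs with h1 h2 h3
      · exact absurd (by rw [h2]; rfl) hx
      all_goals first
        | rfl
        | exact absurd (by rw [h3, D.s_bar]; rfl) hx
    · simp only [OuterIndex.act]
      split_ifs with h1 h2 h3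
      · exact absurd (by rw [h2]; rfl) hx
      all_goals first
        | rfl
        | exact absurd (by rw [h3, D.s_bar]; rfl) hx
  refine isRep_of_act h_s ?_ ?_ ?_ ?_
  · intro a x
    by_cases hx : OuterIndex.vtx D δ ν x = D.s a
    swap
    · rw [h_s a x hx, map_zero]
    rw [← hsingle]
    rcases cases_x a x hx with h0 | ⟨hu, rfl | rfl⟩ | ⟨k, hk1, hkN, hu, ha⟩ | ⟨k, hk1, hkN, hu, ha⟩
    · rw [h0, map_zero]
    · rw [hu, e_ν, proj_n _ _ (by rw [Function.iterate_one, D.s_g])]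
    · rw [hu, e_g, proj_y _ _ (by rw [Function.iterate_one, D.s_g])]
    · rw [hu]
      rcases ha with rfl | rfl
      · rw [n_next k hk1, proj_n _ _ (by rw [Function.iterate_succ_apply', D.s_g])]
      · obtain rfl | rfl | hk3 : k = 1 ∨ k = 2 ∨ 3 ≤ k := by omega
        · rw [bar1, n_1, map_smul, proj_y _ _ sδ]
        · rw [hbar2, n_2, map_smul, proj_y _ _ (by rw [sδ, ← D.s_f β, q.f_β, ← D.s_f κ, q.f_κ,
            ← q.bar_σ, D.s_bar])]
        · by_cases h3 : k = 3 ∧ D.N β = 3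
          · obtain ⟨rfl, h3⟩ := h3
            rw [hbar3, n_3 h3, map_smul, proj_n _ _ (by
              rw [hitν, ← q.f_g_of_N_eq_three' h3, ← D.s_g, q.g_f_f_g])]
          · rw [n_off k hk3 (fun h1 h2 => h3 ⟨h1, h2⟩), map_zero]
    · rw [hu]
      rcases ha with rfl | rfl
      · rw [y_next k hk1, proj_y _ _ (by rw [Function.iterate_succ_apply', D.s_g])]
      · obtain rfl | rfl | hk3 : k = 1 ∨ k = 2 ∨ 3 ≤ k := by omega
        · rw [bary1, y_1, map_smul, proj_n _ _ sτ]
        · by_cases hv : D.N (D.f (D.g δ)) = 2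
          · rw [← hbary2, y_2 hv, map_smul, proj_n _ _ (by
              rw [hτ, ← D.s_f (D.f _), virt_gf hv, D.s_g, D.s_f])]
          · rw [y_off 2 le_rfl (fun _ => hv), map_zero]
        · rw [y_off _ (by omega) (by omega), map_zero]
  · intro a x hx
    rw [← hsingle]
    exact h_tri a x hx
  · intro a h1 h2 x hx
    rw [← hsingle]
    exact h_zeta a h1 h2 x hx
  · intro a h1 h2 x hx
    rw [← hsingle]
    exact h_xi a h1 h2 x hx

open OuterIndex in
-- Following the cycle from the generator of the module reaches the socle vector, so the full path
-- from `ν` acts as a non-zero map.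
theorem Quad.walk_outer_apply {α κ β σ δ ν : A} (q : D.Quad α κ β σ δ ν) :
    run D (actEnd (OuterIndex.act D α κ β δ ν)) ν (D.N α) (Finsupp.single OuterIndex.e 1) =
      Finsupp.single (OuterIndex.n (D.N α)) 1 := by
  have hN := q.three_le
  have h1 : D.N α = D.N α - 1 + 1 := by omega
  have h2 := run_chain (D := D) (a := ν) (w := vn D α) (m := 1)
    (actEnd (OuterIndex.act D α κ β δ ν)) (by
      intro k hk
      by_cases hkN : k < D.N α
      · rw [vn, if_pos hkN.le, actEnd_single, OuterIndex.act, if_pos ⟨hk, hkN⟩, if_pos rfl]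
      · rw [vn]
        split_ifs
        · rw [actEnd_single, OuterIndex.act, if_neg (fun h => hkN h.2), vn, if_neg (by omega)]
        · rw [map_zero, vn, if_neg (by omega)]) (D.N α - 1)
  rw [Function.iterate_one] at h2
  conv_lhs => rw [h1]
  rw [run_succ', actEnd_single, OuterIndex.act, if_pos rfl, h2, add_comm, ← h1, vn, if_pos le_rfl]

end WeightedTriangulationQuiver

namespace WeightedTriangulationQuiver

open MulOpposite

variable {V A K : Type*} [Field K] [Fintype V] {D : WeightedTriangulationQuiver V A K}

/-! ### The projective module at the source of the virtual arrow -/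

/-- Indices of a basis of `P_i`, where `i` is the source of the virtual arrow `κ`. -/
inductive InnerIndex
  | e : InnerIndex
  | x : ℕ → InnerIndex
  | z : InnerIndex

namespace InnerIndex

/-- The vertex of a basis vector. -/
def vtx (D : WeightedTriangulationQuiver V A K) (α δ : A) : InnerIndex → V
  | e => D.s α
  | x k => D.s (D.g^[k] α)
  | z => D.s δ

/-- The vector corresponding to the path of length `k` starting with `α`. -/
noncomputable def vx (D : WeightedTriangulationQuiver V A K) (α : A) (k : ℕ) :
    InnerIndex →₀ K :=
  if k ≤ D.N α then Finsupp.single (x k) 1 else 0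

open Classical in
/-- The action of the arrows on the basis vectors. -/
noncomputable def act (D : WeightedTriangulationQuiver V A K) (α κ β σ δ : A) (a : A) :
    InnerIndex → InnerIndex →₀ K
  | e => if a = α then vx D α 1 else if a = κ then Finsupp.single z 1 else 0
  | x k =>
    if 1 ≤ k ∧ k < D.N α then
      if a = D.g^[k] α then vx D α (k + 1)
      else if a = D.bar (D.g^[k] α) then
        if k = 1 then D.c κ • Finsupp.single z 1
        else if k = 2 ∧ D.N β = 3 then (D.c β * D.c κ * D.c α) • vx D α (D.N α - 1) else 0
      else 0
    else 0
  | z =>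
    if a = σ then (D.c α * (D.c κ)⁻¹) • vx D α (D.N α)
    else if a = δ then D.c α • vx D α (D.N α - 1) else 0

end InnerIndex

open InnerIndex in
-- The model of `P_i`: the basis vectors stand for `e_i`, `κ` and the segments of the cycle of `α`.
-- It is needed besides the model of `P_y`, where the full path from `ν` only detects the path of
-- length `N α - 1` from `α`.
theorem Quad.isRep_inner {α κ β σ δ ν : A} (q : D.Quad α κ β σ δ ν) :
    D.IsRep (fun v => op (vertexProj K (InnerIndex.vtx D α δ) v))
      (fun a => op (actEnd (InnerIndex.act D α κ β σ δ) a)) := by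
  have hN := q.three_le
  have hR := q.three_le'
  have hκα : κ ≠ α := by rw [← q.bar_α]; exact D.bar_ne α
  have hδσ : δ ≠ σ := by rw [← q.bar_σ]; exact D.bar_ne σ
  have hNα : ∀ k, D.N (D.g^[k] α) = D.N α := fun k => D.N_iterate _ _
  have hcα : ∀ k, D.c (D.g^[k] α) = D.c α := fun k => D.c_iterate _ _
  have hitα : D.g^[D.N α] α = α := D.iterate_N α
  set T := actEnd (InnerIndex.act D α κ β σ δ) with hT
  set e : InnerIndex →₀ K := Finsupp.single InnerIndex.e 1 with he
  set z : InnerIndex →₀ K := Finsupp.single InnerIndex.z 1 with hz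
  have hsingle : ∀ a x, T a (Finsupp.single x 1) = InnerIndex.act D α κ β σ δ a x :=
    fun a x => actEnd_single _ _ _
  have vx_of_le : ∀ k, k ≤ D.N α → vx D α k = Finsupp.single (InnerIndex.x k) 1 := fun k hk =>
    if_pos hk
  have vx_of_gt : ∀ k, D.N α < k → vx D α k = 0 := fun k hk => if_neg (by omega)
  have kill : ∀ a, T a (vx D α (D.N α)) = 0 := fun a => by
    rw [vx_of_le _ le_rfl, hsingle]
    exact if_neg (by omega)
  have e_α : T α e = vx D α 1 := by rw [he, hsingle]; exact if_pos rfl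
  have e_κ : T κ e = z := by
    rw [he, hsingle]
    exact (if_neg hκα).trans (if_pos rfl)
  have z_σ : T σ z = (D.c α * (D.c κ)⁻¹) • vx D α (D.N α) := by
    rw [hz, hsingle]; exact if_pos rfl
  have z_δ : T δ z = D.c α • vx D α (D.N α - 1) := by
    rw [hz, hsingle]
    exact (if_neg hδσ).trans (if_pos rfl)
  have x_next : ∀ k, 1 ≤ k → T (D.g^[k] α) (vx D α k) = vx D α (k + 1) := by
    intro k hk
    rcases Nat.lt_trichotomy k (D.N α) with h1 | h1 | h1
    · rw [vx_of_le k h1.le, hsingle, InnerIndex.act, if_pos ⟨hk, h1⟩, if_pos rfl]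
    · rw [h1, kill, vx_of_gt _ (by omega)]
    · rw [vx_of_gt k h1, map_zero, vx_of_gt _ (by omega)]
  have bar1 : D.bar (D.g^[1] α) = β := by rw [Function.iterate_one, D.bar_g, q.f_α]
  have bar2 : D.bar (D.g^[2] α) = D.f (D.g α) := by
    rw [Function.iterate_succ_apply', Function.iterate_one, D.bar_g]
  have x_1 : T β (vx D α 1) = D.c κ • z := by
    rw [vx_of_le 1 (by omega), hsingle, InnerIndex.act, if_pos ⟨le_rfl, by omega⟩, if_neg,
      if_pos bar1.symm, if_pos rfl]
    exact fun h => D.bar_ne _ (bar1.trans h)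
  have x_2 : D.N β = 3 → T (D.f (D.g α)) (vx D α 2) =
      (D.c β * D.c κ * D.c α) • vx D α (D.N α - 1) := by
    intro h3
    rw [vx_of_le 2 (by omega), hsingle, InnerIndex.act, if_pos ⟨by omega, by omega⟩, if_neg,
      if_pos bar2.symm, if_neg (by omega), if_pos ⟨rfl, h3⟩]
    exact fun h => D.bar_ne _ (bar2.trans h)
  have x_off : ∀ k, 2 ≤ k → (k = 2 → D.N β ≠ 3) → T (D.bar (D.g^[k] α)) (vx D α k) = 0 := by
    intro k hk hk3
    rcases Nat.lt_trichotomy k (D.N α) with h1 | h1 | h1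
    · rw [vx_of_le k h1.le, hsingle, InnerIndex.act, if_pos ⟨by omega, h1⟩, if_neg (D.bar_ne _),
        if_pos rfl, if_neg (by omega), if_neg (fun h2 => hk3 h2.1 h2.2)]
    · rw [h1, kill]
    · rw [vx_of_gt k h1, map_zero]
  have x_ν : T ν (vx D α (D.N α - 1)) = vx D α (D.N α) := by
    have := x_next (D.N α - 1) (by omega)
    rwa [q.iterate_α, show D.N α - 1 + 1 = D.N α by omega] at this
  have x_g : T (D.g δ) (vx D α (D.N α - 1)) = 0 := by
    have := x_off (D.N α - 1) (by omega) (fun h4 h5 => by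
      have := q.five_le_of_N_eq_three h5
      omega)
    rwa [q.iterate_α, q.bar_ν] at this
  have run_x : ∀ k l, 1 ≤ k → run D T (D.g^[k] α) l (vx D α k) = vx D α (k + l) :=
    fun k l hk => run_chain T (fun m hm => x_next m (hk.trans hm)) l
  have fx : ∀ k, D.f (D.g^[k] α) = D.bar (D.g^[k + 1] α) := fun k => by
    rw [Function.iterate_succ_apply', D.bar_g]
  have run_of_zero : ∀ {a k u}, k ≠ 0 → T a u = 0 → run D T a k u = 0 := by
    intro a k u hk hu
    obtain ⟨k, rfl⟩ := Nat.exists_eq_succ_of_ne_zero hk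
    rw [Nat.succ_eq_add_one, run_succ', hu, map_zero]
  have run_e : ∀ l, l ≠ 0 → run D T α l e = vx D α l := by
    intro l hl
    obtain ⟨l, rfl⟩ := Nat.exists_eq_succ_of_ne_zero hl
    rw [Nat.succ_eq_add_one, run_succ', e_α]
    exact (run_x 1 l le_rfl).trans (by rw [add_comm])
  have f_f_g : D.N β = 3 → D.f (D.f (D.g α)) = D.g δ := fun h3 => by
    rw [← q.f_g_of_N_eq_three' h3, D.f_cubed]
  have g_f_g : D.N β = 3 → D.g (D.f (D.g α)) = ν := fun h3 => by
    rw [← q.f_g_of_N_eq_three' h3, q.g_f_f_g]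
  have cases_x : ∀ a x, InnerIndex.vtx D α δ x = D.s a →
      (∀ b, T b (Finsupp.single x 1) = 0) ∨
      (Finsupp.single x 1 = e ∧ (a = α ∨ a = κ)) ∨
      (∃ k, 1 ≤ k ∧ k < D.N α ∧ Finsupp.single x 1 = vx D α k ∧
        (a = D.g^[k] α ∨ a = D.bar (D.g^[k] α))) ∨
      (Finsupp.single x 1 = z ∧ (a = σ ∨ a = δ)) := by
    intro a x hx
    rcases x with _ | k | _
    · refine Or.inr (Or.inl ⟨rfl, ?_⟩)
      rw [← q.bar_α]
      exact D.eq_or_eq_bar hx.symm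
    · by_cases hk : 1 ≤ k ∧ k < D.N α
      · exact Or.inr (Or.inr (Or.inl ⟨k, hk.1, hk.2, (vx_of_le k hk.2.le).symm,
          D.eq_or_eq_bar hx.symm⟩))
      · exact Or.inl fun b => by rw [hsingle]; exact if_neg hk
    · refine Or.inr (Or.inr (Or.inr ⟨rfl, ?_⟩))
      rw [← q.bar_δ]
      exact (D.eq_or_eq_bar hx.symm).symm
  have h_tri : ∀ a x, InnerIndex.vtx D α δ x = D.s a →
      T (D.f a) (T a (Finsupp.single x 1)) =
        D.c (D.bar a) • run D T (D.bar a) (D.N (D.bar a) - 1) (Finsupp.single x 1) := by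
    intro a x hx
    have hM := D.two_le_N (D.bar a)
    rcases cases_x a x hx with h0 | ⟨hu, rfl | rfl⟩ | ⟨k, hk1, hkN, hu, ha⟩ | ⟨hu, rfl | rfl⟩
    · rw [h0, map_zero, run_eq_zero T _ (by omega) h0, smul_zero]
    · rw [hu, e_α, q.f_α, x_1, q.bar_α, q.N_κ, run_one, e_κ]
    · rw [hu, e_κ, q.f_κ, z_δ, q.bar_κ, run_e _ (by omega)]
    · rw [hu]
      rcases ha with rfl | rfl
      · rw [x_next k hk1, fx]
        obtain rfl | rfl | hk3 : k = 1 ∨ k = 2 ∨ 3 ≤ k := by omega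
        · have h1 : D.N β - 1 = D.N β - 2 + 1 := by omega
          rw [bar1, h1, run_succ', x_1, q.g_β, map_smul]
          by_cases h3 : D.N β = 3
          · have h2 : D.N β - 2 = 1 := by omega
            rw [bar2, x_2 h3, h2, run_one, z_δ, smul_smul, smul_smul, mul_assoc]
          · have h2 : D.N β - 2 = D.N β - 3 + 1 := by omega
            rw [x_off 2 le_rfl (fun _ => h3), h2, run_succ', z_δ, map_smul,
              run_of_zero (by omega) x_g, smul_zero, smul_zero, smul_zero]
        · rw [x_off _ (by omega) (by omega)]
          by_cases h3 : D.N β = 3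
          · have h5 := q.five_le_of_N_eq_three h3
            have h4 : D.N (D.f (D.g α)) = D.N α := by
              rw [← q.f_g_of_N_eq_three' h3, q.N_f_f_g]
            have h6 : D.N α - 1 = D.N α - 3 + 1 + 1 := by omega
            rw [bar2, h4, h6, run_succ', x_2 h3, map_smul, g_f_g h3, run_succ', x_ν,
              run_eq_zero T _ (by omega) kill, smul_zero, smul_zero]
          · rw [run_of_zero (by omega) (x_off 2 le_rfl (fun _ => h3)), smul_zero]
        · rw [x_off _ (by omega) (by omega), run_of_zero (by omega) (x_off k (by omega) (by omega)),
            smul_zero]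
      · rw [D.bar_bar, hNα, hcα, run_x k _ hk1]
        obtain rfl | rfl | hk3 : k = 1 ∨ k = 2 ∨ 3 ≤ k := by omega
        · rw [bar1, x_1, q.f_β, map_smul, z_σ, smul_smul, mul_left_comm,
            mul_inv_cancel₀ (D.c_ne_zero κ), mul_one, show 1 + (D.N α - 1) = D.N α by omega]
        · rw [vx_of_gt (2 + (D.N α - 1)) (by omega), smul_zero]
          by_cases h3 : D.N β = 3
          · rw [bar2, x_2 h3, f_f_g h3, map_smul, x_g, smul_zero]
          · rw [x_off 2 le_rfl (fun _ => h3), map_zero]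
        · rw [x_off _ (by omega) (by omega), map_zero, vx_of_gt _ (by omega), smul_zero]
    · have h2 : D.N δ - 1 = D.N β - 2 + 1 := by rw [q.N_δ]; omega
      rw [hu, z_σ, map_smul, kill, q.bar_σ, h2, run_succ', z_δ, map_smul,
        run_of_zero (by omega) x_g, smul_zero, smul_zero, smul_zero]
    · rw [hu, z_δ, map_smul, q.f_δ, x_ν, q.bar_δ, q.N_σ, run_one, z_σ, q.c_σ, smul_smul,
        mul_left_comm, mul_inv_cancel₀ (D.c_ne_zero κ), mul_one]
  have h_zeta : ∀ a, D.N (D.f (D.f a)) ≠ 2 →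
      ¬ (D.N (D.f (D.bar a)) = 2 ∧ D.m (D.bar a) = 1 ∧ D.n (D.bar a) = 3) →
      ∀ x, InnerIndex.vtx D α δ x = D.s a →
      T (D.g (D.f a)) (T (D.f a) (T a (Finsupp.single x 1))) = 0 := by
    intro a h1 h2 x hx
    rcases cases_x a x hx with h0 | ⟨hu, rfl | rfl⟩ | ⟨k, hk1, hkN, hu, ha⟩ | ⟨hu, rfl | rfl⟩
    · rw [h0, map_zero, map_zero]
    · rw [q.f_α, q.f_β] at h1
      exact absurd q.N_σ h1
    · rw [hu, e_κ, q.f_κ, z_δ, map_smul, x_g, smul_zero]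
    · rw [hu]
      rcases ha with rfl | rfl
      · rw [x_next k hk1, fx, x_off _ (by omega), map_zero]
        intro hk2 h3
        obtain rfl : k = 1 := by omega
        apply h2
        rw [bar1, q.f_β]
        exact ⟨q.N_σ, q.mn_β h3⟩
      · obtain rfl | hk2 : k = 1 ∨ 2 ≤ k := by omega
        · rw [bar1, x_1, q.f_β, map_smul, z_σ, map_smul, map_smul, kill, smul_zero, smul_zero]
        · by_cases h3 : k = 2 ∧ D.N β = 3
          · obtain ⟨rfl, h3⟩ := h3
            rw [bar2, x_2 h3, f_f_g h3, map_smul, x_g, smul_zero, map_zero]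
          · rw [x_off k hk2 (fun h1 h2 => h3 ⟨h1, h2⟩), map_zero, map_zero]
    · rw [hu, z_σ, map_smul, kill, smul_zero, map_zero]
    · rw [hu, z_δ, map_smul, q.f_δ, x_ν, map_smul, kill, smul_zero]
  have h_xi : ∀ a, D.N (D.f a) ≠ 2 →
      ¬ (D.N (D.f (D.f a)) = 2 ∧ D.m (D.f a) = 1 ∧ D.n (D.f a) = 3) →
      ∀ x, InnerIndex.vtx D α δ x = D.s a →
      T (D.f (D.g a)) (T (D.g a) (T a (Finsupp.single x 1))) = 0 := by
    intro a h1 h2 x hx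
    rcases cases_x a x hx with h0 | ⟨hu, rfl | rfl⟩ | ⟨k, hk1, hkN, hu, ha⟩ | ⟨hu, rfl | rfl⟩
    · rw [h0, map_zero, map_zero]
    · have h3 := x_next 1 le_rfl
      rw [Function.iterate_one] at h3
      rw [hu, e_α, h3, ← bar2, x_off 2 le_rfl]
      intro _ h4
      apply h2
      rw [q.f_α, q.f_β]
      exact ⟨q.N_σ, q.mn_β h4⟩
    · rw [hu, e_κ, q.g_κ, z_σ, map_smul, kill, smul_zero]
    · rw [hu]
      rcases ha with rfl | rfl
      · rw [x_next k hk1, ← Function.iterate_succ_apply' D.g, x_next (k + 1) (by omega), fx,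
          x_off _ (by omega) (by omega)]
      · obtain rfl | hk2 : k = 1 ∨ 2 ≤ k := by omega
        · rw [bar1, q.f_β] at h1
          exact absurd q.N_σ h1
        · by_cases h3 : k = 2 ∧ D.N β = 3
          · obtain ⟨rfl, h3⟩ := h3
            rw [bar2, x_2 h3, g_f_g h3, map_smul, x_ν, map_smul, kill, smul_zero]
          · rw [x_off k hk2 (fun h1 h2 => h3 ⟨h1, h2⟩), map_zero, map_zero]
    · rw [hu, z_σ, map_smul, kill, smul_zero, map_zero]
    · rw [hu, z_δ, map_smul, x_g, smul_zero, map_zero]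
  have proj_x : ∀ k v, D.s (D.g^[k] α) = v →
      vertexProj K (InnerIndex.vtx D α δ) v (vx D α k) = vx D α k := by
    intro k v hv
    rw [vx]
    split_ifs
    · exact vertexProj_single_self hv
    · exact map_zero _
  have proj_z : ∀ v, D.s δ = v → vertexProj K (InnerIndex.vtx D α δ) v z = z := fun v hv =>
    vertexProj_single_self hv
  have h_s : ∀ a x, InnerIndex.vtx D α δ x ≠ D.s a → InnerIndex.act D α κ β σ δ a x = 0 := by
    intro a x hx
    rcases x with _ | k | _
    · simp only [InnerIndex.act]
      rw [if_neg, if_neg]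
      · rintro rfl
        apply hx
        change D.s α = _
        rw [← q.bar_α, D.s_bar]
      · rintro rfl
        exact hx rfl
    · simp only [InnerIndex.act]
      split_ifs with h1 h2 h3
      · exact absurd (by rw [h2]; rfl) hx
      all_goals first
        | rfl
        | exact absurd (by rw [h3, D.s_bar]; rfl) hx
    · simp only [InnerIndex.act]
      rw [if_neg, if_neg]
      · rintro rfl
        exact hx rfl
      · rintro rfl
        apply hx
        change D.s δ = _
        rw [← q.bar_σ, D.s_bar]
  refine isRep_of_act h_s ?_ ?_ ?_ ?_
  · intro a x
    by_cases hx : InnerIndex.vtx D α δ x = D.s a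
    swap
    · rw [h_s a x hx, map_zero]
    rw [← hsingle]
    rcases cases_x a x hx with h0 | ⟨hu, rfl | rfl⟩ | ⟨k, hk1, hkN, hu, ha⟩ | ⟨hu, rfl | rfl⟩
    · rw [h0, map_zero]
    · rw [hu, e_α, proj_x _ _ (by rw [Function.iterate_one, D.s_g])]
    · rw [hu, e_κ, proj_z _ (by rw [← q.f_κ, D.s_f])]
    · rw [hu]
      rcases ha with rfl | rfl
      · rw [x_next k hk1, proj_x _ _ (by rw [Function.iterate_succ_apply', D.s_g])]
      · obtain rfl | hk2 : k = 1 ∨ 2 ≤ k := by omega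
        · rw [bar1, x_1, map_smul, proj_z _ (by rw [← D.s_f, q.f_β, ← q.bar_σ, D.s_bar])]
        · by_cases h3 : k = 2 ∧ D.N β = 3
          · obtain ⟨rfl, h3⟩ := h3
            rw [bar2, x_2 h3, map_smul, proj_x _ _ (by rw [q.iterate_α, ← g_f_g h3, D.s_g])]
          · rw [x_off k hk2 (fun h1 h2 => h3 ⟨h1, h2⟩), map_zero]
    · rw [hu, z_σ, map_smul, proj_x _ _ (by rw [hitα, ← D.s_f, q.f_σ])]
    · rw [hu, z_δ, map_smul, proj_x _ _ (by rw [q.iterate_α, ← q.f_δ, D.s_f])]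
  · intro a x hx
    rw [← hsingle]
    exact h_tri a x hx
  · intro a h1 h2 x hx
    rw [← hsingle]
    exact h_zeta a h1 h2 x hx
  · intro a h1 h2 x hx
    rw [← hsingle]
    exact h_xi a h1 h2 x hx

open InnerIndex in
theorem Quad.walk_inner_apply {α κ β σ δ ν : A} (q : D.Quad α κ β σ δ ν) :
    run D (actEnd (InnerIndex.act D α κ β σ δ)) α (D.N α) (Finsupp.single InnerIndex.e 1) =
      Finsupp.single (InnerIndex.x (D.N α)) 1 := by
  have hN := q.three_le
  have h1 : D.N α = D.N α - 1 + 1 := by omega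
  have h2 := run_chain (D := D) (a := α) (w := vx D α) (m := 1)
    (actEnd (InnerIndex.act D α κ β σ δ)) (by
      intro k hk
      by_cases hkN : k < D.N α
      · rw [vx, if_pos hkN.le, actEnd_single, InnerIndex.act, if_pos ⟨hk, hkN⟩, if_pos rfl]
      · rw [vx]
        split_ifs
        · rw [actEnd_single, InnerIndex.act, if_neg (fun h => hkN h.2), vx, if_neg (by omega)]
        · rw [map_zero, vx, if_neg (by omega)]) (D.N α - 1)
  rw [Function.iterate_one] at h2
  conv_lhs => rw [h1]
  rw [run_succ', actEnd_single, InnerIndex.act, if_pos rfl, h2, add_comm, ← h1, vx, if_pos le_rfl]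

end WeightedTriangulationQuiver

/-! ### The universal property of `Λ` and non-vanishing of the full paths -/

namespace WeightedTriangulationQuiver

open MulOpposite

variable {V A K : Type*} [Field K] [Fintype V]

section Universal

variable (D : WeightedTriangulationQuiver V A K)

/-- The projection of the path algebra onto `Λ`. -/
noncomputable def proj : D.toArrowQuiver.PathAlgebra K →ₐ[K] D.Alg := RingQuot.mkAlgHom K D.Rel

/-- The arrow `a`, in `Λ`. -/
noncomputable def arr (a : A) : D.Alg := D.proj (D.toArrowQuiver.arrow K a)

/-- The projection of the free algebra onto the path algebra. -/
noncomputable def freeProj : FreeAlgebra K (V ⊕ A) →ₐ[K] D.toArrowQuiver.PathAlgebra K :=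
  RingQuot.mkAlgHom K (ArrowQuiver.PathRel K D.toArrowQuiver)

variable {D}

theorem freeProj_eq {x y : FreeAlgebra K (V ⊕ A)} (h : ArrowQuiver.PathRel K D.toArrowQuiver x y) :
    D.freeProj x = D.freeProj y :=
  RingQuot.mkAlgHom_rel K h

theorem proj_eq {x y : D.toArrowQuiver.PathAlgebra K} (h : D.Rel x y) : D.proj x = D.proj y :=
  RingQuot.mkAlgHom_rel K h

theorem proj_gPath (a : A) (k : ℕ) : D.proj (D.gPath a k) = D.walk D.arr a k := by
  rw [gPath, map_list_prod, List.map_map]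
  rfl

variable (D)

theorem isRep_alg : D.IsRep D.e D.arr where
  idem v := by
    have := congrArg D.proj (freeProj_eq (.idem v))
    rwa [map_mul, map_mul] at this
  orth v w h := by
    have := congrArg D.proj (freeProj_eq (.orth v w h))
    rwa [map_mul, map_mul, map_zero, map_zero] at this
  one := by
    have := congrArg D.proj (freeProj_eq (D := D) .one)
    rwa [map_sum, map_sum, map_one, map_one] at this
  source a := by
    have := congrArg D.proj (freeProj_eq (.source a))
    rwa [map_mul, map_mul] at this
  target a := by
    have := congrArg D.proj (freeProj_eq (.target a))
    rwa [map_mul, map_mul] at this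
  triangle a := by
    have := proj_eq (D := D) (.triangle a)
    rw [map_mul, map_smul, pathA, proj_gPath] at this
    exact this
  zeta a h₁ h₂ := by
    have := proj_eq (D := D) (.zeta a h₁ h₂)
    rw [map_mul, map_mul, map_zero] at this
    exact this
  xi a h₁ h₂ := by
    have := proj_eq (D := D) (.xi a h₁ h₂)
    rw [map_mul, map_mul, map_zero] at this
    exact this

theorem generates_alg : Generates K D.e D.arr := by
  have h1 : Function.Surjective (D.proj.comp D.freeProj) :=
    (RingQuot.mkAlgHom_surjective K D.Rel).comp (RingQuot.mkAlgHom_surjective K _)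
  rw [Generates, ← top_le_iff, ← (AlgHom.range_eq_top _).2 h1, ← Algebra.map_top,
    ← FreeAlgebra.adjoin_range_ι, AlgHom.map_adjoin]
  apply Algebra.adjoin_mono
  rintro _ ⟨_, ⟨x | x, rfl⟩, rfl⟩
  · exact Or.inl ⟨x, rfl⟩
  · exact Or.inr ⟨x, rfl⟩

variable {D}

/-- Two successive lifts, first over the path relations and then over the ideal, make `Λ` universal
among algebras satisfying the relations. -/
theorem exists_algHom {R : Type*} [Ring R] [Algebra K R] {ee : V → R} {ar : A → R}
    (h : D.IsRep ee ar) :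
    ∃ F : D.Alg →ₐ[K] R, (∀ v, F (D.e v) = ee v) ∧ ∀ a, F (D.arr a) = ar a := by
  let F₀ : FreeAlgebra K (V ⊕ A) →ₐ[K] R := FreeAlgebra.lift K (Sum.elim ee ar)
  have hl : ∀ v, F₀ (FreeAlgebra.ι K (Sum.inl v)) = ee v := fun v => by
    rw [FreeAlgebra.lift_ι_apply]; rfl
  have hr : ∀ a, F₀ (FreeAlgebra.ι K (Sum.inr a)) = ar a := fun v => by
    rw [FreeAlgebra.lift_ι_apply]; rfl
  have h₀ : ∀ ⦃x y⦄, ArrowQuiver.PathRel K D.toArrowQuiver x y → F₀ x = F₀ y := by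
    rintro _ _ (v | ⟨v, w, hvw⟩ | _ | a | a)
    · rw [map_mul, hl, h.idem]
    · rw [map_mul, hl, hl, h.orth v w hvw, map_zero]
    · rw [map_sum, map_one, ← h.one]
      exact Finset.sum_congr rfl fun v _ => hl v
    · rw [map_mul, hl, hr, h.source]
    · rw [map_mul, hl, hr, h.target]
  let F₁ : D.toArrowQuiver.PathAlgebra K →ₐ[K] R := RingQuot.liftAlgHom K ⟨F₀, h₀⟩
  have h₁ : ∀ x, F₁ (D.freeProj x) = F₀ x := fun x => RingQuot.liftAlgHom_mkAlgHom_apply K F₀ h₀ x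
  have harr : ∀ a, F₁ (D.toArrowQuiver.arrow K a) = ar a := fun a => (h₁ _).trans (hr a)
  have hpath : ∀ a k, F₁ (D.gPath a k) = D.walk ar a k := fun a k => by
    rw [gPath, map_list_prod, List.map_map, walk]
    congr 2
    funext r
    exact harr _
  have h₂ : ∀ ⦃x y⦄, D.Rel x y → F₁ x = F₁ y := by
    rintro _ _ (a | ⟨a, h1, h2⟩ | ⟨a, h1, h2⟩)
    · rw [map_mul, map_smul, harr, harr, pathA, hpath]
      exact h.triangle a
    · rw [map_mul, map_mul, harr, harr, harr, map_zero]
      exact h.zeta a h1 h2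
    · rw [map_mul, map_mul, harr, harr, harr, map_zero]
      exact h.xi a h1 h2
  let F₂ : D.Alg →ₐ[K] R := RingQuot.liftAlgHom K ⟨F₁, h₂⟩
  have h₃ : ∀ x, F₂ (D.proj x) = F₁ x := fun x => RingQuot.liftAlgHom_mkAlgHom_apply K F₁ h₂ x
  exact ⟨F₂, fun v => (h₃ _).trans ((h₁ _).trans (hl v)), fun a => (h₃ _).trans (harr a)⟩

end Universal

variable {D : WeightedTriangulationQuiver V A K}

namespace Quad

variable {α κ β σ δ ν : A} (q : D.Quad α κ β σ δ ν)

include q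

/-- An element of `Λ` acting non-trivially on some module is non-zero. -/
theorem walk_ne_zero_of_act {X : Type*} {vtx : X → V} {act : A → X → X →₀ K} {a : A} {k : ℕ}
    {x y : X}
    (h : D.IsRep (fun v => op (vertexProj K vtx v)) (fun a => op (actEnd act a)))
    (hy : run D (actEnd act) a k (Finsupp.single x 1) = Finsupp.single y 1) :
    D.walk D.arr a k ≠ 0 := by
  obtain ⟨F, -, hF⟩ := exists_algHom h
  intro h0
  have h1 : F (D.walk D.arr a k) = D.walk (fun a => op (actEnd act a)) a k := by
    rw [walk, walk, map_list_prod, List.map_map]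
    congr 2
    funext r
    exact hF _
  rw [h0, map_zero] at h1
  rw [run, ← h1] at hy
  have h2 := DFunLike.congr_fun hy y
  rw [Finsupp.single_eq_same] at h2
  exact zero_ne_one h2

theorem walk_ν_ne_zero : D.walk D.arr ν (D.N α) ≠ 0 :=
  q.walk_ne_zero_of_act q.isRep_outer q.walk_outer_apply

theorem walk_α_ne_zero : D.walk D.arr α (D.N α) ≠ 0 :=
  q.walk_ne_zero_of_act q.isRep_inner q.walk_inner_apply

theorem walk_β_ne_zero : D.walk D.arr β (D.N β) ≠ 0 := by
  rw [← q.N_δ]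
  exact q.swap.walk_ν_ne_zero

end Quad

end WeightedTriangulationQuiver

/-! ### Projectivity and injectivity of a right ideal generated by an idempotent -/

open MulOpposite

section Projective

variable {K R : Type*} [Field K] [Ring R] [Algebra K R] {e : R}

theorem mem_span_idempotent (he : e * e = e) {x : R} :
    x ∈ Submodule.span Rᵐᵒᵖ {e} ↔ e * x = x := by
  rw [Submodule.mem_span_singleton]
  constructor
  · rintro ⟨r, rfl⟩
    rw [← MulOpposite.op_unop r, op_smul_eq_mul, ← mul_assoc, he]
  · intro h
    exact ⟨op x, by rw [op_smul_eq_mul, h]⟩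

theorem projective_span_idempotent (he : e * e = e) :
    Module.Projective Rᵐᵒᵖ (Submodule.span Rᵐᵒᵖ {e}) := by
  let i : Submodule.span Rᵐᵒᵖ {e} →ₗ[Rᵐᵒᵖ] Rᵐᵒᵖ :=
    { toFun := fun x => op (x : R)
      map_add' := fun _ _ => rfl
      map_smul' := fun _ _ => rfl }
  let s : Rᵐᵒᵖ →ₗ[Rᵐᵒᵖ] Submodule.span Rᵐᵒᵖ {e} :=
    LinearMap.toSpanSingleton _ _ ⟨e, Submodule.mem_span_singleton_self e⟩
  refine Module.Projective.of_split i s (LinearMap.ext fun x => Subtype.ext ?_)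
  change op (x : R) • e = (x : R)
  rw [op_smul_eq_mul]
  exact (mem_span_idempotent he).1 x.2

/-- A right ideal `eR` with a non-degenerate finite-dimensional pairing `eR × Re → K` is
injective. -/
theorem injective_span_idempotent (he : e * e = e) {ω : R} (hω : ω ≠ 0) (hωe : ω * e = ω)
    (heω : e * ω = ω) {U : Submodule K R} (hU : U.FG) (heU : ∀ r, e * r ∈ U)
    (hl : ∀ x, e * x = x → x ≠ 0 → ∃ z, x * z = ω)
    (hr : ∀ y, y * e = y → y ≠ 0 → ∃ z, z * y = ω) :
    Module.Injective Rᵐᵒᵖ (Submodule.span Rᵐᵒᵖ {e}) := by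
  -- The pairing is `(x, y) ↦ φ(xy)` on `eR × Re`; the hypotheses `hl` and `hr` make it
  -- non-degenerate on either side.
  obtain ⟨φ, hφ⟩ : ∃ φ : R →ₗ[K] K, φ ω ≠ 0 := by
    by_contra! h
    exact hω ((Module.forall_dual_apply_eq_zero_iff K ω).1 h)
  let M : Submodule K R := LinearMap.range (LinearMap.mulLeft K e)
  let N : Submodule K R := LinearMap.range (LinearMap.mulRight K e)
  have hM : ∀ x : M, e * (x : R) = x := by
    rintro ⟨_, r, rfl⟩
    change e * (e * r) = e * r
    rw [← mul_assoc, he]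
  have hN : ∀ x : N, (x : R) * e = x := by
    rintro ⟨_, r, rfl⟩
    change r * e * e = r * e
    rw [mul_assoc, he]
  have hMU : M ≤ U := by
    rintro _ ⟨r, rfl⟩
    exact heU r
  have : FiniteDimensional K U := Module.Finite.iff_fg.2 hU
  have : FiniteDimensional K M := Submodule.finiteDimensional_of_le hMU
  let p : M →ₗ[K] N →ₗ[K] K :=
    ((LinearMap.mul K R).compr₂ φ).domRestrict₁₂ M N
  have hp : ∀ x y, p x y = φ (x * y) := fun x y => rfl
  have hp1 : Function.Injective p := by
    rw [injective_iff_map_eq_zero]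
    intro x hx
    by_contra h0
    obtain ⟨z, hz⟩ := hl x (hM x) (fun h => h0 (Subtype.ext h))
    apply hφ
    have h1 := LinearMap.congr_fun hx ⟨z * e, z, rfl⟩
    rwa [hp, ← mul_assoc, hz, hωe] at h1
  have hp2 : Function.Injective p.flip := by
    rw [injective_iff_map_eq_zero]
    intro y hy
    by_contra h0
    obtain ⟨z, hz⟩ := hr y (hN y) (fun h => h0 (Subtype.ext h))
    apply hφ
    have h1 := LinearMap.congr_fun hy ⟨e * z, z, rfl⟩
    rwa [LinearMap.flip_apply, hp, mul_assoc, hz, heω] at h1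
  have hpp := LinearMap.IsPerfPair.of_injective hp1 hp2
  -- In Baer's criterion a map `g` from a right ideal to `eR` is composed with `φ`, extended
  -- `K`-linearly to `R` and restricted to `Re`. The perfect pairing represents this functional by
  -- some `x₀ ∈ eR`.
  apply Module.Baer.injective
  intro I g
  let G : I.restrictScalars K →ₗ[K] K :=
    { toFun := fun x => φ (g ⟨x.1, x.2⟩ : R)
      map_add' := fun x y => by
        rw [← map_add, ← Submodule.coe_add, ← map_add]
        rfl
      map_smul' := fun k x => by
        have h1 : g ⟨(k • x).1, (k • x).2⟩ = (algebraMap K Rᵐᵒᵖ k) • g ⟨x.1, x.2⟩ := by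
          rw [← map_smul]
          congr 1
          exact Subtype.ext (Algebra.smul_def k (x : Rᵐᵒᵖ))
        rw [h1, Submodule.coe_smul, MulOpposite.algebraMap_apply, op_smul_eq_mul,
          ← Algebra.commutes, ← Algebra.smul_def, map_smul]
        rfl }
  obtain ⟨ψ, hψ⟩ := LinearMap.exists_extend G
  let ψ' : Module.Dual K N := ψ ∘ₗ (MulOpposite.opLinearEquiv K : R ≃ₗ[K] Rᵐᵒᵖ).toLinearMap ∘ₗ N.subtype
  obtain ⟨x₀, hx₀⟩ : ∃ x₀, p x₀ = ψ' := ⟨p.toPerfPair.symm ψ', p.apply_symm_toPerfPair_self ψ'⟩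
  have hspan : ∀ x : R, e * x = x → x ∈ Submodule.span Rᵐᵒᵖ {e} := fun x hx =>
    (mem_span_idempotent he).2 hx
  refine ⟨LinearMap.toSpanSingleton _ _ ⟨x₀, hspan _ (hM x₀)⟩, fun r hrI => Subtype.ext ?_⟩
  change (x₀ : R) * unop r = g ⟨r, hrI⟩
  have hg1 := (mem_span_idempotent he).1 (g ⟨r, hrI⟩).2
  -- If `x₀ r ≠ g(r)`, the difference is multiplied into `ω` by some `z`. Since `φ(x₀ r z e) =
  -- φ(g(r) z e)` by the choice of `x₀`, this gives `φ(ω) = 0`.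
  by_contra hne
  have hne' : (x₀ : R) * unop r - g ⟨r, hrI⟩ ≠ 0 := sub_ne_zero.2 hne
  obtain ⟨z, hz⟩ := hl _ (by rw [mul_sub, ← mul_assoc, hM, hg1]) hne'
  have hmem : op (z * e) * r ∈ I := I.mul_mem_left _ hrI
  have h1 : φ ((x₀ : R) * (unop r * (z * e))) = ψ (op (unop r * (z * e))) :=
    LinearMap.congr_fun hx₀ ⟨unop r * (z * e), unop r * z, by
      change unop r * z * e = _
      rw [mul_assoc]⟩
  have h2 : ψ (op (unop r * (z * e))) = φ ((g ⟨r, hrI⟩ : R) * (z * e)) := by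
    have h3 : ψ (op (unop r * (z * e))) = G ⟨op (z * e) * r, hmem⟩ :=
      LinearMap.congr_fun hψ ⟨op (z * e) * r, hmem⟩
    have h4 : g ⟨op (z * e) * r, hmem⟩ = op (z * e) • g ⟨r, hrI⟩ := by
      rw [← map_smul]; rfl
    rw [h3]
    change φ (g ⟨op (z * e) * r, hmem⟩ : R) = _
    rw [h4]
    rfl
  apply hφ
  rw [← hωe, ← hz, mul_assoc, sub_mul, map_sub, mul_assoc, h1, h2, sub_self]

end Projective

/-! ### Injectivity of `P_i` -/

namespace WeightedTriangulationQuiver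

variable {V A K : Type*} [Field K] [Fintype V] {D : WeightedTriangulationQuiver V A K}
variable {R : Type*} [Ring R] [Algebra K R] {ee : V → R} {ar : A → R}

theorem Generates.op (hg : Generates K ee ar) :
    Generates K (fun v => op (ee v)) (fun a => op (ar a)) := by
  have h1 := Subalgebra.op_adjoin (R := K) (Set.range ee ∪ Set.range ar)
  rw [show Algebra.adjoin K (Set.range ee ∪ Set.range ar) = ⊤ from hg, Subalgebra.op_top] at h1
  rw [Generates, h1]
  congr 1
  ext x
  simp only [Set.mem_union, Set.mem_range, Set.mem_preimage]
  refine or_congr (exists_congr fun v => ?_) (exists_congr fun v => ?_) <;>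
  exact ⟨fun h => by rw [← h]; rfl, fun h => by rw [h]; rfl⟩

namespace Quad

variable {α κ β σ δ ν : A} (q : D.Quad α κ β σ δ ν) (h : D.IsRep ee ar)

include q

theorem s_α : D.s α = D.t ν := by
  rw [← D.s_bar, q.bar_α, ← q.f_ν, D.s_f]

include h

theorem walk_mul_ee_α : D.walk ar α (D.N α) * ee (D.s α) = D.walk ar α (D.N α) := by
  have hN := q.three_le
  have h1 := h.walk_mul_ee α (k := D.N α) (by omega)
  rwa [D.iterate_N] at h1

/-- The left-handed statement is the right-handed one for the opposite quiver, where `ν` takes the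
place of `α`; the full path from `ν` there is the full path from `α` read backwards. -/
theorem exists_mul_eq_socle' (hg : Generates K ee ar) {y : R} (hy : y * ee (D.s α) = y)
    (hy0 : y ≠ 0) : ∃ z, z * y = D.walk ar α (D.N α) := by
  have hN := q.three_le
  have h1 := q.reverse.exists_mul_eq_socle h.reverse hg.op (x := op y) (by
    change op (ee (D.t ν)) * op y = op y
    rw [← op_mul, ← q.s_α, hy]) (by rwa [Ne, op_eq_zero_iff])
  obtain ⟨z, hz⟩ := h1
  have h2 := reverse_walk (D := D) ar α (D.N α - 1)
  rw [q.iterate_α, show D.N α - 1 + 1 = D.N α by omega] at h2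
  rw [D.reverse_N, q.N_ν, h2] at hz
  exact ⟨unop z, op_injective hz⟩

end Quad

variable (D) in
theorem mem_P {v : V} {x : D.Alg} : x ∈ D.P v ↔ D.e v * x = x :=
  mem_span_idempotent (D.isRep_alg.idem v)

variable (D) in
theorem projective_P (v : V) : Module.Projective (D.Alg)ᵐᵒᵖ (D.P v) :=
  projective_span_idempotent (D.isRep_alg.idem v)

theorem Quad.injective_P {α κ β σ δ ν : A} (q : D.Quad α κ β σ δ ν) :
    Module.Injective (D.Alg)ᵐᵒᵖ (D.P (D.s α)) := by
  have hN := q.three_le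
  have h := D.isRep_alg
  have hg := D.generates_alg
  exact injective_span_idempotent (h.idem _) q.walk_α_ne_zero (q.walk_mul_ee_α h)
    (h.ee_mul_walk α (by omega)) (q.corner_fg h) (q.ee_mul_mem_corner h hg)
    (fun x hx hx0 => q.exists_mul_eq_socle h hg hx hx0)
    (fun x hx hx0 => q.exists_mul_eq_socle' h hg hx hx0)

end WeightedTriangulationQuiver

/-! ### The radical of `P_v` and superfluous submodules -/

namespace WeightedTriangulationQuiver

open MulOpposite

variable {V A K : Type*} [Field K] [Fintype V] {D : WeightedTriangulationQuiver V A K}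

section ArrowIdeal

variable {R : Type*} [Ring R] [Algebra K R] {ee : V → R} {ar : A → R}

/-- The span of all words of length at least one in the arrows. -/
def arrowIdeal (K : Type*) [Field K] {A R : Type*} [Ring R] [Algebra K R] (ar : A → R) :
    Submodule K R :=
  Submodule.span K {w | ∃ l : List A, l ≠ [] ∧ w = (l.map ar).prod}

theorem ar_mem_arrowIdeal (a : A) : ar a ∈ arrowIdeal K ar :=
  Submodule.subset_span ⟨[a], by simp, by simp⟩

theorem IsRep.arrowIdeal_mul_mem (h : D.IsRep ee ar) (hg : Generates K ee ar) {u : R}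
    (hu : u ∈ arrowIdeal K ar) (r : R) : u * r ∈ arrowIdeal K ar := by
  refine hg.mul_mem ?_ ?_ hu r
  · intro u hu v
    induction hu using Submodule.span_induction with
    | mem x hx =>
      obtain ⟨l, hl, rfl⟩ := hx
      obtain ⟨l, a, rfl⟩ := l.eq_nil_or_concat.resolve_left hl
      rw [List.map_concat, List.prod_concat, mul_assoc]
      by_cases hv : D.t a = v
      · rw [← hv, h.target]
        exact Submodule.subset_span ⟨l.concat a, hl, by rw [List.map_concat, List.prod_concat]⟩
      · rw [h.mul_ee_of_ne hv, mul_zero]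
        exact zero_mem _
    | zero => rw [zero_mul]; exact zero_mem _
    | add x y _ _ hx hy => rw [add_mul]; exact add_mem hx hy
    | smul c x _ hx => rw [smul_mul_assoc]; exact Submodule.smul_mem _ _ hx
  · intro u hu a
    induction hu using Submodule.span_induction with
    | mem x hx =>
      obtain ⟨l, hl, rfl⟩ := hx
      exact Submodule.subset_span ⟨l ++ [a], by simp, by simp⟩
    | zero => rw [zero_mul]; exact zero_mem _
    | add x y _ _ hx hy => rw [add_mul]; exact add_mem hx hy
    | smul c x _ hx => rw [smul_mul_assoc]; exact Submodule.smul_mem _ _ hx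

/-- The quotient of `e_v R` by paths of positive length is at most one-dimensional, which makes
`P_v` local once those paths act nilpotently. -/
theorem IsRep.ee_mul_decomp (h : D.IsRep ee ar) (hg : Generates K ee ar) (v : V) (r : R) :
    ∃ c : K, ee v * r - c • ee v ∈ arrowIdeal K ar := by
  have key : ee v * r ∈ Submodule.span K {ee v} ⊔ arrowIdeal K ar := by
    have hJ : ∀ {u} r, u ∈ arrowIdeal K ar → u * r ∈ arrowIdeal K ar := fun r hu =>
      h.arrowIdeal_mul_mem hg hu r
    refine hg.mul_mem (U := Submodule.span K {ee v} ⊔ arrowIdeal K ar) ?_ ?_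
      (Submodule.mem_sup_left (Submodule.mem_span_singleton_self _)) r
    · intro u hu w
      obtain ⟨x, hx, y, hy, rfl⟩ := Submodule.mem_sup.1 hu
      obtain ⟨c, rfl⟩ := Submodule.mem_span_singleton.1 hx
      rw [add_mul, smul_mul_assoc]
      refine add_mem ?_ (Submodule.mem_sup_right (hJ _ hy))
      by_cases hv : v = w
      · rw [← hv, h.idem]
        exact Submodule.mem_sup_left hx
      · rw [h.orth v w hv, smul_zero]
        exact zero_mem _
    · intro u hu a
      obtain ⟨x, hx, y, hy, rfl⟩ := Submodule.mem_sup.1 hu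
      obtain ⟨c, rfl⟩ := Submodule.mem_span_singleton.1 hx
      rw [add_mul, smul_mul_assoc]
      refine add_mem (Submodule.mem_sup_right (Submodule.smul_mem _ _ ?_))
        (Submodule.mem_sup_right (hJ _ hy))
      by_cases hv : D.s a = v
      · rw [← hv, h.source]
        exact ar_mem_arrowIdeal a
      · rw [h.ee_mul_of_ne hv]
        exact zero_mem _
  obtain ⟨x, hx, y, hy, hxy⟩ := Submodule.mem_sup.1 key
  obtain ⟨c, rfl⟩ := Submodule.mem_span_singleton.1 hx
  exact ⟨c, by rw [← hxy, add_sub_cancel_left]; exact hy⟩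

end ArrowIdeal

theorem e_mem_P (v : V) : D.e v ∈ D.P v := Submodule.mem_span_singleton_self _

theorem eq_top_of_e_mem {v : V} {N : Submodule (D.Alg)ᵐᵒᵖ (D.P v)} (h : ⟨D.e v, e_mem_P v⟩ ∈ N) :
    N = ⊤ := by
  rw [eq_top_iff]
  intro x _
  have h1 : x = op (x : D.Alg) • (⟨D.e v, e_mem_P v⟩ : D.P v) := by
    apply Subtype.ext
    change (x : D.Alg) = op (x : D.Alg) • D.e v
    rw [op_smul_eq_mul, D.mem_P.1 x.2]
  rw [h1]
  exact N.smul_mem _ h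

/-- The submodule of `P_v` spanned by the paths of positive length. -/
noncomputable def radP (D : WeightedTriangulationQuiver V A K) (v : V) :
    Submodule (D.Alg)ᵐᵒᵖ (D.P v) where
  carrier := {x | (x : D.Alg) ∈ arrowIdeal K D.arr}
  zero_mem' := zero_mem (arrowIdeal K D.arr)
  add_mem' hx hy := (arrowIdeal K D.arr).add_mem hx hy
  smul_mem' r _ hx := D.isRep_alg.arrowIdeal_mul_mem D.generates_alg hx (unop r)

theorem mem_radP {v : V} {x : D.P v} : x ∈ D.radP v ↔ (x : D.Alg) ∈ arrowIdeal K D.arr := Iff.rfl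

/-- A form of Nakayama's lemma that needs nilpotency only at the single vertex `v`. -/
theorem isSuperfluous_radP {v : V} (hv : D.e v ∈ longAnnihilated K D.arr) :
    IsSuperfluous (D.radP v) := by
  intro N hN
  obtain ⟨n, hn⟩ := hv
  have h1 : (⟨D.e v, e_mem_P v⟩ : D.P v) ∈ N ⊔ D.radP v := hN ▸ Submodule.mem_top
  obtain ⟨y, hy, x, hx, hyx⟩ := Submodule.mem_sup.1 h1
  have hyx' : (y : D.Alg) + x = D.e v := congrArg Subtype.val hyx
  let N' : Submodule K D.Alg :=
    { carrier := {z | ∃ w ∈ N, (w : D.Alg) = D.e v * z}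
      zero_mem' := ⟨0, N.zero_mem, by rw [mul_zero]; rfl⟩
      add_mem' := by
        rintro z₁ z₂ ⟨w₁, hw₁, h₁⟩ ⟨w₂, hw₂, h₂⟩
        exact ⟨w₁ + w₂, N.add_mem hw₁ hw₂, by rw [mul_add, ← h₁, ← h₂]; rfl⟩
      smul_mem' := by
        rintro c z ⟨w, hw, h⟩
        refine ⟨op (algebraMap K D.Alg c) • w, N.smul_mem _ hw, ?_⟩
        change op (algebraMap K D.Alg c) • (w : D.Alg) = _
        rw [op_smul_eq_mul, h, ← Algebra.commutes, ← Algebra.smul_def, mul_smul_comm] }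
  -- Descending induction on the length of a word `w`, with `e_v = y + x`, `y ∈ N` and `x` in the
  -- radical: `e_v w = y w + x w`, where `y w ∈ N` and `x w` is a combination of longer words. The
  -- empty word gives `e_v ∈ N`.
  have key : ∀ k (l : List A), n ≤ l.length + k → (l.map D.arr).prod ∈ N' := by
    intro k
    induction k with
    | zero =>
      intro l hl
      exact ⟨0, N.zero_mem, by rw [hn l hl]; rfl⟩
    | succ k ih =>
      intro l hl
      have h2 : (y : D.Alg) * (l.map D.arr).prod ∈ N' := by
        refine ⟨op (l.map D.arr).prod • y, N.smul_mem _ hy, ?_⟩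
        change op (l.map D.arr).prod • (y : D.Alg) = _
        rw [op_smul_eq_mul, ← mul_assoc, D.mem_P.1 y.2]
      have h3 : ∀ u ∈ arrowIdeal K D.arr, u * (l.map D.arr).prod ∈ N' := by
        intro u hu
        induction hu using Submodule.span_induction with
        | mem x hx =>
          obtain ⟨l', hl', rfl⟩ := hx
          rw [← List.prod_append, ← List.map_append]
          apply ih
          have := List.length_pos_of_ne_nil hl'
          rw [List.length_append]
          omega
        | zero => rw [zero_mul]; exact zero_mem _
        | add x y _ _ hx hy => rw [add_mul]; exact add_mem hx hy
        | smul c x _ hx => rw [smul_mul_assoc]; exact Submodule.smul_mem _ _ hx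
      have h4 := add_mem h2 (h3 x hx)
      rw [← add_mul, hyx'] at h4
      obtain ⟨w, hw, h5⟩ := h4
      exact ⟨w, hw, by rw [h5, ← mul_assoc, D.isRep_alg.idem]⟩
  obtain ⟨w, hw, h6⟩ := key n [] (by simp)
  apply eq_top_of_e_mem
  rw [List.map_nil, List.prod_nil, mul_one] at h6
  rwa [← show w = ⟨D.e v, e_mem_P v⟩ from Subtype.ext h6]

section Local

variable {v : V} (hv : D.e v ∈ longAnnihilated K D.arr) (hv0 : D.e v ≠ 0)

include hv hv0

theorem radP_ne_top : D.radP v ≠ ⊤ := fun h => hv0 <| by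
  have h1 := isSuperfluous_radP hv ⊥ (by rw [h, sup_top_eq])
  have h2 : (⟨D.e v, e_mem_P v⟩ : D.P v) ∈ (⊥ : Submodule (D.Alg)ᵐᵒᵖ (D.P v)) :=
    h1 ▸ Submodule.mem_top
  exact congrArg Subtype.val ((Submodule.mem_bot _).1 h2)

/-- An element outside the radical is, after scaling, `e_v` plus a radical element, so a submodule
containing it is everything by superfluity. -/
theorem le_radP {X : Submodule (D.Alg)ᵐᵒᵖ (D.P v)} (hX : X ≠ ⊤) : X ≤ D.radP v := by
  intro x hx
  obtain ⟨c, hc⟩ := D.isRep_alg.ee_mul_decomp D.generates_alg v x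
  rw [D.mem_P.1 x.2] at hc
  by_cases hc0 : c = 0
  · rwa [hc0, zero_smul, sub_zero] at hc
  · refine absurd (isSuperfluous_radP hv X (eq_top_of_e_mem ?_)) hX
    let y : D.P v := ⟨(x : D.Alg) - c • D.e v, D.mem_P.2 (by
      rw [mul_sub, D.mem_P.1 x.2, mul_smul_comm, D.isRep_alg.idem])⟩
    have hy : y ∈ D.radP v := hc
    have h1 : (⟨D.e v, e_mem_P v⟩ : D.P v) = op (algebraMap K D.Alg c⁻¹) • (x - y) := by
      apply Subtype.ext
      change D.e v = op (algebraMap K D.Alg c⁻¹) • ((x : D.Alg) - ((x : D.Alg) - c • D.e v))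
      rw [sub_sub_cancel, op_smul_eq_mul, ← Algebra.commutes, ← Algebra.smul_def, smul_smul,
        inv_mul_cancel₀ hc0, one_smul]
    rw [h1]
    exact Submodule.smul_mem _ _ (sub_mem (Submodule.mem_sup_left hx) (Submodule.mem_sup_right hy))

theorem isSuperfluous_of_ne_top {X : Submodule (D.Alg)ᵐᵒᵖ (D.P v)} (hX : X ≠ ⊤) :
    IsSuperfluous X := fun N hN => by
  refine isSuperfluous_radP hv N (top_le_iff.1 ?_)
  rw [← hN]
  exact sup_le_sup_left (le_radP hv hv0 hX) N

/-- As every proper submodule lies in `radP`, it is the unique maximal submodule. -/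
theorem jacobson_P : Module.jacobson (D.Alg)ᵐᵒᵖ (D.P v) = D.radP v := by
  have h1 : IsCoatom (D.radP v) :=
    ⟨radP_ne_top hv hv0, fun X hX => by
      by_contra h2
      exact hX.not_ge (le_radP hv hv0 h2)⟩
  refine le_antisymm (sInf_le h1) (le_sInf fun X hX => ?_)
  have h2 := le_radP hv hv0 hX.1
  rcases h2.eq_or_lt with h3 | h3
  · exact h3.ge
  · exact absurd (hX.2 _ h3) h1.1

end Local

end WeightedTriangulationQuiver

/-! ### Assembling the periodic resolution -/

namespace WeightedTriangulationQuiver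

open MulOpposite

variable {V A K : Type*} [Field K] [Fintype V] {D : WeightedTriangulationQuiver V A K}

section Periodic

variable {R : Type*} [Ring R] {V : Type*} {P : V → Type*} [∀ v, AddCommGroup (P v)]
  [∀ v, Module R (P v)] {i j y : V} {d₀ : P j →ₗ[R] P i} {d₁ : P y →ₗ[R] P j}
  {d₂ : P i →ₗ[R] P y} {d₃ : P i →ₗ[R] P i}

theorem exact_periodicDifferential (h₀ : Function.Exact d₁ d₀) (h₁ : Function.Exact d₂ d₁)
    (h₂ : Function.Exact d₃ d₂) (h₃ : Function.Exact d₀ d₃) :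
    ∀ n, Function.Exact (periodicDifferential d₀ d₁ d₂ d₃ (n + 1))
      (periodicDifferential d₀ d₁ d₂ d₃ n)
  | 0 => h₀
  | 1 => h₁
  | 2 => h₂
  | 3 => h₃
  | n + 4 => exact_periodicDifferential h₀ h₁ h₂ h₃ n

theorem isSuperfluous_ker_periodicDifferential (h₀ : IsSuperfluous (LinearMap.ker d₀))
    (h₁ : IsSuperfluous (LinearMap.ker d₁)) (h₂ : IsSuperfluous (LinearMap.ker d₂))
    (h₃ : IsSuperfluous (LinearMap.ker d₃)) :
    ∀ n, IsSuperfluous (LinearMap.ker (periodicDifferential d₀ d₁ d₂ d₃ n))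
  | 0 => h₀
  | 1 => h₁
  | 2 => h₂
  | 3 => h₃
  | n + 4 => isSuperfluous_ker_periodicDifferential h₀ h₁ h₂ h₃ n

end Periodic

/-- Left multiplication by an element of `e_u Λ`. -/
noncomputable def leftMul {u : V} (b : D.Alg) (hb : D.e u * b = b) (v : V) :
    D.P v →ₗ[(D.Alg)ᵐᵒᵖ] D.P u where
  toFun x := ⟨b * x, D.mem_P.2 (by rw [← mul_assoc, hb])⟩
  map_add' x y := Subtype.ext (mul_add b _ _)
  map_smul' r x := Subtype.ext (mul_assoc b _ _).symm

theorem leftMul_eq_zero_iff {u v : V} {b : D.Alg} {hb : D.e u * b = b} {x : D.P v} :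
    leftMul b hb v x = 0 ↔ b * (x : D.Alg) = 0 :=
  Subtype.ext_iff

theorem ker_leftMul_ne_top {u v : V} {b : D.Alg} {hb : D.e u * b = b} (hb' : b * D.e v = b)
    (hb0 : b ≠ 0) : LinearMap.ker (leftMul b hb v) ≠ ⊤ := fun h => hb0 <| by
  have h1 : (⟨D.e v, e_mem_P v⟩ : D.P v) ∈ LinearMap.ker (leftMul b hb v) :=
    h ▸ Submodule.mem_top
  rw [LinearMap.mem_ker, leftMul_eq_zero_iff] at h1
  rw [← hb', h1]

theorem arr_smul_S {v : V} (hv : D.e v ∈ longAnnihilated K D.arr) (hv0 : D.e v ≠ 0) (a : A)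
    (x : D.S v) : op (D.arr a) • x = 0 := by
  obtain ⟨x, rfl⟩ := Submodule.mkQ_surjective _ x
  rw [← map_smul, Submodule.mkQ_apply, Submodule.Quotient.mk_eq_zero, jacobson_P hv hv0, mem_radP]
  change (x : D.Alg) * D.arr a ∈ _
  obtain ⟨c, hc⟩ := D.isRep_alg.ee_mul_decomp D.generates_alg v x
  rw [D.mem_P.1 x.2] at hc
  have h1 : (x : D.Alg) * D.arr a =
      ((x : D.Alg) - c • D.e v) * D.arr a + c • (D.e v * D.arr a) := by
    rw [sub_mul, smul_mul_assoc, sub_add_cancel]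
  rw [h1]
  refine add_mem (D.isRep_alg.arrowIdeal_mul_mem D.generates_alg hc _) (Submodule.smul_mem _ _ ?_)
  by_cases hs : D.s a = v
  · rw [← hs, D.isRep_alg.source]
    exact ar_mem_arrowIdeal a
  · rw [D.isRep_alg.ee_mul_of_ne hs]
    exact zero_mem _

/-- All arrows act as zero on `S_i`, so an image isomorphic to it would have its generator `b`
killed by every arrow. -/
theorem not_nonempty_range_leftMul_equiv {i u v : V} (hi : D.e i ∈ longAnnihilated K D.arr)
    (hi0 : D.e i ≠ 0) {b : D.Alg} {hb : D.e u * b = b} (hb' : b * D.e v = b) {a : A}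
    (ha : b * D.arr a ≠ 0) :
    ¬ Nonempty (LinearMap.range (leftMul b hb v) ≃ₗ[(D.Alg)ᵐᵒᵖ] D.S i) := by
  rintro ⟨E⟩
  have h1 : leftMul b hb v ⟨D.e v, e_mem_P v⟩ ∈ LinearMap.range (leftMul b hb v) := ⟨_, rfl⟩
  have h2 := arr_smul_S hi hi0 a (E ⟨_, h1⟩)
  rw [← map_smul, EmbeddingLike.map_eq_zero_iff] at h2
  apply ha
  have h3 := congrArg (fun x : LinearMap.range (leftMul b hb v) => ((x : D.P u) : D.Alg)) h2
  change b * D.e v * D.arr a = 0 at h3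
  rwa [hb'] at h3

namespace Quad

variable {α κ β σ δ ν : A} (q : D.Quad α κ β σ δ ν)

include q

theorem e_ne_zero : D.e (D.s α) ≠ 0 := fun h => q.walk_α_ne_zero <| by
  have hN := q.three_le
  rw [← D.isRep_alg.ee_mul_walk α (k := D.N α) (by omega), h, zero_mul]

theorem e_ne_zero' : D.e (D.s ν) ≠ 0 := fun h => q.walk_ν_ne_zero <| by
  have hN := q.three_le
  rw [← D.isRep_alg.ee_mul_walk ν (k := D.N α) (by omega), h, zero_mul]

theorem walk_α_mul_arr (a : A) : D.walk D.arr α (D.N α) * D.arr a = 0 := by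
  have hN := q.three_le
  have h1 := q.walk_α_mul_mem D.isRep_alg (k := D.N α) (by omega) a
  rw [q.tail_eq_bot D.isRep_alg (by omega)] at h1
  exact (Submodule.mem_bot K).1 h1

theorem arr_ν_mul_arr_α : D.arr ν * D.arr α ≠ 0 := fun h => q.walk_ν_ne_zero <| by
  have hN := q.three_le
  rw [show D.N α = 2 + (D.N α - 2) by omega, walk_add, walk_two, q.g_ν, h, zero_mul]

theorem arr_κ_ne_zero : D.arr κ ≠ 0 := fun h => q.walk_α_ne_zero <| by
  have h1 := D.isRep_alg.c_smul_walk_N α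
  rw [q.bar_α, h, zero_mul, zero_mul] at h1
  exact (smul_eq_zero.1 h1).resolve_left (D.c_ne_zero α)

/-- A path of positive length from `i` starts with `α` or with `κ`, and `κ` is a multiple of `αβ`.
Hence a single projective covers `Ω(S_i)`, although two arrows start at `i`. -/
theorem mem_radP_iff {x : D.P (D.s α)} :
    x ∈ D.radP (D.s α) ↔ ∃ r, D.arr α * r = (x : D.Alg) := by
  have h := D.isRep_alg
  constructor
  · intro hx
    have hκ : D.arr κ = D.arr α * ((D.c κ)⁻¹ • D.arr β) := by
      rw [mul_smul_comm, q.ar_α_mul_β h, smul_smul, inv_mul_cancel₀ (D.c_ne_zero κ), one_smul]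
    have key : ∀ u ∈ arrowIdeal K D.arr, D.e (D.s α) * u ∈ rightIdeal K (D.arr α) := by
      intro u hu
      induction hu using Submodule.span_induction with
      | mem x hx =>
        obtain ⟨l, hl, rfl⟩ := hx
        obtain ⟨a, l, rfl⟩ := List.exists_cons_of_ne_nil hl
        rw [List.map_cons, List.prod_cons, ← mul_assoc]
        by_cases ha : D.s a = D.s α
        · rw [← ha, h.source]
          rcases D.eq_or_eq_bar ha with rfl | rfl
          · exact mul_mem_rightIdeal _ _
          · rw [q.bar_α, hκ, mul_assoc]
            exact mul_mem_rightIdeal _ _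
        · rw [h.ee_mul_of_ne ha, zero_mul]
          exact zero_mem _
      | zero => rw [mul_zero]; exact zero_mem _
      | add x y _ _ hx hy => rw [mul_add]; exact add_mem hx hy
      | smul c x _ hx => rw [mul_smul_comm]; exact Submodule.smul_mem _ _ hx
    have h1 := key x hx
    rwa [D.mem_P.1 x.2] at h1
  · rintro ⟨r, hr⟩
    rw [mem_radP, ← hr]
    exact h.arrowIdeal_mul_mem D.generates_alg (ar_mem_arrowIdeal α) r

variable [Fintype A]

theorem e_mem : D.e (D.s α) ∈ longAnnihilated K D.arr := q.ee_mem_longAnnihilated D.isRep_alg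

theorem e_mem' : D.e (D.s ν) ∈ longAnnihilated K D.arr :=
  q.ee_mem_longAnnihilated' D.isRep_alg D.generates_alg

/-- `ω` kills `α`, hence the radical, and is itself non-zero. So multiplication by `ω` factors as
the cover `P_i → S_i` followed by an embedding of `S_i` as the socle. -/
theorem ker_leftMul_walk (hω : D.e (D.s α) * D.walk D.arr α (D.N α) = D.walk D.arr α (D.N α)) :
    LinearMap.ker (leftMul _ hω (D.s α)) = Module.jacobson (D.Alg)ᵐᵒᵖ (D.P (D.s α)) := by
  rw [jacobson_P q.e_mem q.e_ne_zero]
  refine le_antisymm (le_radP q.e_mem q.e_ne_zero (ker_leftMul_ne_top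
    (q.walk_mul_ee_α D.isRep_alg) q.walk_α_ne_zero)) fun x hx => ?_
  obtain ⟨r, hr⟩ := q.mem_radP_iff.1 hx
  rw [LinearMap.mem_ker, leftMul_eq_zero_iff, ← hr, ← mul_assoc, q.walk_α_mul_arr, zero_mul]

/-- The differentials are left multiplications by `α`, the relator, `ν` and `ω`. Each kernel is
superfluous because it is a proper submodule of a local module. -/
theorem periodic_resolution
    (hns : D.N α = 4 → D.N β = 4 → D.N (D.f (D.g α)) = 2 →
      D.c κ * D.c α * D.c (D.f (D.g α)) * D.c β ≠ 1)
    {i j y : V} (hi : i = D.s α) (hj : j = D.s β) (hy : y = D.s ν) :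
    ∃ (ι : D.S i →ₗ[(D.Alg)ᵐᵒᵖ] D.P i)
      (a : (D.P i ⧸ LinearMap.range ι) →ₗ[(D.Alg)ᵐᵒᵖ] D.P y)
      (b : D.P y →ₗ[(D.Alg)ᵐᵒᵖ] D.P j)
      (c : D.P j →ₗ[(D.Alg)ᵐᵒᵖ] D.syzygy i),
      IsInjectiveEnvelope ι ∧
      (Function.Injective a ∧ Function.Exact a b ∧ Function.Exact b c ∧ Function.Surjective c) ∧
      IsMinimalProjectiveResolution (fun n => D.P (periodicIndex i j y n))
        (periodicDifferential (P := fun v => D.P v) ((D.syzygy i).subtype ∘ₗ c) b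
          (a ∘ₗ (LinearMap.range ι).mkQ) (ι ∘ₗ D.cover i))
        (D.cover i) ∧
      HasPeriod (fun n => D.P (periodicIndex i j y n))
        (periodicDifferential (P := fun v => D.P v) ((D.syzygy i).subtype ∘ₗ c) b
          (a ∘ₗ (LinearMap.range ι).mkQ) (ι ∘ₗ D.cover i))
        (D.S i) 4 := by
  have h := D.isRep_alg
  have hg := D.generates_alg
  have hN := q.three_le
  have hR := q.three_le'
  have hωe : D.e i * D.walk D.arr α (D.N α) = D.walk D.arr α (D.N α) := by
    rw [hi]; exact h.ee_mul_walk α (by omega)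
  have hωe' : D.walk D.arr α (D.N α) * D.e i = D.walk D.arr α (D.N α) := by
    rw [hi]; exact q.walk_mul_ee_α h
  have hνe : D.e y * D.arr ν = D.arr ν := by rw [hy]; exact h.source ν
  have hνe' : D.arr ν * D.e i = D.arr ν := by rw [hi, q.s_α]; exact h.target ν
  have hbe : D.e j * relator D D.arr α κ β δ = relator D D.arr α κ β δ := by
    rw [hj]; exact q.ee_mul_relator h
  have hbe' : relator D D.arr α κ β δ * D.e y = relator D D.arr α κ β δ := by
    rw [hy]; exact q.relator_mul_ee h
  have hαe : D.e i * D.arr α = D.arr α := by rw [hi]; exact h.source α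
  have hαe' : D.arr α * D.e j = D.arr α := by rw [hj, ← q.f_α, D.s_f]; exact h.target α
  have hei : D.e i ∈ longAnnihilated K D.arr := by rw [hi]; exact q.e_mem
  have hei0 : D.e i ≠ 0 := by rw [hi]; exact q.e_ne_zero
  have hey : D.e y ∈ longAnnihilated K D.arr := by rw [hy]; exact q.e_mem'
  have hey0 : D.e y ≠ 0 := by rw [hy]; exact q.e_ne_zero'
  have hej : D.e j ∈ longAnnihilated K D.arr := by rw [hj]; exact q.swap.e_mem'
  have hej0 : D.e j ≠ 0 := by rw [hj]; exact q.swap.e_ne_zero'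
  have hνω : D.arr ν * D.walk D.arr α (D.N α) = 0 := q.ar_ν_mul_walk_α h
  have hrel : relator D D.arr α κ β δ * D.arr (D.g δ) ≠ 0 := by
    obtain ⟨r, hr0, u, hu, hr⟩ := q.relator_mul_g h hns
    rw [hr]
    exact q.smul_walk_β_add_ne_zero h q.walk_β_ne_zero le_rfl hR hr0 hu
  have hker : LinearMap.ker (leftMul _ hωe i) = Module.jacobson (D.Alg)ᵐᵒᵖ (D.P i) := by
    subst hi
    exact q.ker_leftMul_walk hωe
  have hrad : ∀ x : D.P i, x ∈ D.radP i ↔ ∃ r, D.arr α * r = (x : D.Alg) := by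
    subst hi
    exact fun x => q.mem_radP_iff
  let ι : D.S i →ₗ[(D.Alg)ᵐᵒᵖ] D.P i := Submodule.liftQ _ (leftMul _ hωe i) hker.ge
  have hι : ι ∘ₗ D.cover i = leftMul _ hωe i := Submodule.liftQ_mkQ _ _ _
  have hιinj : Function.Injective ι := by
    rw [← LinearMap.ker_eq_bot]
    exact Submodule.ker_liftQ_eq_bot _ _ _ hker.le
  have hιrange : LinearMap.range ι = LinearMap.range (leftMul _ hωe i) :=
    Submodule.range_liftQ _ _ _
  let a : (D.P i ⧸ LinearMap.range ι) →ₗ[(D.Alg)ᵐᵒᵖ] D.P y :=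
    Submodule.liftQ _ (leftMul _ hνe i) (by
      rw [hιrange]
      rintro _ ⟨x, rfl⟩
      rw [LinearMap.mem_ker, leftMul_eq_zero_iff]
      change D.arr ν * (D.walk D.arr α (D.N α) * (x : D.Alg)) = 0
      rw [← mul_assoc, hνω, zero_mul])
  have ha : a ∘ₗ (LinearMap.range ι).mkQ = leftMul _ hνe i := Submodule.liftQ_mkQ _ _ _
  have hainj : Function.Injective a := by
    rw [← LinearMap.ker_eq_bot]
    refine Submodule.ker_liftQ_eq_bot _ _ _ fun x hx => ?_
    rw [LinearMap.mem_ker, leftMul_eq_zero_iff] at hx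
    obtain ⟨r, hr⟩ := q.eq_smul_of_ν_mul_eq_zero h hg q.walk_ν_ne_zero
      (by rw [← hi]; exact D.mem_P.1 x.2) hx
    rw [hιrange]
    refine ⟨⟨r • D.e i, D.mem_P.2 (by rw [mul_smul_comm, h.idem])⟩, Subtype.ext ?_⟩
    change D.walk D.arr α (D.N α) * (r • D.e i) = _
    rw [hr, mul_smul_comm, hωe']
  have harange : LinearMap.range a = LinearMap.range (leftMul _ hνe i) :=
    Submodule.range_liftQ _ _ _
  let b : D.P y →ₗ[(D.Alg)ᵐᵒᵖ] D.P j := leftMul _ hbe y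
  have hsyz : D.syzygy i = D.radP i := by
    rw [syzygy, cover, Submodule.ker_mkQ, jacobson_P hei hei0]
  let c : D.P j →ₗ[(D.Alg)ᵐᵒᵖ] D.syzygy i := (leftMul _ hαe j).codRestrict _ fun x => by
    rw [hsyz, hrad]
    exact ⟨_, rfl⟩
  have hc : (D.syzygy i).subtype ∘ₗ c = leftMul _ hαe j := LinearMap.subtype_comp_codRestrict _ _ _
  have hcsurj : Function.Surjective c := by
    rintro ⟨x, hx⟩
    rw [hsyz, hrad] at hx
    obtain ⟨r, hr⟩ := hx
    refine ⟨⟨D.e j * r, D.mem_P.2 (by rw [← mul_assoc, h.idem])⟩, Subtype.ext (Subtype.ext ?_)⟩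
    change D.arr α * (D.e j * r) = x
    rw [← mul_assoc, hαe', hr]
  have hab : ∀ x : D.P y, b x = 0 ↔ x ∈ LinearMap.range (leftMul _ hνe i) := by
    intro x
    rw [leftMul_eq_zero_iff]
    constructor
    · intro hx
      obtain ⟨r, hr⟩ := q.exists_ν_mul h hg q.walk_β_ne_zero hns
        (by rw [← hy]; exact D.mem_P.1 x.2) hx
      refine ⟨⟨D.e i * r, D.mem_P.2 (by rw [← mul_assoc, h.idem])⟩, Subtype.ext ?_⟩
      change D.arr ν * (D.e i * r) = x
      rw [← mul_assoc, hνe', hr]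
    · rintro ⟨z, rfl⟩
      change relator D D.arr α κ β δ * (D.arr ν * (z : D.Alg)) = 0
      rw [← mul_assoc, q.relator_mul_ν h, zero_mul]
  have hbc : Function.Exact b (leftMul _ hαe j) := by
    intro x
    rw [leftMul_eq_zero_iff]
    constructor
    · intro hx
      obtain ⟨r, hr⟩ := q.exists_relator_mul h hg q.walk_α_ne_zero hns
        (by rw [← hj]; exact D.mem_P.1 x.2) hx
      refine ⟨⟨D.e y * r, D.mem_P.2 (by rw [← mul_assoc, h.idem])⟩, Subtype.ext ?_⟩
      change relator D D.arr α κ β δ * (D.e y * r) = x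
      rw [← mul_assoc, hbe', hr]
    · rintro ⟨z, rfl⟩
      change D.arr α * (relator D D.arr α κ β δ * (z : D.Alg)) = 0
      rw [← mul_assoc, q.α_mul_relator h, zero_mul]
  have hcov : Function.Exact (leftMul _ hαe j) (D.cover i) := by
    intro x
    rw [← LinearMap.mem_ker, show LinearMap.ker (D.cover i) = D.radP i from hsyz, hrad]
    constructor
    · rintro ⟨r, hr⟩
      refine ⟨⟨D.e j * r, D.mem_P.2 (by rw [← mul_assoc, h.idem])⟩, Subtype.ext ?_⟩
      change D.arr α * (D.e j * r) = x
      rw [← mul_assoc, hαe', hr]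
    · rintro ⟨z, rfl⟩
      exact ⟨_, rfl⟩
  have hωa : Function.Exact (leftMul _ hωe i) (leftMul _ hνe i) := by
    intro x
    rw [← ha, LinearMap.comp_apply, map_eq_zero_iff a hainj, Submodule.mkQ_apply,
      Submodule.Quotient.mk_eq_zero, hιrange]
    rfl
  have hcω : Function.Exact (leftMul _ hαe j) (leftMul _ hωe i) := by
    intro x
    rw [← hι, LinearMap.comp_apply, map_eq_zero_iff ι hιinj]
    exact hcov x
  have hα0 : D.arr α ≠ 0 := fun h0 => q.arr_ν_mul_arr_α (by rw [h0, mul_zero])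
  have hν0 : D.arr ν ≠ 0 := fun h0 => q.arr_ν_mul_arr_α (by rw [h0, zero_mul])
  have hb0 : relator D D.arr α κ β δ ≠ 0 := fun h0 => hrel (by rw [h0, zero_mul])
  have hcov' : Function.Surjective (D.cover i) := Submodule.mkQ_surjective _
  have hcovker : IsSuperfluous (LinearMap.ker (D.cover i)) := by
    rw [show LinearMap.ker (D.cover i) = D.radP i from hsyz]
    exact isSuperfluous_radP hei
  refine ⟨ι, a, b, c, ⟨?_, hιinj, ?_⟩, ⟨hainj, ?_, ?_, hcsurj⟩, ?_, ?_⟩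
  · subst hi
    exact q.injective_P
  -- Essentiality: a non-zero element of `N` can be multiplied to `ω`, which generates the image of
  -- `ι`.
  · intro N hN0
    rw [eq_bot_iff]
    intro x hx
    by_contra hx0
    obtain ⟨z, hz⟩ := q.exists_mul_eq_socle h hg (x := (x : D.Alg))
      (by rw [← hi]; exact D.mem_P.1 x.2) (fun h0 => hx0 (Subtype.ext h0))
    have h1 : op z • x ∈ N ⊓ LinearMap.range ι := by
      refine ⟨N.smul_mem _ hx, ?_⟩
      rw [hιrange]
      refine ⟨⟨D.e i, e_mem_P i⟩, Subtype.ext ?_⟩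
      change D.walk D.arr α (D.N α) * D.e i = x * z
      rw [hωe', hz]
    rw [hN0] at h1
    have h2 : (x : D.Alg) * z = 0 := congrArg Subtype.val ((Submodule.mem_bot _).1 h1)
    exact q.walk_α_ne_zero (hz.symm.trans h2)
  · intro x
    rw [hab, ← harange]
    rfl
  · intro x
    rw [← hbc x, ← hc, LinearMap.comp_apply, map_eq_zero_iff _ (Submodule.injective_subtype _)]
  · rw [hι, ha, hc]
    refine ⟨fun n => D.projective_P _, hcov', hcov,
      exact_periodicDifferential hbc hab hωa hcω, hcovker,
      isSuperfluous_ker_periodicDifferential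
        (isSuperfluous_of_ne_top hej hej0 (ker_leftMul_ne_top hαe' hα0))
        (isSuperfluous_of_ne_top hey hey0 (ker_leftMul_ne_top hbe' hb0))
        (isSuperfluous_of_ne_top hei hei0 (ker_leftMul_ne_top hνe' hν0))
        (isSuperfluous_of_ne_top hei hei0 (ker_leftMul_ne_top hωe' q.walk_α_ne_zero))⟩
  · rw [hι, ha, hc]
    constructor
    · refine ⟨3, rfl, ⟨?_⟩⟩
      change LinearMap.range (leftMul _ hωe i) ≃ₗ[(D.Alg)ᵐᵒᵖ] D.S i
      rw [← hιrange]
      exact (LinearEquiv.ofInjective ι hιinj).symm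
    · rintro _ ⟨n, rfl, hn⟩
      by_contra! hlt
      -- The generators of the first three syzygies are `α`, the relator and `ν`; they are not
      -- killed by `β`, `g(δ)` and `α`, respectively.
      obtain rfl | rfl | rfl : n = 0 ∨ n = 1 ∨ n = 2 := by omega
      · refine not_nonempty_range_leftMul_equiv (hb := hαe) (a := β) hei hei0 hαe' ?_ hn
        rw [q.ar_α_mul_β h]
        exact smul_ne_zero (D.c_ne_zero κ) q.arr_κ_ne_zero
      · exact not_nonempty_range_leftMul_equiv (hb := hbe) hei hei0 hbe' hrel hn
      · exact not_nonempty_range_leftMul_equiv (hb := hνe) hei hei0 hνe' q.arr_ν_mul_arr_α hn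

end Quad

end WeightedTriangulationQuiver

/-! ### Recognition of the singular algebras -/

namespace WeightedTriangulationQuiver

variable {V A K : Type*} [Field K] {D : WeightedTriangulationQuiver V A K}

/-- A part of the quiver with all arrows at its vertices is the whole quiver. -/
theorem exists_equiv_of_closed {X : Type*} {p : ℕ} [NeZero p] {v : Fin p → V}
    (hv : Function.Injective v) {a : X → A} {src : X → Fin p} (hsrc : Function.Surjective src)
    {rot par : X → X} (hs : ∀ x, D.s (a x) = v (src x)) (hf : ∀ x, D.f (a x) = a (rot x))
    (hbar : ∀ x, D.bar (a x) = a (par x)) (hpar : ∀ x y, src x = src y → x = y ∨ y = par x) :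
    ∃ (v' : Fin p ≃ V) (a' : X ≃ A), (∀ x, a' x = a x) ∧ (∀ x, D.s (a' x) = v' (src x)) ∧
      ∀ x, D.f (a' x) = a' (rot x) := by
  have hinj : Function.Injective a := fun x y hxy => by
    rcases hpar x y (hv (by rw [← hs, ← hs, hxy])) with h | h
    · exact h
    · exact absurd (by rw [hbar, ← h, hxy]) (D.bar_ne (a x))
  have hmem : ∀ b, D.s b ∈ Set.range v → b ∈ Set.range a := by
    rintro b ⟨u, hu⟩
    obtain ⟨x, rfl⟩ := hsrc u
    rcases D.eq_or_eq_bar (a := a x) (b := b) (by rw [hs, hu]) with h | h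
    · exact ⟨x, h.symm⟩
    · exact ⟨par x, by rw [h, hbar]⟩
  have hst : ∀ b, D.s b ∈ Set.range v ↔ D.t b ∈ Set.range v := by
    intro b
    constructor
    · intro hb
      obtain ⟨x, rfl⟩ := hmem b hb
      exact ⟨src (rot x), by rw [D.t_eq_s_f, hf, hs]⟩
    · intro hb
      rw [D.t_eq_s_f] at hb
      obtain ⟨x, hx⟩ := hmem _ hb
      exact ⟨src (rot (rot x)), by rw [← hs, ← hf, ← hf, hx, D.f_cubed]⟩
  have hconn : ∀ u w, Relation.EqvGen (fun x z => ∃ a, D.s a = x ∧ D.t a = z) u w →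
      (u ∈ Set.range v ↔ w ∈ Set.range v) := by
    intro u w h
    induction h with
    | rel x z h =>
      obtain ⟨b, rfl, rfl⟩ := h
      exact hst b
    | refl x => exact Iff.rfl
    | symm x z _ ih => exact ih.symm
    | trans x z w _ _ ih1 ih2 => exact ih1.trans ih2
  -- The given vertices are closed under passing along arrows in both directions, so connectedness
  -- leaves no others.
  have hvs : Function.Surjective v := fun w => (hconn (v 0) w (D.connected _ _)).1 ⟨0, rfl⟩
  have has : Function.Surjective a := fun b => hmem b (hvs _)
  exact ⟨Equiv.ofBijective v ⟨hv, hvs⟩, Equiv.ofBijective a ⟨hinj, has⟩, fun _ => rfl, hs, hf⟩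

theorem n_eq_two {a : A} (h1 : D.g a ≠ a) (h2 : D.g (D.g a) = a) : D.n a = 2 := by
  have h3 : D.n a ∣ 2 := Function.IsPeriodicPt.minimalPeriod_dvd (n := 2) h2
  rcases (Nat.dvd_prime Nat.prime_two).1 h3 with h | h
  · exact absurd (Function.minimalPeriod_eq_one_iff_isFixedPt.1 h) h1
  · exact h

theorem n_eq_four {a : A} (h1 : D.g (D.g a) ≠ a) (h2 : D.g^[4] a = a) : D.n a = 4 := by
  have h3 : D.n a ∣ 2 ^ 2 := Function.IsPeriodicPt.minimalPeriod_dvd (n := 4) h2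
  obtain ⟨k, hk, h4⟩ := (Nat.dvd_prime_pow Nat.prime_two).1 h3
  have h5 : ¬ D.n a ∣ 2 := fun h5 => h1
    ((Function.isPeriodicPt_minimalPeriod D.g a).trans_dvd h5 : Function.IsPeriodicPt D.g 2 a)
  interval_cases k
  · rw [h4] at h5; exact absurd (by norm_num) h5
  · rw [h4] at h5; exact absurd (by norm_num) h5
  · exact h4

theorem s_ne_of {a b : A} (h1 : b ≠ a) (h2 : b ≠ D.bar a) : D.s a ≠ D.s b := fun h =>
  (D.eq_or_eq_bar h.symm).elim h1 h2

namespace Quad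

variable {α κ β σ δ ν : A} (q : D.Quad α κ β σ δ ν)

include q

/-- If `g(α) = ν`, then also `g(δ) = β`, and the six arrows of the configuration are closed under
`f` and the involution. As `f(g(α)) = κ`, the arrow `κ` counts twice in the product of parameters,
which accounts for the square in the singularity condition. -/
theorem isSingularTriangle (hα : D.N α = 4) (hβ : D.N β = 4) (hν : D.g α = ν)
    (hc : D.c κ * D.c α * D.c (D.f (D.g α)) * D.c β = 1) : D.IsSingularTriangle := by
  have hgν : D.g δ = β := by rw [← q.bar_ν, ← hν, D.bar_g, q.f_α]
  have hκσ : κ ≠ σ := fun h => q.α_ne_δ (by rw [← q.f_σ, ← h, q.f_κ])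
  have hβδ : β ≠ δ := fun h => by
    have h1 : σ = ν := by rw [← q.f_β, h, q.f_δ]
    have h2 : α = κ := by rw [← q.f_σ, h1, q.f_ν]
    exact D.bar_ne α (q.bar_α.trans h2.symm)
  have hβκ : β ≠ κ := fun h => by rw [h, q.N_κ] at hβ; omega
  have hβσ : β ≠ σ := fun h => by rw [h, q.N_σ] at hβ; omega
  have hδκ : δ ≠ κ := fun h => by rw [← q.N_δ, h, q.N_κ] at hβ; omega
  have hij : D.s α ≠ D.s β := s_ne_of q.α_ne_β.symm (by rw [q.bar_α]; exact hβκ)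
  have hik : D.s α ≠ D.s δ := s_ne_of q.α_ne_δ.symm (by rw [q.bar_α]; exact hδκ)
  have hkj : D.s δ ≠ D.s β := s_ne_of hβδ (by rw [q.bar_δ]; exact hβσ)
  let v : Fin 3 → V := ![D.s α, D.s δ, D.s β]
  have hv : Function.Injective v := by
    intro a b hab
    fin_cases a <;> fin_cases b <;>
      simp [v, hij, hik, hkj, hij.symm, hik.symm, hkj.symm] at hab ⊢
  let a : Fin 2 × Fin 3 → A := fun x => ![![κ, δ, ν], ![α, β, σ]] x.1 x.2
  obtain ⟨v', a', ha', hs', hf'⟩ := exists_equiv_of_closed (D := D) hv (a := a)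
    (src := fun x => triangularSource x.1 x.2) (rot := fun x => (x.1, x.2 + 1))
    (par := fun x => (1 - x.1, -x.2)) (by decide)
    (by
      rintro ⟨T, k⟩
      fin_cases T <;> fin_cases k
      · change D.s κ = D.s α
        rw [← q.bar_α, D.s_bar]
      · rfl
      · change D.s ν = D.s β
        rw [← hν, ← q.bar_β, D.s_bar]
      · rfl
      · rfl
      · change D.s σ = D.s δ
        rw [← q.bar_δ, D.s_bar])
    (by
      rintro ⟨T, k⟩
      fin_cases T <;> fin_cases k
      exacts [q.f_κ, q.f_δ, q.f_ν, q.f_α, q.f_β, q.f_σ])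
    (by
      rintro ⟨T, k⟩
      fin_cases T <;> fin_cases k
      · exact q.bar_κ
      · exact q.bar_δ
      · exact q.bar_ν.trans hgν
      · exact q.bar_α
      · exact q.bar_β.trans hν
      · exact q.bar_σ)
    (by decide)
  have hm : ∀ {b}, D.N b = 4 → D.n b = 2 → D.m b = 2 := fun {b} h1 h2 => by
    rw [N, h2] at h1; omega
  have hnα : D.n α = 2 := n_eq_two (by rw [hν]; exact q.α_ne_ν.symm) (by rw [hν, q.g_ν])
  have hnβ : D.n β = 2 := n_eq_two (by rw [q.g_β]; exact hβδ.symm) (by rw [q.g_β, hgν])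
  have hnκ : D.n κ = 2 := n_eq_two (by rw [q.g_κ]; exact hκσ.symm) (by rw [q.g_κ, q.g_σ])
  refine ⟨v', a', fun T k => hs' (T, k), fun T k => hf' (T, k), ?_, ?_, ?_, ?_⟩
  · rw [ha']
    change D.m κ = 1
    have := q.N_κ
    rw [N, hnκ] at this
    omega
  · rw [ha']
    change D.m δ = 2
    rw [← q.g_β, D.m_g]
    exact hm hβ hnβ
  · rw [ha']
    change D.m ν = 2
    rw [← hν, D.m_g]
    exact hm hα hnα
  · rw [ha', ha', ha']
    change D.c κ ^ 2 * D.c δ * D.c ν = 1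
    rw [hν, q.f_ν] at hc
    rw [q.c_δ, q.c_ν, ← hc]
    ring

/-- If `g(α) ≠ ν`, the two `g`-cycles of length four and the second virtual cycle `(f(g(α))
f(g(δ)))` bring in two further triangles. All twelve arrows are then determined, and their six
sources are distinct, mostly because the values of `N` at the two arrows of a vertex differ. -/
theorem isSingularSpherical (hα : D.N α = 4) (hβ : D.N β = 4) (hv : D.N (D.f (D.g α)) = 2)
    (hν : D.g α ≠ ν)
    (hc : D.c κ * D.c α * D.c (D.f (D.g α)) * D.c β = 1) : D.IsSingularSpherical := by
  have hgδ : D.g δ ≠ β := fun h => hν <| by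
    rw [← q.bar_β, ← h, ← q.bar_ν, D.bar_bar]
  have hκσ : κ ≠ σ := fun h => q.α_ne_δ (by rw [← q.f_σ, ← h, q.f_κ])
  -- the third arrows of the `g`-cycles of `α` and `β`
  set τ := D.f (D.f (D.g δ)) with hτ
  set ρ := D.f (D.f (D.g α)) with hρ
  have hgτ : D.g τ = ν := q.g_f_f_g
  have hgρ : D.g ρ = β := q.swap.g_f_f_g
  have hggα : D.g (D.g α) = τ := by
    apply D.g_injective
    apply D.g_injective
    rw [hgτ, q.g_ν]
    have := D.iterate_N α
    rwa [hα] at this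
  have hggδ : D.g (D.g δ) = ρ := by
    apply D.g_injective
    apply D.g_injective
    rw [hgρ, q.g_β]
    have := D.iterate_N δ
    rwa [q.N_δ, hβ] at this
  have hfτ : D.f τ = D.g δ := D.f_cubed _
  have hfρ : D.f ρ = D.g α := D.f_cubed _
  have hbarξ : D.bar (D.f (D.g α)) = τ := by rw [D.bar_f, hggα]
  have hbarξ' : D.bar (D.f (D.g δ)) = ρ := by rw [D.bar_f, hggδ]
  have hbarτ : D.bar τ = D.f (D.g α) := by rw [← hbarξ, D.bar_bar]
  have hbarρ : D.bar ρ = D.f (D.g δ) := by rw [← hbarξ', D.bar_bar]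
  have hgξ' : D.g (D.f (D.g δ)) = D.f (D.g α) := by
    rw [← D.bar_f, ← hτ, hbarτ]
  have hgξ : D.g (D.f (D.g α)) = D.f (D.g δ) := by
    rw [← D.bar_f, ← hρ, hbarρ]
  have hξ : D.f (D.g α) ≠ D.f (D.g δ) := fun h =>
    q.α_ne_δ (D.g_injective (D.f.injective h))
  have hNτ : D.N τ = 4 := by rw [← D.N_g, hgτ, q.N_ν, hα]
  have hNρ : D.N ρ = 4 := by rw [← D.N_g, hgρ, hβ]
  have hNδ : D.N δ = 4 := by rw [q.N_δ, hβ]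
  have hNν : D.N ν = 4 := by rw [q.N_ν, hα]
  have hNgδ : D.N (D.g δ) = 4 := by rw [D.N_g, hNδ]
  have hNgα : D.N (D.g α) = 4 := by rw [D.N_g, hα]
  have hNξ' : D.N (D.f (D.g δ)) = 2 := by rw [← hgξ, D.N_g, hv]
  have hNne : ∀ {a b}, D.N a = 4 → D.N b = 2 → a ≠ b := fun {a b} h1 h2 h => by
    rw [h, h2] at h1; omega
  have hατ : τ ≠ α := fun h => hν <| D.g_injective <| by rw [hggα, h, q.g_ν]
  have hαρ : ρ ≠ α := fun h => D.bar_ne β <| by rw [q.bar_β, ← hfρ, h, q.f_α]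
  have hδτ : τ ≠ δ := fun h => D.bar_ne ν <| by rw [q.bar_ν, ← hgτ, h]
  have hδρ : ρ ≠ δ := fun h => hgδ <| by rw [← h, hgρ]
  have hτρ : ρ ≠ τ := fun h => q.α_ne_δ <| D.g_injective <| by rw [← hfρ, h, hfτ]
  have hs42 : ∀ {a b}, D.N a = 4 → D.N (D.bar a) = 4 → D.N b = 2 → D.s a ≠ D.s b :=
    fun h1 h2 h3 => s_ne_of (hNne h1 h3).symm (hNne h2 h3).symm
  have hsκ : D.s κ = D.s α := by rw [← q.bar_α, D.s_bar]
  have hsσ : D.s σ = D.s δ := by rw [← q.bar_δ, D.s_bar]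
  have hsξ : D.s (D.f (D.g α)) = D.s τ := by rw [← hbarξ, D.s_bar]
  have hsξ' : D.s (D.f (D.g δ)) = D.s ρ := by rw [← hbarξ', D.s_bar]
  have hNbarβ : D.N (D.bar β) = 4 := by rw [q.bar_β, hNgα]
  have hNbarν : D.N (D.bar ν) = 4 := by rw [q.bar_ν, hNgδ]
  have h10 : D.s β ≠ D.s α := hsκ ▸ hs42 hβ hNbarβ q.N_κ
  have h12 : D.s β ≠ D.s δ := hsσ ▸ hs42 hβ hNbarβ q.N_σ
  have h14 : D.s β ≠ D.s τ := hsξ ▸ hs42 hβ hNbarβ hv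
  have h15 : D.s β ≠ D.s ρ := hsξ' ▸ hs42 hβ hNbarβ hNξ'
  have h30 : D.s ν ≠ D.s α := hsκ ▸ hs42 hNν hNbarν q.N_κ
  have h32 : D.s ν ≠ D.s δ := hsσ ▸ hs42 hNν hNbarν q.N_σ
  have h34 : D.s ν ≠ D.s τ := hsξ ▸ hs42 hNν hNbarν hv
  have h35 : D.s ν ≠ D.s ρ := hsξ' ▸ hs42 hNν hNbarν hNξ'
  have h02 : D.s α ≠ D.s δ :=
    s_ne_of q.α_ne_δ.symm (by rw [q.bar_α]; exact hNne hNδ q.N_κ)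
  have h04 : D.s α ≠ D.s τ := s_ne_of hατ (by rw [q.bar_α]; exact hNne hNτ q.N_κ)
  have h05 : D.s α ≠ D.s ρ := s_ne_of hαρ (by rw [q.bar_α]; exact hNne hNρ q.N_κ)
  have h13 : D.s β ≠ D.s ν := s_ne_of q.β_ne_ν.symm (by rw [q.bar_β]; exact Ne.symm hν)
  have h24 : D.s δ ≠ D.s τ := s_ne_of hδτ (by rw [q.bar_δ]; exact hNne hNτ q.N_σ)
  have h25 : D.s δ ≠ D.s ρ := s_ne_of hδρ (by rw [q.bar_δ]; exact hNne hNρ q.N_σ)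
  have h45 : D.s τ ≠ D.s ρ :=
    s_ne_of hτρ (by rw [hbarτ]; exact hNne hNρ hv)
  let v : Fin 6 → V := ![D.s α, D.s β, D.s δ, D.s ν, D.s τ, D.s ρ]
  have hvinj : Function.Injective v := by
    intro a b hab
    fin_cases a <;> fin_cases b <;>
      simp [v, h02, h04, h05, h10, h12, h13, h14, h15, h24, h25, h30, h32, h34, h35, h45,
        h02.symm, h04.symm, h05.symm, h10.symm, h12.symm, h13.symm, h14.symm, h15.symm,
        h24.symm, h25.symm, h30.symm, h32.symm, h34.symm, h35.symm, h45.symm] at hab ⊢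
  let a : Fin 4 × Fin 3 → A := fun x =>
    ![![α, β, σ], ![κ, δ, ν], ![D.g α, D.f (D.g α), ρ], ![τ, D.g δ, D.f (D.g δ)]] x.1 x.2
  obtain ⟨v', a', ha', hs', hf'⟩ := exists_equiv_of_closed (D := D) hvinj (a := a)
    (src := fun x => sphericalSource x.1 x.2) (rot := fun x => (x.1, x.2 + 1))
    -- The table of the involution: positions of the two arrows with the same source in
    -- `sphericalSource`.
    (par := fun x => ![![(1, 0), (2, 0), (1, 1)], ![(0, 0), (0, 2), (3, 1)],
      ![(0, 1), (3, 0), (3, 2)], ![(2, 1), (1, 2), (2, 2)]] x.1 x.2) (by decide)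
    (by
      rintro ⟨T, k⟩
      fin_cases T <;> fin_cases k
      · rfl
      · rfl
      · change D.s σ = D.s δ
        rw [← q.bar_δ, D.s_bar]
      · change D.s κ = D.s α
        rw [← q.bar_α, D.s_bar]
      · rfl
      · rfl
      · change D.s (D.g α) = D.s β
        rw [← q.bar_β, D.s_bar]
      · change D.s (D.f (D.g α)) = D.s τ
        rw [← hbarξ, D.s_bar]
      · rfl
      · rfl
      · change D.s (D.g δ) = D.s ν
        rw [← q.bar_ν, D.s_bar]
      · change D.s (D.f (D.g δ)) = D.s ρ
        rw [← hbarξ', D.s_bar])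
    (by
      rintro ⟨T, k⟩
      fin_cases T <;> fin_cases k
      exacts [q.f_α, q.f_β, q.f_σ, q.f_κ, q.f_δ, q.f_ν, rfl, rfl, hfρ, hfτ, rfl, rfl])
    (by
      rintro ⟨T, k⟩
      fin_cases T <;> fin_cases k
      exacts [q.bar_α, q.bar_β, q.bar_σ, q.bar_κ, q.bar_δ, q.bar_ν,
        (D.bar_g α).trans q.f_α, hbarξ, hbarρ, hbarτ,
        (D.bar_g δ).trans q.f_δ, hbarξ'])
    (by decide)
  have hn4 : ∀ {b}, D.N b = 4 → D.g (D.g b) ≠ b → D.m b = 1 := fun {b} h1 h2 => by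
    have h3 := D.iterate_N b
    rw [h1] at h3
    have h4 := n_eq_four h2 h3
    rw [N, h4] at h1
    omega
  have hn2 : ∀ {b}, D.N b = 2 → D.g b ≠ b → D.m b = 1 := fun {b} h1 h2 => by
    have h4 := n_eq_two h2 (D.g_g_of_virtual h1)
    rw [N, h4] at h1
    omega
  have hmα : D.m α = 1 := hn4 hα (by rw [hggα]; exact hατ)
  have hmδ : D.m δ = 1 := hn4 hNδ (by rw [hggδ]; exact hδρ)
  have hmκ : D.m κ = 1 := hn2 q.N_κ (by rw [q.g_κ]; exact hκσ.symm)
  have hmξ : D.m (D.f (D.g α)) = 1 := hn2 hv (by rw [hgξ]; exact hξ.symm)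
  have hmβ : D.m β = 1 := by rw [← D.m_g, q.g_β, hmδ]
  have hmν : D.m ν = 1 := by rw [← D.m_g, q.g_ν, hmα]
  refine ⟨v', a', fun T k => hs' (T, k), fun T k => hf' (T, k), ?_, ?_⟩
  · intro x
    obtain ⟨⟨T, k⟩, rfl⟩ := a'.surjective x
    rw [ha']
    fin_cases T <;> fin_cases k
    · exact hmα
    · exact hmβ
    · change D.m σ = 1
      rw [← q.g_κ, D.m_g, hmκ]
    · exact hmκ
    · exact hmδ
    · exact hmν
    · exact (D.m_g α).trans hmα
    · exact hmξ
    · change D.m ρ = 1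
      rw [← D.m_g, hgρ, hmβ]
    · change D.m τ = 1
      rw [← D.m_g, hgτ, hmν]
    · exact (D.m_g δ).trans hmδ
    · change D.m (D.f (D.g δ)) = 1
      rw [← hgξ, D.m_g, hmξ]
  · rw [ha', ha', ha', ha']
    change D.c α * D.c β * D.c κ * D.c (D.f (D.g α)) = 1
    rw [← hc]
    ring

/-- The critical coefficient in `relator_mul_g` vanishes only for the two excluded algebras, told
apart by whether the cycle of `α` closes up after two steps. -/
theorem not_singular (hsph : ¬ D.IsSingularSpherical) (htri : ¬ D.IsSingularTriangle)
    (hα : D.N α = 4) (hβ : D.N β = 4) (hv : D.N (D.f (D.g α)) = 2) :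
    D.c κ * D.c α * D.c (D.f (D.g α)) * D.c β ≠ 1 := fun hc => by
  by_cases hν : D.g α = ν
  · exact htri (q.isSingularTriangle hα hβ hν hc)
  · exact hsph (q.isSingularSpherical hα hβ hv hν hc)

end Quad

end WeightedTriangulationQuiver

theorem lemma5p2 {K V A : Type*} [Field K] [IsAlgClosed K] [Fintype V] [Fintype A]
    (hV : 3 ≤ Fintype.card V) (D : WeightedTriangulationQuiver V A K)
    (hsph : ¬ D.IsSingularSpherical) (htri : ¬ D.IsSingularTriangle)
    (α : A) (hvirt : D.IsVirtual (D.bar α)) (hloop : D.s (D.bar α) ≠ D.t (D.bar α))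
    (i j y : V) (hi : i = D.s α) (hj : j = D.t α) (hy : y = D.t (D.f (D.bar α))) :
    ∃ (ι : D.S i →ₗ[(D.Alg)ᵐᵒᵖ] D.P i)
      (a : (D.P i ⧸ LinearMap.range ι) →ₗ[(D.Alg)ᵐᵒᵖ] D.P y)
      (b : D.P y →ₗ[(D.Alg)ᵐᵒᵖ] D.P j)
      (c : D.P j →ₗ[(D.Alg)ᵐᵒᵖ] D.syzygy i),
      IsInjectiveEnvelope ι ∧
      (Function.Injective a ∧ Function.Exact a b ∧ Function.Exact b c ∧ Function.Surjective c) ∧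
      IsMinimalProjectiveResolution (fun n => D.P (periodicIndex i j y n))
        (periodicDifferential (P := fun v => D.P v) ((D.syzygy i).subtype ∘ₗ c) b
          (a ∘ₗ (LinearMap.range ι).mkQ) (ι ∘ₗ D.cover i))
        (D.cover i) ∧
      HasPeriod (fun n => D.P (periodicIndex i j y n))
        (periodicDifferential (P := fun v => D.P v) ((D.syzygy i).subtype ∘ₗ c) b
          (a ∘ₗ (LinearMap.range ι).mkQ) (ι ∘ₗ D.cover i))
        (D.S i) 4 := by
  have q := D.quad_of_virtual hvirt hloop
  exact q.periodic_resolution (q.not_singular hsph htri) hi (hj.trans (D.s_f α).symm)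
    (hy.trans (D.s_f _).symm)
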